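/- Let $K$ be $\mathrm{SO}(n)$, $\mathrm{SU}(n)$ or $\mathrm{Sp}(n)$, where $\mathrm{Sp}(n)$ is the compact group of all quaternionic $n\times n$ matrices $A$ with $A^*A=AA^*=1$. For $0\le k\le n$ the lower $k\times k$ block of $K$ is the subgroup of all matrices $\operatorname{diag}(I_{n-k},B)$ in $K$ with $B$ of size $k\times k$. Let $H$ be a closed connected proper subgroup of $K$ that contains the lower $k\times k$ block for some $k\le n$, where $k\ge 3$ if $K=\mathrm{SO}(n)$ or $K=\mathrm{SU}(n)$, and $k\ge 2$ if $K=\mathrm{Sp}(n)$. Suppose that $K/H$ admits a $K$-invariant Riemannian metric all of whose sectional curvatures are positive. Then $H$ contains a subgroup conjugate in $K$ to the lower $(n-1)\times(n-1)$ block, and up to conjugation in $K$ the pair $(K,H)$ is one of the following standard presentations of spheres and projective spaces: - $(\mathrm{SO}(n),\mathrm{SO}(n-1))$, with $K/H=\mathbb S^{n-1}$; - $(\mathrm{SU}(n),\mathrm{SU}(n-1))$, with $K/H=\mathbb S^{2n-1}$, or $(\mathrm{SU}(n),\mathrm{U}(n-1))$, with $K/H=\mathbb{CP}^{n-1}$;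 - $(\mathrm{Sp}(n),\mathrm{Sp}(n-1))$, with $K/H=\mathbb S^{4n-1}$, or $(\mathrm{Sp}(n),\mathrm{Sp}(n-1)\mathrm{Sp}(1))$, with $K/H=\mathbb{HP}^{n-1}$, or $(\mathrm{Sp}(n),\mathrm{Sp}(n-1)\mathrm{U}(1))$, with $K/H=\mathbb{CP}^{2n-1}$. Here $\mathrm{SO}(n-1)$, $\mathrm{SU}(n-1)$, $\mathrm{Sp}(n-1)$ are the lower $(n-1)\times(n-1)$ blocks, $\mathrm{U}(n-1)\subset\mathrm{SU}(n)$ and $\mathrm{Sp}(n-1)\mathrm{Sp}(1)\subset\mathrm{Sp}(n)$ are the subgroups of all matrices $\operatorname{diag}(a,B)$ in $K$ with $a$ of size $1\times 1$ and $B$ of size $(n-1)\times(n-1)$, and $\mathrm{Sp}(n-1)\mathrm{U}(1)$ is the subgroup of $\mathrm{Sp}(n-1)\mathrm{Sp}(1)$ given by $a\in\mathrm{U}(1)=\mathbb C\cap\mathrm{Sp}(1)$. -/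

import Mathlib

namespace BlockLemma

open scoped ContDiff

/-! ## The classical groups and their standard subgroups -/

/-- `Mat n 𝔽` is the ring of `n × n` matrices over `𝔽`. -/
abbrev Mat (n : ℕ) (𝔽 : Type) : Type := Matrix (Fin n) (Fin n) 𝔽

/-- The group of all `n × n` matrices `A` over `𝔽` with `A* A = A A* = 1`, where `A*` is the conjugate
transpose: this is `O(n)`, `U(n)`, `Sp(n)` for `𝔽 = ℝ, ℂ, ℍ`. It carries the topology of a subspace of
the space of matrices. -/
abbrev UGroup (n : ℕ) (𝔽 : Type) [NormedDivisionRing 𝔽] [StarRing 𝔽] : Type :=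
  ↥(unitary (Mat n 𝔽))

/-- The special orthogonal group `SO(n)`. -/
def SO (n : ℕ) : Subgroup (UGroup n ℝ) where
  carrier := {A | (A : Mat n ℝ) ∈ Matrix.specialOrthogonalGroup (Fin n) ℝ}
  mul_mem' hA hB := (Matrix.specialOrthogonalGroup (Fin n) ℝ).mul_mem hA hB
  one_mem' := (Matrix.specialOrthogonalGroup (Fin n) ℝ).one_mem
  inv_mem' hA := (star (⟨_, hA⟩ : Matrix.specialOrthogonalGroup (Fin n) ℝ)).2

/-- The special unitary group `SU(n)`. -/
def SU (n : ℕ) : Subgroup (UGroup n ℂ) where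
  carrier := {A | (A : Mat n ℂ) ∈ Matrix.specialUnitaryGroup (Fin n) ℂ}
  mul_mem' hA hB := (Matrix.specialUnitaryGroup (Fin n) ℂ).mul_mem hA hB
  one_mem' := (Matrix.specialUnitaryGroup (Fin n) ℂ).one_mem
  inv_mem' hA := (star (⟨_, hA⟩ : Matrix.specialUnitaryGroup (Fin n) ℂ)).2

/-- The compact symplectic group `Sp(n)`: all quaternionic matrices with `A* A = A A* = 1`. -/
noncomputable def Sp (n : ℕ) : Subgroup (UGroup n (Quaternion ℝ)) := ⊤

section Groups

variable {n : ℕ} {𝔽 : Type} [NormedDivisionRing 𝔽] [StarRing 𝔽]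

theorem coe_inv_apply (A : UGroup n 𝔽) (i j : Fin n) :
    ((A⁻¹ : UGroup n 𝔽) : Mat n 𝔽) i j = star ((A : Mat n 𝔽) j i) := rfl

/-- The lower `k × k` block of `K`: the matrices `diag(1, B)` in `K` with `B` of size `k × k`.
(The index `i` belongs to the upper `n - k` indices iff `i + k < n`.) -/
def block (K : Subgroup (UGroup n 𝔽)) (k : ℕ) : Subgroup (UGroup n 𝔽) where
  carrier := {A | A ∈ K ∧ ∀ i j : Fin n, (i.val + k < n ∨ j.val + k < n) →
    (A : Mat n 𝔽) i j = (1 : Mat n 𝔽) i j}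
  mul_mem' := by
    rintro A B ⟨hA, hA'⟩ ⟨hB, hB'⟩
    refine ⟨K.mul_mem hA hB, fun i j h => ?_⟩
    change ((A : Mat n 𝔽) * (B : Mat n 𝔽)) i j = _
    rcases h with h | h
    · rw [Matrix.mul_apply, ← hB' i j (Or.inl h)]
      have : ∀ m : Fin n, (A : Mat n 𝔽) i m * (B : Mat n 𝔽) m j
          = (1 : Mat n 𝔽) i m * (B : Mat n 𝔽) m j := fun m => by rw [hA' i m (Or.inl h)]
      rw [Finset.sum_congr rfl fun m _ => this m, ← Matrix.mul_apply, one_mul]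
    · rw [Matrix.mul_apply, ← hA' i j (Or.inr h)]
      have : ∀ m : Fin n, (A : Mat n 𝔽) i m * (B : Mat n 𝔽) m j
          = (A : Mat n 𝔽) i m * (1 : Mat n 𝔽) m j := fun m => by rw [hB' m j (Or.inr h)]
      rw [Finset.sum_congr rfl fun m _ => this m, ← Matrix.mul_apply, mul_one]
  one_mem' := ⟨K.one_mem, fun _ _ _ => rfl⟩
  inv_mem' := by
    rintro A ⟨hA, hA'⟩
    refine ⟨K.inv_mem hA, fun i j h => ?_⟩
    rw [coe_inv_apply, hA' j i h.symm, ← Matrix.star_apply, star_one]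

/-- The block diagonal matrices `diag(a, B)` in `K` with `a` of size `1 × 1` and `B` of size
`(n - 1) × (n - 1)`. For `K = SU(n)` this is `U(n - 1)` (that is, `S(U(1)U(n - 1))`), for `K = Sp(n)`
it is `Sp(n - 1)Sp(1)`. -/
def splitBlock (K : Subgroup (UGroup n 𝔽)) : Subgroup (UGroup n 𝔽) where
  carrier := {A | A ∈ K ∧ ∀ i j : Fin n, i.val = 0 → j.val ≠ 0 →
    (A : Mat n 𝔽) i j = 0 ∧ (A : Mat n 𝔽) j i = 0}
  mul_mem' := by
    rintro A B ⟨hA, hA'⟩ ⟨hB, hB'⟩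
    refine ⟨K.mul_mem hA hB, fun i j hi hj => ⟨?_, ?_⟩⟩
    · change ((A : Mat n 𝔽) * (B : Mat n 𝔽)) i j = _
      rw [Matrix.mul_apply]
      refine Finset.sum_eq_zero fun m _ => ?_
      by_cases hm : m.val = 0
      · rw [(hB' m j hm hj).1, mul_zero]
      · rw [(hA' i m hi hm).1, zero_mul]
    · change ((A : Mat n 𝔽) * (B : Mat n 𝔽)) j i = _
      rw [Matrix.mul_apply]
      refine Finset.sum_eq_zero fun m _ => ?_
      by_cases hm : m.val = 0
      · rw [(hA' m j hm hj).2, zero_mul]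
      · rw [(hB' i m hi hm).2, mul_zero]
  one_mem' := by
    refine ⟨K.one_mem, fun i j hi hj => ?_⟩
    have hij : i ≠ j := fun h => hj (h ▸ hi)
    exact ⟨Matrix.one_apply_ne hij, Matrix.one_apply_ne hij.symm⟩
  inv_mem' := by
    rintro A ⟨hA, hA'⟩
    refine ⟨K.inv_mem hA, fun i j hi hj => ⟨?_, ?_⟩⟩
    · rw [coe_inv_apply, (hA' i j hi hj).2, star_zero]
    · rw [coe_inv_apply, (hA' i j hi hj).1, star_zero]

end Groups

/-- The subgroup `Sp(n - 1)U(1)` of `Sp(n)`: the block diagonal matrices `diag(a, B)` with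
`B ∈ Sp(n - 1)` and `a ∈ U(1) = {x + y i ∈ ℍ | x² + y² = 1}`. -/
noncomputable def spU (n : ℕ) : Subgroup (UGroup n (Quaternion ℝ)) where
  carrier := {A | A ∈ splitBlock (Sp n) ∧ ∀ i : Fin n, i.val = 0 →
    ((A : Mat n (Quaternion ℝ)) i i).imJ = 0 ∧ ((A : Mat n (Quaternion ℝ)) i i).imK = 0}
  mul_mem' := by
    rintro A B ⟨hA, hA'⟩ ⟨hB, hB'⟩
    refine ⟨(splitBlock (Sp n)).mul_mem hA hB, fun i hi => ?_⟩
    have key : ((A * B : UGroup n (Quaternion ℝ)) : Mat n (Quaternion ℝ)) i i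
        = (A : Mat n (Quaternion ℝ)) i i * (B : Mat n (Quaternion ℝ)) i i := by
      change ((A : Mat n (Quaternion ℝ)) * (B : Mat n (Quaternion ℝ))) i i = _
      rw [Matrix.mul_apply]
      refine Finset.sum_eq_single i (fun m _ hm => ?_) (fun h => absurd (Finset.mem_univ i) h)
      have hm0 : m.val ≠ 0 := fun h => hm (Fin.ext (h.trans hi.symm))
      rw [(hA.2 i m hi hm0).1, zero_mul]
    obtain ⟨a1, a2⟩ := hA' i hi
    obtain ⟨b1, b2⟩ := hB' i hi
    rw [key]
    simp [a1, a2, b1, b2]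
  one_mem' := by
    refine ⟨(splitBlock (Sp n)).one_mem, fun i _ => ?_⟩
    change ((1 : Mat n (Quaternion ℝ)) i i).imJ = 0 ∧ ((1 : Mat n (Quaternion ℝ)) i i).imK = 0
    rw [Matrix.one_apply_eq]
    exact ⟨rfl, rfl⟩
  inv_mem' := by
    rintro A ⟨hA, hA'⟩
    refine ⟨(splitBlock (Sp n)).inv_mem hA, fun i hi => ?_⟩
    rw [coe_inv_apply]
    simp [(hA' i hi).1, (hA' i hi).2]

section Conjugation

variable {G : Type} [Group G]

/-- The conjugate `g L g⁻¹`. -/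
def conjugate (g : G) (L : Subgroup G) : Subgroup G := L.map (MulAut.conj g).toMonoidHom

/-- `H` is conjugate to `L` by an element of `K`. -/
def IsConjugateIn (K H L : Subgroup G) : Prop := ∃ g ∈ K, H = conjugate g L

end Conjugation

/-! ## Sectional curvature of a Riemannian metric in coordinates

`g x` is the matrix `(g_ij(x))` of the metric at the point `x ∈ ℝᵈ`. -/

section Coordinates

variable {d : ℕ}

/-- The partial derivative `∂_i f (x)`. -/
noncomputable def partialDeriv (i : Fin d) (f : (Fin d → ℝ) → ℝ) (x : Fin d → ℝ) : ℝ :=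
  fderiv ℝ f x (Pi.single i 1)

/-- The Christoffel symbol
`Γ^l_ij = ½ ∑_m g^{lm} (∂_i g_jm + ∂_j g_im - ∂_m g_ij)` of the Levi-Civita connection. -/
noncomputable def christoffel (g : (Fin d → ℝ) → Matrix (Fin d) (Fin d) ℝ) (l i j : Fin d)
    (x : Fin d → ℝ) : ℝ :=
  (1 / 2) * ∑ m, (g x)⁻¹ l m *
    (partialDeriv i (fun y => g y j m) x + partialDeriv j (fun y => g y i m) x
      - partialDeriv m (fun y => g y i j) x)

/-- The component `R^l_ijk` of the curvature tensor
`R(X,Y)Z = ∇_X ∇_Y Z - ∇_Y ∇_X Z - ∇_[X,Y] Z`, that is, `R(∂_i,∂_j)∂_k = ∑_l R^l_ijk ∂_l`. -/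
noncomputable def riemannTensor (g : (Fin d → ℝ) → Matrix (Fin d) (Fin d) ℝ) (l i j k : Fin d)
    (x : Fin d → ℝ) : ℝ :=
  partialDeriv i (christoffel g l j k) x - partialDeriv j (christoffel g l i k) x
    + ∑ m, (christoffel g m j k x * christoffel g l i m x
        - christoffel g m i k x * christoffel g l j m x)

/-- The scalar product `⟨v,w⟩` at `x`. -/
noncomputable def innerAt (g : (Fin d → ℝ) → Matrix (Fin d) (Fin d) ℝ) (x v w : Fin d → ℝ) : ℝ :=
  ∑ i, ∑ j, g x i j * v i * w j

/-- The vector `R(v,w)z` at `x`. -/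
noncomputable def curvatureVec (g : (Fin d → ℝ) → Matrix (Fin d) (Fin d) ℝ)
    (x v w z : Fin d → ℝ) : Fin d → ℝ :=
  fun l => ∑ i, ∑ j, ∑ k, riemannTensor g l i j k x * v i * w j * z k

/-- The sectional curvature `⟨R(v,w)w,v⟩ / (|v|²|w|² - ⟨v,w⟩²)` of the plane spanned by `v, w` at `x`. -/
noncomputable def sectionalCurvature (g : (Fin d → ℝ) → Matrix (Fin d) (Fin d) ℝ)
    (x v w : Fin d → ℝ) : ℝ :=
  innerAt g x (curvatureVec g x v w w) v /
    (innerAt g x v v * innerAt g x w w - innerAt g x v w ^ 2)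

end Coordinates

/-! ## Riemannian metrics on `K/H`

`H ≤ K` are closed subgroups of `UGroup n 𝔽` and `π : K → K/H` is the projection. The tangent space of `K/H`
at `π(A)` is the quotient of the tangent space of `K` at `A` by the tangent space of the coset `A H`. -/

section Homogeneous

variable {n : ℕ} {𝔽 : Type} [NormedDivisionRing 𝔽] [NormedAlgebra ℝ 𝔽] [StarRing 𝔽]

/-- The Lie algebra of a closed subgroup `L`: all matrices `X` with `exp(tX) ∈ L` for all real `t`. -/
def lieAlg (L : Subgroup (UGroup n 𝔽)) : Set (Mat n 𝔽) :=
  {X | ∀ t : ℝ, ∃ A ∈ L, (A : Mat n 𝔽) = NormedSpace.exp (t • X)}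

/-- The tangent space at `A` of the coset `A L`: all matrices `A X` with `X` in the Lie algebra of `L`.
For `A ∈ L` it is the tangent space of `L` at `A`. -/
def tangentAt (L : Subgroup (UGroup n 𝔽)) (A : UGroup n 𝔽) : Set (Mat n 𝔽) :=
  {V | ∃ X ∈ lieAlg L, V = (A : Mat n 𝔽) * X}

/-- Smoothness on `U` of a matrix valued map (all entries are smooth). -/
def SmoothOn {d : ℕ} (σ : (Fin d → ℝ) → UGroup n 𝔽) (U : Set (Fin d → ℝ)) : Prop :=
  ∀ i j : Fin n, ContDiffOn ℝ ∞ (fun x => (σ x : Mat n 𝔽) i j) U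

/-- The directional derivative `dσ_x(v)`, taken entrywise. -/
noncomputable def velocity {d : ℕ} (σ : (Fin d → ℝ) → UGroup n 𝔽) (x v : Fin d → ℝ) : Mat n 𝔽 :=
  Matrix.of fun i j => fderiv ℝ (fun y => (σ y : Mat n 𝔽) i j) x v

/-- `σ : U → K` is a smooth map on an open set `U ⊆ ℝᵈ` for which `π ∘ σ : U → K/H` is a local
diffeomorphism, that is, for all `x ∈ U` the map `v ↦ dσ_x(v)` induces a bijection of `ℝᵈ` onto
`T_A K / T_A(A H)`, where `A = σ(x)`. So `π ∘ σ` is a local coordinate system of `K/H` near every point of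
`U`, and every local coordinate system has this form locally. -/
structure IsLocalParam (K H : Subgroup (UGroup n 𝔽)) {d : ℕ} (σ : (Fin d → ℝ) → UGroup n 𝔽)
    (U : Set (Fin d → ℝ)) : Prop where
  isOpen : IsOpen U
  smooth : SmoothOn σ U
  mem : ∀ x ∈ U, σ x ∈ K
  bij : ∀ x ∈ U, ∀ V ∈ tangentAt K (σ x), ∃! v : Fin d → ℝ, V - velocity σ x v ∈ tangentAt H (σ x)

/-- A Riemannian metric on `K/H`, given by its pullback under `π : K → K/H`: a smooth field of symmetric
positive semidefinite forms on the tangent spaces of `K` whose kernel at `A` is the tangent space of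
`A H`, and which is invariant under right translations by elements of `H`. Only the values of `form A` for
`A ∈ K` on vectors in the tangent space of `K` at `A` matter. -/
structure QuotientMetric (K H : Subgroup (UGroup n 𝔽)) where
  form : UGroup n 𝔽 → LinearMap.BilinForm ℝ (Mat n 𝔽)
  symm : ∀ A ∈ K, ∀ V ∈ tangentAt K A, ∀ W ∈ tangentAt K A, form A V W = form A W V
  nonneg : ∀ A ∈ K, ∀ V ∈ tangentAt K A, 0 ≤ form A V V
  eq_zero_iff : ∀ A ∈ K, ∀ V ∈ tangentAt K A, (form A V V = 0 ↔ V ∈ tangentAt H A)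
  right_inv : ∀ A ∈ K, ∀ B ∈ H, ∀ V ∈ tangentAt K A, ∀ W ∈ tangentAt K A,
    form (A * B) (V * (B : Mat n 𝔽)) (W * (B : Mat n 𝔽)) = form A V W
  smooth : ∀ (d : ℕ) (σ : (Fin d → ℝ) → UGroup n 𝔽) (U : Set (Fin d → ℝ)), IsOpen U →
    SmoothOn σ U → (∀ x ∈ U, σ x ∈ K) → ∀ v w : Fin d → ℝ,
      ContDiffOn ℝ ∞ (fun x => form (σ x) (velocity σ x v) (velocity σ x w)) U

/-- The metric is `K`-invariant: left translations by elements of `K` act on `K/H` by isometries. -/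
def QuotientMetric.IsInvariant {K H : Subgroup (UGroup n 𝔽)} (g : QuotientMetric K H) : Prop :=
  ∀ A ∈ K, ∀ B ∈ K, ∀ V ∈ tangentAt K B, ∀ W ∈ tangentAt K B,
    g.form (A * B) ((A : Mat n 𝔽) * V) ((A : Mat n 𝔽) * W) = g.form B V W

/-- The matrix `(g_ij)` of the metric in the local coordinate system `π ∘ σ`. -/
noncomputable def QuotientMetric.coeff {K H : Subgroup (UGroup n 𝔽)} (g : QuotientMetric K H) {d : ℕ}
    (σ : (Fin d → ℝ) → UGroup n 𝔽) (x : Fin d → ℝ) : Matrix (Fin d) (Fin d) ℝ :=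
  Matrix.of fun i j =>
    g.form (σ x) (velocity σ x (Pi.single i 1)) (velocity σ x (Pi.single j 1))

/-- Positive sectional curvature: all planes at all points of `K/H` have positive curvature. -/
def QuotientMetric.PositivelyCurved {K H : Subgroup (UGroup n 𝔽)} (g : QuotientMetric K H) : Prop :=
  ∀ (d : ℕ) (σ : (Fin d → ℝ) → UGroup n 𝔽) (U : Set (Fin d → ℝ)), IsLocalParam K H σ U →
    ∀ x ∈ U, ∀ v w : Fin d → ℝ, LinearIndependent ℝ ![v, w] →
      0 < sectionalCurvature (g.coeff σ) x v w

/-- `K/H` admits a `K`-invariant Riemannian metric of positive sectional curvature. -/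
def AdmitsPositiveCurvature (K H : Subgroup (UGroup n 𝔽)) : Prop :=
  ∃ g : QuotientMetric K H, g.IsInvariant ∧ g.PositivelyCurved

end Homogeneous

end BlockLemma

/-!
The theorem is a statement about homogeneous metrics and is proved on the level of Lie algebras.

**Curvature.** The only information taken from positive curvature is a rigidity statement: an invariant
metric of `K/H` of positive curvature admits no two commuting vectors `X`, `Y` of the Lie algebra of `K`,
independent modulo that of `H`, such that `⟨[P, W], Q⟩ + ⟨P, [Q, W]⟩ = 0` for all `W` and all
`P, Q ∈ {X, Y}`. Indeed, in the coordinates `exp (x₀ X + x₁ Y) exp (∑ xₘ Bₘ)` the metric coefficients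
do not depend on `x₀` and `x₁`, and the condition says that the surface spanned by `X` and `Y` is totally
geodesic; so its Christoffel symbols and its curvature vanish (`false_of_flat_pair`).

**The off-diagonal part.** Suppose that `H` contains the lower `k × k` block, and write a matrix in
blocks of sizes `n - k` and `k`. The lower block algebra generates the full matrix ring `Mat k 𝔽`
(`IsBlockGroup.generate`). Hence the upper right corners of the elements of the Lie algebra of `H` form
a module over that ring (`IsBlockGroup.off_mul_mem`), and the metric, restricted to the matrices
`V - V*` with `V` an arbitrary corner, satisfies `⟨V T, W⟩ = ⟨V, W T*⟩` (`IsotropyForm.off_adjoint`);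
moreover these matrices are orthogonal to the block diagonal ones (`IsotropyForm.off_apply`).

* If `H` has no off-diagonal part and `n - k ≥ 2`, an eigenvector of the metric in the last column and
  an orthogonal eigenvector in the preceding column are commuting eigenvectors of the metric on the
  Lie algebra of `K`; they span a flat surface (`IsotropyForm.false_of_blockDiag`).
* If `H` has a nonzero off-diagonal part, it contains all corners `u y*` for some fixed unit vector
  `u`, which a rotation in `K` of the upper coordinates moves to the last upper coordinate vector. The
  rotations obtained in this way generate the lower `(k + 1) × (k + 1)` block together with the
  `k × k` block (`IsBlockGroup.exists_conjugate_block_succ`).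

By induction `H` contains a conjugate of the block of codimension one, and after conjugation it is
block diagonal because it is a proper subgroup (`exists_conjugate_block_pred`).

**Codimension one.** Since `H` is connected, it is determined by its Lie algebra
(`le_of_exp_lieAlg`), which rests on the theorem that a closed subgroup is locally the exponential of
its Lie algebra (`eventually_mem_exp_lieSet`). So `H` is determined by the set of first diagonal entries
of the elements of its Lie algebra: a subalgebra of the imaginary elements of `ℝ`, `ℂ` or `ℍ`, that is,
`0`, a line, or all imaginary quaternions.
-/

namespace BlockLemma

open Filter Topology NormedSpace Matrix
open scoped ContDiff

set_option linter.unusedSectionVars false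

/-! ### One-parameter subgroups of closed submonoids of a Banach algebra -/

section Banach

variable {𝔸 : Type*} [NormedRing 𝔸] [NormedAlgebra ℝ 𝔸]

/-- The set of all `X` whose one-parameter group `exp (t X)` stays in `S`. -/
def lieSet (S : Set 𝔸) : Set 𝔸 := {X | ∀ t : ℝ, exp (t • X) ∈ S}

variable [CompleteSpace 𝔸]

theorem exp_add_comm {x y : 𝔸} (h : Commute x y) : exp (x + y) = exp x * exp y := by
  let _ : NormedAlgebra ℚ 𝔸 := NormedAlgebra.restrictScalars ℚ ℝ 𝔸
  exact exp_add_of_commute h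

theorem continuous_exp' : Continuous (exp : 𝔸 → 𝔸) := by
  let _ : NormedAlgebra ℚ 𝔸 := NormedAlgebra.restrictScalars ℚ ℝ 𝔸
  exact exp_continuous

theorem exp_mul_exp_neg (x : 𝔸) : exp x * exp (-x) = 1 := by
  rw [← exp_add_comm (Commute.refl x).neg_right, add_neg_cancel, exp_zero]

theorem exp_neg_mul_exp (x : 𝔸) : exp (-x) * exp x = 1 := by
  rw [← exp_add_comm (Commute.refl x).neg_left, neg_add_cancel, exp_zero]

theorem exp_natCast_smul (m : ℕ) (x : 𝔸) : exp ((m : ℝ) • x) = exp x ^ m := by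
  let _ : NormedAlgebra ℚ 𝔸 := NormedAlgebra.restrictScalars ℚ ℝ 𝔸
  rw [Nat.cast_smul_eq_nsmul, NormedSpace.exp_nsmul]

/-- `exp` intertwines: if `a x = x b` then `exp a x = x exp b`. -/
theorem exp_mul_eq_mul_exp {a b x : 𝔸} (h : a * x = x * b) : exp a * x = x * exp b := by
  let _ : NormedAlgebra ℚ 𝔸 := NormedAlgebra.restrictScalars ℚ ℝ 𝔸
  exact (SemiconjBy.exp_right (x := x) (a := b) (b := a) h.symm).symm

theorem hasDerivAt_exp_smul (X : 𝔸) (t : ℝ) :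
    HasDerivAt (fun s : ℝ => exp (s • X)) (exp (t • X) * X) t := hasDerivAt_exp_smul_const X t

theorem hasDerivAt_exp_smul_zero (X : 𝔸) : HasDerivAt (fun s : ℝ => exp (s • X)) X 0 := by
  simpa using hasDerivAt_exp_smul X 0

theorem hasDerivAt_exp_conj (X Y : 𝔸) :
    HasDerivAt (fun s : ℝ => exp (-(s • X)) * Y * exp (s • X)) (Y * X - X * Y) 0 := by
  have h1 : HasDerivAt (fun s : ℝ => exp (-(s • X))) (-X) 0 := by
    simpa [smul_neg] using hasDerivAt_exp_smul_zero (-X)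
  have h := (h1.mul_const Y).mul (hasDerivAt_exp_smul_zero X)
  refine h.congr_deriv ?_
  simp [exp_zero]; abel

/-- A plane rotation: if `G` acts by `a ↦ -b`, `b ↦ a`, then `exp (t G)` turns `cos t a + sin t b`
into `a`. -/
theorem exp_smul_mul_rotation {G a b : 𝔸} (ha : G * a = -b) (hb : G * b = a) (t : ℝ) :
    exp (t • G) * (Real.cos t • a + Real.sin t • b) = a := by
  have hd : ∀ s : ℝ, HasDerivAt
      (fun t : ℝ => exp (t • G) * (Real.cos t • a + Real.sin t • b)) 0 s := by
    intro s
    have h2 : HasDerivAt (fun t : ℝ => Real.cos t • a + Real.sin t • b)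
        (-Real.sin s • a + Real.cos s • b) s :=
      ((Real.hasDerivAt_cos s).smul_const a).add ((Real.hasDerivAt_sin s).smul_const b)
    refine ((hasDerivAt_exp_smul G s).mul h2).congr_deriv ?_
    rw [mul_assoc, ← mul_add, mul_add G, mul_smul_comm, mul_smul_comm, ha, hb]
    have : Real.cos s • -b + Real.sin s • a + (-Real.sin s • a + Real.cos s • b) = 0 := by
      simp only [smul_neg, neg_smul]; abel
    rw [this, mul_zero]
  have hc := is_const_of_deriv_eq_zero (fun s => (hd s).differentiableAt)
    (fun s => (hd s).deriv) t 0
  simpa using hc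

variable {S : Submonoid 𝔸}

/-- If a curve in a closed submonoid starts at `1` with velocity `Z`, then `Z` generates a
one-parameter group in the submonoid: `exp (t Z)` is the limit of `γ (t / m) ^ m`. -/
theorem mem_lieSet_of_hasDerivAt (hS : IsClosed (S : Set 𝔸)) {γ : ℝ → 𝔸} {Z : 𝔸}
    (hγ : HasDerivAt γ Z 0) (h0 : γ 0 = 1) (hmem : ∀ t, γ t ∈ S) : Z ∈ lieSet (S : Set 𝔸) := by
  intro t
  have hex : HasStrictFDerivAt (exp : 𝔸 → 𝔸)
      ((ContinuousLinearEquiv.refl ℝ 𝔸 : 𝔸 ≃L[ℝ] 𝔸) : 𝔸 →L[ℝ] 𝔸) 0 :=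
    hasStrictFDerivAt_exp_zero
  set log := HasStrictFDerivAt.localInverse exp _ _ hex with hlog
  have hl : HasFDerivAt log (ContinuousLinearMap.id ℝ 𝔸) (γ 0) := by
    have := hex.to_localInverse.hasFDerivAt
    rw [exp_zero] at this
    rw [h0]; exact this
  have hl0 : log 1 = 0 := by
    have := hex.localInverse_apply_image
    rwa [exp_zero] at this
  have hright : ∀ᶠ s in 𝓝 (0 : ℝ), exp (log (γ s)) = γ s := by
    have h1 := hex.eventually_right_inverse
    rw [exp_zero, ← h0] at h1
    exact hγ.continuousAt.eventually h1
  have hd : HasDerivAt (fun s => log (γ s)) Z 0 := by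
    have := hl.comp_hasDerivAt 0 hγ
    simpa using! this
  have hd2 : HasDerivAt (fun s => log (γ (s * t))) (t • Z) 0 := by
    have hm : HasDerivAt (fun s : ℝ => s * t) t 0 := by
      simpa using (hasDerivAt_id (0 : ℝ)).mul_const t
    have hd' : HasDerivAt (fun s => log (γ s)) Z (0 * t) := by rwa [zero_mul]
    exact hd'.scomp 0 hm
  have hslope := hd2.tendsto_slope_zero
  have hseq : Tendsto (fun m : ℕ => ((m : ℝ) + 1)⁻¹) atTop (𝓝[≠] 0) := by
    rw [tendsto_nhdsWithin_iff]
    refine ⟨?_, Eventually.of_forall fun m => ?_⟩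
    · simpa [one_div] using tendsto_one_div_add_atTop_nhds_zero_nat (𝕜 := ℝ)
    · exact inv_ne_zero (by positivity)
  have hlim := hslope.comp hseq
  have hlim2 := (continuous_exp' (𝔸 := 𝔸)).tendsto _ |>.comp hlim
  refine hS.mem_of_tendsto hlim2 ?_
  have hev : ∀ᶠ m : ℕ in atTop,
      exp (log (γ (((m : ℝ) + 1)⁻¹ * t))) = γ (((m : ℝ) + 1)⁻¹ * t) := by
    have hs2 : Tendsto (fun m : ℕ => ((m : ℝ) + 1)⁻¹ * t) atTop (𝓝 0) := by
      simpa using (tendsto_nhdsWithin_iff.1 hseq).1.mul_const t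
    exact hs2.eventually hright
  filter_upwards [hev] with m hm
  simp only [Function.comp, zero_add, inv_inv, zero_mul, h0, hl0, sub_zero]
  have := exp_natCast_smul (m + 1) (log (γ (((m : ℝ) + 1)⁻¹ * t)))
  push_cast at this
  rw [this, hm]
  exact S.pow_mem (hmem _) _

theorem lieSet_add (hS : IsClosed (S : Set 𝔸)) {X Y : 𝔸} (hX : X ∈ lieSet (S : Set 𝔸))
    (hY : Y ∈ lieSet (S : Set 𝔸)) : X + Y ∈ lieSet (S : Set 𝔸) := by
  refine mem_lieSet_of_hasDerivAt hS (γ := fun t => exp (t • X) * exp (t • Y)) ?_ (by simp)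
    fun t => S.mul_mem (hX t) (hY t)
  refine ((hasDerivAt_exp_smul_zero X).mul (hasDerivAt_exp_smul_zero Y)).congr_deriv ?_
  simp

omit [CompleteSpace 𝔸] in
theorem lieSet_smul {X : 𝔸} (hX : X ∈ lieSet (S : Set 𝔸)) (c : ℝ) :
    c • X ∈ lieSet (S : Set 𝔸) := fun t => by
  rw [smul_smul]; exact hX _

omit [CompleteSpace 𝔸] in
theorem lieSet_zero : (0 : 𝔸) ∈ lieSet (S : Set 𝔸) := fun t => by simp [S.one_mem]

/-- The one-parameter groups of a closed submonoid form a linear subspace. -/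
def lieSubmodule (hS : IsClosed (S : Set 𝔸)) : Submodule ℝ 𝔸 where
  carrier := lieSet (S : Set 𝔸)
  add_mem' := lieSet_add hS
  zero_mem' := lieSet_zero
  smul_mem' c _ hX := lieSet_smul hX c

theorem lieSet_conj {A B X : 𝔸} (hA : A ∈ S) (hB : B ∈ S) (hAB : A * B = 1) (hBA : B * A = 1)
    (hX : X ∈ lieSet (S : Set 𝔸)) : A * X * B ∈ lieSet (S : Set 𝔸) := fun t => by
  have h1 : (t • (A * X * B)) * A = A * (t • X) := by
    rw [smul_mul_assoc, mul_assoc _ B, hBA, mul_one, mul_smul_comm]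
  have h2 : exp (t • (A * X * B)) * A = A * exp (t • X) := exp_mul_eq_mul_exp h1
  have : exp (t • (A * X * B)) = A * exp (t • X) * B := by
    rw [← h2, mul_assoc (exp _) A B, hAB, mul_one]
  rw [this]
  exact S.mul_mem (S.mul_mem hA (hX t)) hB

theorem lieSet_bracket [FiniteDimensional ℝ 𝔸] (hS : IsClosed (S : Set 𝔸)) {X Y : 𝔸}
    (hX : X ∈ lieSet (S : Set 𝔸)) (hY : Y ∈ lieSet (S : Set 𝔸)) :
    Y * X - X * Y ∈ lieSet (S : Set 𝔸) := by
  have hcl : IsClosed (lieSubmodule hS : Set 𝔸) := Submodule.closed_of_finiteDimensional _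
  have hd := (hasDerivAt_exp_conj X Y).tendsto_slope_zero
  refine hcl.mem_of_tendsto hd (Eventually.of_forall fun s => ?_)
  refine (lieSubmodule hS).smul_mem _ ((lieSubmodule hS).sub_mem ?_ ?_)
  · refine lieSet_conj ?_ (hX _) (exp_neg_mul_exp _) (exp_mul_exp_neg _) hY
    rw [← neg_smul]; exact hX _
  · have h : Y ∈ lieSubmodule hS := hY
    simpa using h

/-- In a complement of the Lie algebra, small vectors do not exponentiate into `S`: otherwise the
normalized vectors would accumulate at a unit vector generating a one-parameter group in `S`. -/
theorem eventually_eq_zero_of_exp_mem [FiniteDimensional ℝ 𝔸] (hS : IsClosed (S : Set 𝔸))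
    (hinv : ∀ X : 𝔸, exp X ∈ S → exp (-X) ∈ S) {C : Submodule ℝ 𝔸}
    (hC : Disjoint (lieSubmodule hS) C) :
    ∀ᶠ Z in 𝓝 (0 : 𝔸), Z ∈ C → exp Z ∈ S → Z = 0 := by
  by_contra hcon
  have hfreq : ∃ᶠ Z in 𝓝 (0 : 𝔸), Z ∈ C ∧ exp Z ∈ S ∧ Z ≠ 0 := by
    refine (not_eventually.1 hcon).mono fun Z hZ => ?_
    push Not at hZ
    exact hZ
  obtain ⟨u, hu, hu'⟩ := exists_seq_forall_of_frequently hfreq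
  have hne : ∀ m, ‖u m‖ ≠ 0 := fun m => norm_ne_zero_iff.2 (hu' m).2.2
  let _ : ProperSpace 𝔸 := FiniteDimensional.proper ℝ 𝔸
  obtain ⟨Z, hZ, φ, hφ, hlim⟩ := (isCompact_sphere (0 : 𝔸) 1).tendsto_subseq
    (x := fun m => ‖u m‖⁻¹ • u m) fun m => by
      simp [norm_smul, inv_mul_cancel₀ (hne m)]
  have hZC : Z ∈ C := (Submodule.closed_of_finiteDimensional C).mem_of_tendsto hlim
    (Eventually.of_forall fun m => C.smul_mem _ (hu' _).1)
  have hint : ∀ (X : 𝔸), exp X ∈ S → ∀ m : ℤ, exp ((m : ℝ) • X) ∈ S := by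
    intro X hX m
    obtain ⟨k, rfl | rfl⟩ := m.eq_nat_or_neg
    · rw [Int.cast_natCast, exp_natCast_smul]; exact S.pow_mem hX _
    · rw [Int.cast_neg, Int.cast_natCast, neg_smul, ← smul_neg, exp_natCast_smul]
      exact S.pow_mem (hinv _ hX) _
  have hZL : Z ∈ lieSubmodule hS := by
    intro t
    have hn : Tendsto (fun m => ‖u (φ m)‖) atTop (𝓝 0) := by
      simpa using (hu.comp hφ.tendsto_atTop).norm
    have hfl : Tendsto (fun m => (⌊t / ‖u (φ m)‖⌋ : ℝ) * ‖u (φ m)‖) atTop (𝓝 t) := by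
      rw [← tendsto_sub_nhds_zero_iff]
      refine squeeze_zero_norm (fun m => ?_) hn
      have hpos : 0 < ‖u (φ m)‖ := lt_of_le_of_ne (norm_nonneg _) (hne _).symm
      have h1 := Int.floor_le (t / ‖u (φ m)‖)
      have h2 := Int.lt_floor_add_one (t / ‖u (φ m)‖)
      rw [le_div_iff₀ hpos] at h1
      rw [div_lt_iff₀ hpos] at h2
      rw [Real.norm_eq_abs, abs_le]
      constructor <;> nlinarith
    have := (hfl.smul hlim)
    refine hS.mem_of_tendsto ((continuous_exp' (𝔸 := 𝔸)).tendsto _ |>.comp this)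
      (Eventually.of_forall fun m => ?_)
    have h3 := hint _ (hu' (φ m)).2.1 ⌊t / ‖u (φ m)‖⌋
    simp only [Function.comp, smul_smul]
    rwa [mul_assoc, mul_inv_cancel₀ (hne _), mul_one]
  have : Z = 0 := (Submodule.disjoint_def.1 hC) Z hZL hZC
  simp [this] at hZ

/-- Von Neumann's theorem: near `1`, every element of a closed submonoid is the exponential of an
element of its Lie algebra. -/
theorem eventually_mem_exp_lieSet [FiniteDimensional ℝ 𝔸] (hS : IsClosed (S : Set 𝔸))
    (hinv : ∀ X : 𝔸, exp X ∈ S → exp (-X) ∈ S) :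
    ∀ᶠ A in 𝓝 (1 : 𝔸), A ∈ S → ∃ Z ∈ lieSet (S : Set 𝔸), exp Z = A := by
  obtain ⟨C, hC⟩ := (lieSubmodule hS).exists_isCompl
  set P : 𝔸 →L[ℝ] 𝔸 := LinearMap.toContinuousLinearMap
    ((lieSubmodule hS).subtype ∘ₗ (lieSubmodule hS).projectionOnto C hC) with hP
  have hPmem : ∀ W, P W ∈ lieSubmodule hS := fun W => Subtype.coe_prop _
  have hPC : ∀ W, W - P W ∈ C := by
    intro W
    rw [← Submodule.ker_projectionOnto hC, LinearMap.mem_ker, map_sub, sub_eq_zero]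
    exact (Submodule.projectionOnto_apply_left hC
      ((lieSubmodule hS).projectionOnto C hC W)).symm
  set Φ : 𝔸 → 𝔸 := fun W => exp (P W) * exp (W - P W) with hΦ
  have hex : HasStrictFDerivAt (exp : 𝔸 → 𝔸) (1 : 𝔸 →L[ℝ] 𝔸) 0 := hasStrictFDerivAt_exp_zero
  have h1 : HasStrictFDerivAt (fun W => exp (P W)) P 0 := by
    have : HasStrictFDerivAt (exp : 𝔸 → 𝔸) (1 : 𝔸 →L[ℝ] 𝔸) (P 0) := by rwa [map_zero]
    exact this.comp 0 P.hasStrictFDerivAt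
  have h2 : HasStrictFDerivAt (fun W => exp (W - P W)) (ContinuousLinearMap.id ℝ 𝔸 - P) 0 := by
    have : HasStrictFDerivAt (exp : 𝔸 → 𝔸) (1 : 𝔸 →L[ℝ] 𝔸)
      ((ContinuousLinearMap.id ℝ 𝔸 - P) 0) := by rwa [map_zero]
    exact this.comp 0 (ContinuousLinearMap.id ℝ 𝔸 - P).hasStrictFDerivAt
  have h3 : HasStrictFDerivAt Φ
      ((ContinuousLinearEquiv.refl ℝ 𝔸 : 𝔸 ≃L[ℝ] 𝔸) : 𝔸 →L[ℝ] 𝔸) 0 := by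
    refine (h1.mul' h2).congr_fderiv ?_
    ext W
    simp
  have hΦ0 : Φ 0 = 1 := by simp [hΦ]
  have hright := h3.eventually_right_inverse
  have hcont := h3.localInverse_continuousAt
  rw [hΦ0] at hright hcont
  have h0 : h3.localInverse Φ _ 0 1 = 0 := by
    have := h3.localInverse_apply_image
    rwa [hΦ0] at this
  have hsmall : ∀ᶠ W in 𝓝 (0 : 𝔸), exp (W - P W) ∈ S → W - P W = 0 := by
    have hc : Tendsto (fun W => W - P W) (𝓝 0) (𝓝 0) := by
      have : Continuous fun W => W - P W := by fun_prop
      simpa using this.tendsto 0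
    exact (hc.eventually (eventually_eq_zero_of_exp_mem hS hinv hC.disjoint)).mono
      fun W hW => hW (hPC W)
  rw [ContinuousAt, h0] at hcont
  filter_upwards [hright, hcont.eventually hsmall] with A hA hW hAS
  set W := h3.localInverse Φ _ 0 A
  have h5 : exp (W - P W) = exp (-(P W)) * A := by
    rw [← hA, hΦ, ← mul_assoc, exp_neg_mul_exp, one_mul]
  have h6 : exp (W - P W) ∈ S := by
    rw [h5]
    refine S.mul_mem ?_ hAS
    have := hPmem W (-1)
    simpa using this
  refine ⟨P W, hPmem W, ?_⟩
  rw [← hA, hΦ]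
  simp [hW h6]

end Banach

/-! ### The Lie algebra of a closed subgroup -/

section LieAlg

variable {n : ℕ} {𝔽 : Type} [NormedDivisionRing 𝔽] [NormedAlgebra ℝ 𝔽] [StarRing 𝔽]

theorem coe_mul (A B : UGroup n 𝔽) : ((A * B : UGroup n 𝔽) : Mat n 𝔽) = (A : Mat n 𝔽) * B := rfl

theorem mul_coe_inv (A : UGroup n 𝔽) : (A : Mat n 𝔽) * ((A⁻¹ : UGroup n 𝔽) : Mat n 𝔽) = 1 :=
  congrArg Subtype.val (mul_inv_cancel A)

theorem coe_inv_mul (A : UGroup n 𝔽) : ((A⁻¹ : UGroup n 𝔽) : Mat n 𝔽) * (A : Mat n 𝔽) = 1 :=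
  congrArg Subtype.val (inv_mul_cancel A)

/-- A subgroup of the unitary group, as a submonoid of the ring of matrices. -/
def matSubmonoid (L : Subgroup (UGroup n 𝔽)) : Submonoid (Mat n 𝔽) :=
  L.toSubmonoid.map (unitary (Mat n 𝔽)).subtype

theorem mem_matSubmonoid {L : Subgroup (UGroup n 𝔽)} {M : Mat n 𝔽} :
    M ∈ matSubmonoid L ↔ ∃ A ∈ L, (A : Mat n 𝔽) = M := Iff.rfl

theorem coe_mem_matSubmonoid {L : Subgroup (UGroup n 𝔽)} {A : UGroup n 𝔽} :
    (A : Mat n 𝔽) ∈ matSubmonoid L ↔ A ∈ L := by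
  rw [mem_matSubmonoid]
  exact ⟨fun ⟨B, hB, h⟩ => Subtype.ext h ▸ hB, fun h => ⟨A, h, rfl⟩⟩

variable [FiniteDimensional ℝ 𝔽]

theorem mat_exp_mul_exp_neg (X : Mat n 𝔽) : exp X * exp (-X) = 1 := by
  let _ : NormedRing (Mat n 𝔽) := Matrix.linftyOpNormedRing
  let _ : NormedAlgebra ℝ (Mat n 𝔽) := Matrix.linftyOpNormedAlgebra
  have : CompleteSpace (Mat n 𝔽) := FiniteDimensional.complete ℝ _
  exact exp_mul_exp_neg X

theorem mat_exp_neg_mul_exp (X : Mat n 𝔽) : exp (-X) * exp X = 1 := by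
  simpa using mat_exp_mul_exp_neg (-X)

theorem mat_exp_add {X Y : Mat n 𝔽} (h : X * Y = Y * X) : exp (X + Y) = exp X * exp Y := by
  let _ : NormedRing (Mat n 𝔽) := Matrix.linftyOpNormedRing
  let _ : NormedAlgebra ℝ (Mat n 𝔽) := Matrix.linftyOpNormedAlgebra
  have : CompleteSpace (Mat n 𝔽) := FiniteDimensional.complete ℝ _
  exact exp_add_comm h

theorem mat_exp_mul_eq_mul_exp {A B X : Mat n 𝔽} (h : A * X = X * B) :
    exp A * X = X * exp B := by
  let _ : NormedRing (Mat n 𝔽) := Matrix.linftyOpNormedRing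
  let _ : NormedAlgebra ℝ (Mat n 𝔽) := Matrix.linftyOpNormedAlgebra
  have : CompleteSpace (Mat n 𝔽) := FiniteDimensional.complete ℝ _
  exact exp_mul_eq_mul_exp h

theorem mat_exp_mul_of_mul_eq_zero {A X : Mat n 𝔽} (h : A * X = 0) : exp A * X = X := by
  simpa using mat_exp_mul_eq_mul_exp (A := A) (B := 0) (X := X) (by simp [h])

theorem mat_mul_exp_of_mul_eq_zero {A X : Mat n 𝔽} (h : X * A = 0) : X * exp A = X := by
  simpa using (mat_exp_mul_eq_mul_exp (A := 0) (B := A) (X := X) (by simp [h])).symm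

theorem mat_exp_smul_mul_rotation {G A B : Mat n 𝔽} (hA : G * A = -B) (hB : G * B = A) (t : ℝ) :
    exp (t • G) * (Real.cos t • A + Real.sin t • B) = A := by
  let _ : NormedRing (Mat n 𝔽) := Matrix.linftyOpNormedRing
  let _ : NormedAlgebra ℝ (Mat n 𝔽) := Matrix.linftyOpNormedAlgebra
  have : CompleteSpace (Mat n 𝔽) := FiniteDimensional.complete ℝ _
  exact exp_smul_mul_rotation hA hB t

variable [ContinuousStar 𝔽]

theorem isClosed_matSubmonoid {L : Subgroup (UGroup n 𝔽)} (hL : IsClosed (L : Set (UGroup n 𝔽))) :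
    IsClosed (matSubmonoid L : Set (Mat n 𝔽)) := by
  have : IsClosed ((unitary (Mat n 𝔽) : Submonoid (Mat n 𝔽)) : Set (Mat n 𝔽)) := by
    have h : ((unitary (Mat n 𝔽) : Submonoid (Mat n 𝔽)) : Set (Mat n 𝔽))
        = {A | star A * A = 1} ∩ {A | A * star A = 1} := by
      ext A; exact Unitary.mem_iff
    rw [h]
    exact (isClosed_eq (by fun_prop) (by fun_prop)).inter (isClosed_eq (by fun_prop) (by fun_prop))
  exact this.isClosedEmbedding_subtypeVal.isClosedMap _ hL

theorem matSubmonoid_exp_neg (L : Subgroup (UGroup n 𝔽)) (X : Mat n 𝔽)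
    (h : exp X ∈ matSubmonoid L) : exp (-X) ∈ matSubmonoid L := by
  obtain ⟨A, hA, hAX⟩ := mem_matSubmonoid.1 h
  refine mem_matSubmonoid.2 ⟨A⁻¹, L.inv_mem hA, ?_⟩
  rw [← one_mul (exp (-X)), ← coe_inv_mul A, hAX, mul_assoc, mat_exp_mul_exp_neg, mul_one]

variable {L : Subgroup (UGroup n 𝔽)}

/-- The Lie algebra of a closed subgroup as a real vector space. -/
def lieSub (hL : IsClosed (L : Set (UGroup n 𝔽))) : Submodule ℝ (Mat n 𝔽) where
  carrier := lieAlg L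
  add_mem' := by
    let _ : NormedRing (Mat n 𝔽) := Matrix.linftyOpNormedRing
    let _ : NormedAlgebra ℝ (Mat n 𝔽) := Matrix.linftyOpNormedAlgebra
    have : CompleteSpace (Mat n 𝔽) := FiniteDimensional.complete ℝ _
    exact fun {_ _} hX hY => lieSet_add (isClosed_matSubmonoid hL) hX hY
  zero_mem' := fun t => ⟨1, L.one_mem, by simp [exp_zero]⟩
  smul_mem' c X hX := fun t => by rw [smul_smul]; exact hX _

theorem lieAlg_bracket (hL : IsClosed (L : Set (UGroup n 𝔽))) {X Y : Mat n 𝔽}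
    (hX : X ∈ lieAlg L) (hY : Y ∈ lieAlg L) : X * Y - Y * X ∈ lieAlg L := by
  let _ : NormedRing (Mat n 𝔽) := Matrix.linftyOpNormedRing
  let _ : NormedAlgebra ℝ (Mat n 𝔽) := Matrix.linftyOpNormedAlgebra
  have : CompleteSpace (Mat n 𝔽) := FiniteDimensional.complete ℝ _
  exact lieSet_bracket (isClosed_matSubmonoid hL) hY hX

theorem lieAlg_conj {X : Mat n 𝔽} {A : UGroup n 𝔽} (hA : A ∈ L) (hX : X ∈ lieAlg L) :
    (A : Mat n 𝔽) * X * (A⁻¹ : UGroup n 𝔽) ∈ lieAlg L := by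
  let _ : NormedRing (Mat n 𝔽) := Matrix.linftyOpNormedRing
  let _ : NormedAlgebra ℝ (Mat n 𝔽) := Matrix.linftyOpNormedAlgebra
  have : CompleteSpace (Mat n 𝔽) := FiniteDimensional.complete ℝ _
  exact lieSet_conj (coe_mem_matSubmonoid.2 hA) (coe_mem_matSubmonoid.2 (L.inv_mem hA))
    (mul_coe_inv A) (coe_inv_mul A) hX

theorem lieAlg_mono {L' : Subgroup (UGroup n 𝔽)} (h : L ≤ L') : lieAlg L ⊆ lieAlg L' :=
  fun _ hX t => let ⟨A, hA, h'⟩ := hX t; ⟨A, h hA, h'⟩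

theorem exists_coe_eq_exp {X : Mat n 𝔽} (hX : X ∈ lieAlg L) :
    ∃ A ∈ L, (A : Mat n 𝔽) = exp X := by simpa using hX 1

/-- The velocity at `1` of a curve in a closed subgroup belongs to its Lie algebra. -/
theorem mem_lieAlg_of_hasDerivAt (hL : IsClosed (L : Set (UGroup n 𝔽))) {γ : ℝ → Mat n 𝔽}
    {Z : Mat n 𝔽} (hγ : HasDerivAt γ Z 0) (h0 : γ 0 = 1) (hmem : ∀ t, γ t ∈ matSubmonoid L) :
    Z ∈ lieAlg L := by
  let _ : NormedRing (Mat n 𝔽) := Matrix.linftyOpNormedRing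
  let _ : NormedAlgebra ℝ (Mat n 𝔽) := Matrix.linftyOpNormedAlgebra
  have : CompleteSpace (Mat n 𝔽) := FiniteDimensional.complete ℝ _
  exact mem_lieSet_of_hasDerivAt (isClosed_matSubmonoid hL) hγ h0 hmem

/-- A closed connected subgroup `H` lies in `L` if the exponentials of its Lie algebra do. -/
theorem le_of_exp_lieAlg {H : Subgroup (UGroup n 𝔽)} (hH : IsClosed (H : Set (UGroup n 𝔽)))
    (hc : IsConnected (H : Set (UGroup n 𝔽)))
    (h : ∀ Z ∈ lieAlg H, exp Z ∈ matSubmonoid L) : H ≤ L := by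
  have hev : ∀ᶠ A in 𝓝 (1 : Mat n 𝔽), A ∈ matSubmonoid H → ∃ Z ∈ lieAlg H, exp Z = A := by
    let _ : NormedRing (Mat n 𝔽) := Matrix.linftyOpNormedRing
    let _ : NormedAlgebra ℝ (Mat n 𝔽) := Matrix.linftyOpNormedAlgebra
    have : CompleteSpace (Mat n 𝔽) := FiniteDimensional.complete ℝ _
    exact eventually_mem_exp_lieSet (isClosed_matSubmonoid hH) (matSubmonoid_exp_neg H)
  have hev2 : ∀ᶠ A : H in 𝓝 (1 : H), (A : UGroup n 𝔽) ∈ L := by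
    have hcont : Continuous fun A : H => ((A : UGroup n 𝔽) : Mat n 𝔽) :=
      continuous_subtype_val.comp continuous_subtype_val
    have := hcont.tendsto 1
    filter_upwards [this.eventually hev] with A hA
    obtain ⟨Z, hZ, hZA⟩ := hA (coe_mem_matSubmonoid.2 A.2)
    rw [← coe_mem_matSubmonoid, ← hZA]
    exact h Z hZ
  have hopen : IsOpen ((L.subgroupOf H : Subgroup H) : Set H) :=
    Subgroup.isOpen_of_mem_nhds _ (g := 1) hev2
  have hclopen : IsClopen ((L.subgroupOf H : Subgroup H) : Set H) :=
    ⟨Subgroup.isClosed_of_isOpen _ hopen, hopen⟩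
  have : ConnectedSpace H := isConnected_iff_connectedSpace.1 hc
  have huniv := hclopen.eq_univ ⟨1, one_mem _⟩
  intro A hA
  have : (⟨A, hA⟩ : H) ∈ ((L.subgroupOf H : Subgroup H) : Set H) := huniv ▸ Set.mem_univ _
  exact this

end LieAlg

/-! ### Curvature along a flat torus -/

theorem sumExtend_inl {ι E : Type*} [AddCommGroup E] [Module ℝ E] {v : ι → E}
    (hv : LinearIndependent ℝ v) (i : ι) : Module.Basis.sumExtend hv (Sum.inl i) = v i := by
  rw [Module.Basis.sumExtend, Module.Basis.reindex_apply, Module.Basis.extend_apply_self]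
  rfl

/-- A subspace `h` of `k` has a complement in `k` with a basis `B` that starts with two given vectors
which are independent modulo `h`; `π` reads off the coordinates modulo `h`. -/
theorem exists_adapted_basis {E : Type*} [AddCommGroup E] [Module ℝ E] [FiniteDimensional ℝ E]
    {k h : Submodule ℝ E} {X Y : E} (hX : X ∈ k) (hY : Y ∈ k)
    (hind : ∀ a b : ℝ, a • X + b • Y ∈ h → a = 0 ∧ b = 0) :
    ∃ (d : ℕ) (i₀ i₁ : Fin d) (B : Fin d → E) (π : E →ₗ[ℝ] (Fin d → ℝ)), i₀ ≠ i₁ ∧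
      (∀ i, B i ∈ k) ∧ (∀ i, π (B i) = Pi.single i 1) ∧ (∀ Z ∈ k, π Z = 0 ↔ Z ∈ h) ∧
      B i₀ = X ∧ B i₁ = Y := by
  classical
  set h' : Submodule ℝ k := h.comap k.subtype with hh'
  obtain ⟨v, hv0, hv1⟩ : ∃ v : Fin 2 → k ⧸ h', v 0 = h'.mkQ ⟨X, hX⟩ ∧ v 1 = h'.mkQ ⟨Y, hY⟩ :=
    ⟨![h'.mkQ ⟨X, hX⟩, h'.mkQ ⟨Y, hY⟩], rfl, rfl⟩
  have hv : LinearIndependent ℝ v := by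
    have hv2 : v = ![h'.mkQ ⟨X, hX⟩, h'.mkQ ⟨Y, hY⟩] := by
      funext i; fin_cases i
      · exact hv0
      · exact hv1
    rw [hv2]
    rw [LinearIndependent.pair_iff]
    intro a b hab
    rw [← map_smul, ← map_smul, ← map_add, Submodule.mkQ_apply,
      Submodule.Quotient.mk_eq_zero] at hab
    exact hind a b hab
  set b := Module.Basis.sumExtend hv
  have : Fintype (Fin 2 ⊕ Module.Basis.sumExtendIndex hv) := FiniteDimensional.fintypeBasisIndex b
  set e := Fintype.equivFin (Fin 2 ⊕ Module.Basis.sumExtendIndex hv)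
  set c := b.reindex e
  have hlift : ∀ i, ∃ Z : k, h'.mkQ Z = c i := fun i => h'.mkQ_surjective _
  choose B₀ hB₀ using hlift
  have hc0 : c (e (Sum.inl 0)) = h'.mkQ ⟨X, hX⟩ := by
    rw [Module.Basis.reindex_apply, Equiv.symm_apply_apply, sumExtend_inl, hv0]
  have hc1 : c (e (Sum.inl 1)) = h'.mkQ ⟨Y, hY⟩ := by
    rw [Module.Basis.reindex_apply, Equiv.symm_apply_apply, sumExtend_inl, hv1]
  set B : Fin _ → k := fun i => if i = e (Sum.inl 0) then ⟨X, hX⟩ else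
    if i = e (Sum.inl 1) then ⟨Y, hY⟩ else B₀ i
  have hne : e (Sum.inl 0) ≠ e (Sum.inl 1) := e.injective.ne (by simp)
  have hB : ∀ i, h'.mkQ (B i) = c i := by
    intro i
    by_cases h0 : i = e (Sum.inl 0)
    · simp only [B, h0, if_true]; exact hc0.symm
    · by_cases h1 : i = e (Sum.inl 1)
      · simp only [B, h1, hne.symm, if_true, if_false]; exact hc1.symm
      · simp only [B, h0, h1, if_false]; exact hB₀ i
  obtain ⟨π, hπ⟩ := LinearMap.exists_extend (c.equivFun.toLinearMap ∘ₗ h'.mkQ)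
  have hπ' : ∀ Z : k, π Z = c.equivFun (h'.mkQ Z) := fun Z => LinearMap.congr_fun hπ Z
  refine ⟨_, e (Sum.inl 0), e (Sum.inl 1), fun i => B i, π, hne, fun i => (B i).2, fun i => ?_,
    fun Z hZ => ?_, ?_, ?_⟩
  · rw [hπ', hB]
    funext j
    rw [Module.Basis.equivFun_self, Pi.single_apply]
    simp [eq_comm]
  · have := hπ' ⟨Z, hZ⟩
    simp only at this
    rw [this, LinearEquiv.map_eq_zero_iff, Submodule.mkQ_apply, Submodule.Quotient.mk_eq_zero]
    rfl
  · simp [B]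
  · simp [B, hne.symm]

theorem partialDeriv_eq_zero {d : ℕ} {i : Fin d} {f : (Fin d → ℝ) → ℝ} {x : Fin d → ℝ}
    (h : HasDerivAt (fun t : ℝ => f (x + t • Pi.single i 1)) 0 0) : partialDeriv i f x = 0 := by
  by_cases hf : DifferentiableAt ℝ f x
  · exact (hf.hasFDerivAt.hasLineDerivAt _).unique h
  · simp [partialDeriv, fderiv_zero_of_not_differentiableAt hf]

/-- A metric whose coefficients do not depend on the coordinates in `s` and for which the surface
`x m = 0` for `m ∉ s` is totally geodesic has no curvature in the directions of `s`. -/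
theorem riemannTensor_eq_zero {d : ℕ} (G : (Fin d → ℝ) → Matrix (Fin d) (Fin d) ℝ)
    (s : Set (Fin d)) (hG : ∀ i ∈ s, ∀ x, ∀ t : ℝ, G (x + t • Pi.single i 1) = G x)
    (hG' : ∀ x, (∀ m ∉ s, x m = 0) → ∀ i ∈ s, ∀ j ∈ s, ∀ m ∉ s,
      HasDerivAt (fun t : ℝ => G (x + t • Pi.single m 1) i j) 0 0)
    {x : Fin d → ℝ} (hx : ∀ m ∉ s, x m = 0) {i j k : Fin d} (hi : i ∈ s) (hj : j ∈ s) (hk : k ∈ s)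
    (l : Fin d) : riemannTensor G l i j k x = 0 := by
  have h1 : ∀ i ∈ s, ∀ a b x, partialDeriv i (fun y => G y a b) x = 0 := by
    intro i hi a b x
    refine partialDeriv_eq_zero ?_
    simp only [hG i hi]
    exact hasDerivAt_const _ _
  have h2 : ∀ x, (∀ m ∉ s, x m = 0) → ∀ i ∈ s, ∀ j ∈ s, ∀ l, christoffel G l i j x = 0 := by
    intro x hx i hi j hj l
    unfold christoffel
    rw [Finset.sum_eq_zero, mul_zero]
    intro m _
    rw [h1 i hi, h1 j hj]
    by_cases hm : m ∈ s
    · rw [h1 m hm]; simp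
    · rw [partialDeriv_eq_zero (hG' x hx i hi j hj m hm)]; simp
  have h3 : ∀ i ∈ s, ∀ j ∈ s, ∀ k ∈ s, ∀ l, partialDeriv i (christoffel G l j k) x = 0 := by
    intro i hi j hj k hk l
    refine partialDeriv_eq_zero ?_
    have : ∀ t : ℝ, christoffel G l j k (x + t • Pi.single i 1) = 0 := by
      intro t
      refine h2 _ (fun m hm => ?_) j hj k hk l
      have hmi : m ≠ i := fun h => hm (h ▸ hi)
      simp [hx m hm, hmi]
    simp only [this]
    exact hasDerivAt_const _ _
  unfold riemannTensor
  rw [h3 i hi j hj k hk, h3 j hj i hi k hk, Finset.sum_eq_zero]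
  · simp
  · intro m _
    rw [h2 x hx j hj k hk, h2 x hx i hi k hk]; simp

theorem sectionalCurvature_eq_zero {d : ℕ} (G : (Fin d → ℝ) → Matrix (Fin d) (Fin d) ℝ)
    {x : Fin d → ℝ} {i j : Fin d} (h : ∀ l, riemannTensor G l i j j x = 0) :
    sectionalCurvature G x (Pi.single i 1) (Pi.single j 1) = 0 := by
  have : curvatureVec G x (Pi.single i 1) (Pi.single j 1) (Pi.single j 1) = 0 := by
    funext l
    unfold curvatureVec
    refine Finset.sum_eq_zero fun a _ => Finset.sum_eq_zero fun b _ => Finset.sum_eq_zero fun c _ => ?_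
    by_cases ha : a = i
    · by_cases hb : b = j
      · by_cases hc : c = j
        · subst ha hb hc; simp [h]
        · simp [hc]
      · simp [hb]
    · simp [ha]
  unfold sectionalCurvature
  rw [this]
  simp [innerAt]

section Param

variable {n : ℕ} {𝔽 : Type} [NormedDivisionRing 𝔽] [NormedAlgebra ℝ 𝔽] [StarRing 𝔽]
  [FiniteDimensional ℝ 𝔽] [ContinuousStar 𝔽]

/-- The map `x ↦ exp (x i₀ B i₀ + x i₁ B i₁) exp (∑ x m B m)`, the sum over all other indices. -/
noncomputable def paramMat {d : ℕ} (B : Fin d → Mat n 𝔽) (i₀ i₁ : Fin d) (x : Fin d → ℝ) :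
    Mat n 𝔽 :=
  exp (x i₀ • B i₀ + x i₁ • B i₁) *
    exp (∑ m, (if m = i₀ ∨ m = i₁ then 0 else x m) • B m)

theorem contDiff_paramMat {d : ℕ} (B : Fin d → Mat n 𝔽) (i₀ i₁ : Fin d) (i j : Fin n) :
    ContDiff ℝ ∞ fun x => paramMat B i₀ i₁ x i j := by
  let _ : NormedRing (Mat n 𝔽) := Matrix.linftyOpNormedRing
  let _ : NormedAlgebra ℝ (Mat n 𝔽) := Matrix.linftyOpNormedAlgebra
  have : CompleteSpace (Mat n 𝔽) := FiniteDimensional.complete ℝ _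
  have hexp : ContDiff ℝ ∞ (exp : Mat n 𝔽 → Mat n 𝔽) :=
    contDiff_iff_contDiffAt.2 fun x => (exp_analytic x).contDiffAt
  have hent : ContDiff ℝ ∞ fun M : Mat n 𝔽 => M i j :=
    (LinearMap.toContinuousLinearMap (Matrix.entryLinearMap ℝ 𝔽 i j)).contDiff
  have h1 : ContDiff ℝ ∞ fun x : Fin d → ℝ => x i₀ • B i₀ + x i₁ • B i₁ := by fun_prop
  have h2 : ContDiff ℝ ∞ fun x : Fin d → ℝ =>
      ∑ m, (if m = i₀ ∨ m = i₁ then 0 else x m) • B m := by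
    refine ContDiff.sum fun m _ => ?_
    split_ifs <;> fun_prop
  exact hent.comp ((hexp.comp h1).mul (hexp.comp h2))

theorem hasDerivAt_mat_exp_smul (X : Mat n 𝔽) : HasDerivAt (fun t : ℝ => exp (t • X)) X 0 := by
  let _ : NormedRing (Mat n 𝔽) := Matrix.linftyOpNormedRing
  let _ : NormedAlgebra ℝ (Mat n 𝔽) := Matrix.linftyOpNormedAlgebra
  have : CompleteSpace (Mat n 𝔽) := FiniteDimensional.complete ℝ _
  exact hasDerivAt_exp_smul_zero X

theorem hasDerivAt_mat_mul_left {γ : ℝ → Mat n 𝔽} {Z : Mat n 𝔽} {t : ℝ} (h : HasDerivAt γ Z t)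
    (A : Mat n 𝔽) : HasDerivAt (fun s => A * γ s) (A * Z) t := by
  let _ : NormedRing (Mat n 𝔽) := Matrix.linftyOpNormedRing
  let _ : NormedAlgebra ℝ (Mat n 𝔽) := Matrix.linftyOpNormedAlgebra
  exact h.const_mul A

theorem hasDerivAt_mat_mul_right {γ : ℝ → Mat n 𝔽} {Z : Mat n 𝔽} {t : ℝ} (h : HasDerivAt γ Z t)
    (A : Mat n 𝔽) : HasDerivAt (fun s => γ s * A) (Z * A) t := by
  let _ : NormedRing (Mat n 𝔽) := Matrix.linftyOpNormedRing
  let _ : NormedAlgebra ℝ (Mat n 𝔽) := Matrix.linftyOpNormedAlgebra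
  exact h.mul_const A

theorem hasDerivAt_mat_exp_conj (X Y : Mat n 𝔽) :
    HasDerivAt (fun s : ℝ => exp (-(s • X)) * Y * exp (s • X)) (Y * X - X * Y) 0 := by
  let _ : NormedRing (Mat n 𝔽) := Matrix.linftyOpNormedRing
  let _ : NormedAlgebra ℝ (Mat n 𝔽) := Matrix.linftyOpNormedAlgebra
  have : CompleteSpace (Mat n 𝔽) := FiniteDimensional.complete ℝ _
  exact hasDerivAt_exp_conj X Y

theorem hasDerivAt_mat_of_entries {γ : ℝ → Mat n 𝔽} {Z : Mat n 𝔽} {t : ℝ}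
    (h : ∀ i j, HasDerivAt (fun s => γ s i j) (Z i j) t) : HasDerivAt γ Z t := by
  let _ : NormedAddCommGroup (Mat n 𝔽) := Matrix.normedAddCommGroup
  let _ : NormedSpace ℝ (Mat n 𝔽) := Matrix.normedSpace
  exact hasDerivAt_pi.2 fun i => hasDerivAt_pi.2 fun j => h i j

theorem hasDerivAt_bilin_aux {E : Type*} [NormedAddCommGroup E] [NormedSpace ℝ E]
    [FiniteDimensional ℝ E] (q : LinearMap.BilinForm ℝ E) {γ δ : ℝ → E}
    {V W : E} {t : ℝ} (hγ : HasDerivAt γ V t) (hδ : HasDerivAt δ W t) :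
    HasDerivAt (fun s => q (γ s) (δ s)) (q V (δ t) + q (γ t) W) t := by
  set q' : E →L[ℝ] E →L[ℝ] ℝ := LinearMap.toContinuousBilinearMap q
  exact (q'.hasFDerivAt.comp_hasDerivAt t hγ).clm_apply hδ

theorem mat_hasDerivAt_unique {γ : ℝ → Mat n 𝔽} {V W : Mat n 𝔽} {t : ℝ} (h : HasDerivAt γ V t)
    (h' : HasDerivAt γ W t) : V = W := by
  let _ : NormedRing (Mat n 𝔽) := Matrix.linftyOpNormedRing
  let _ : NormedAlgebra ℝ (Mat n 𝔽) := Matrix.linftyOpNormedAlgebra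
  exact h.unique h'

/-- A bilinear form on matrices has the expected derivative along two curves. -/
theorem hasDerivAt_bilin (q : LinearMap.BilinForm ℝ (Mat n 𝔽)) {γ δ : ℝ → Mat n 𝔽}
    {V W : Mat n 𝔽} {t : ℝ} (hγ : HasDerivAt γ V t) (hδ : HasDerivAt δ W t) :
    HasDerivAt (fun s => q (γ s) (δ s)) (q V (δ t) + q (γ t) W) t := by
  let _ : NormedRing (Mat n 𝔽) := Matrix.linftyOpNormedRing
  let _ : NormedAlgebra ℝ (Mat n 𝔽) := Matrix.linftyOpNormedAlgebra
  exact hasDerivAt_bilin_aux q hγ hδ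

theorem velocity_eq_sum {d : ℕ} (σ : (Fin d → ℝ) → UGroup n 𝔽) (x v : Fin d → ℝ) :
    velocity σ x v = ∑ j, v j • velocity σ x (Pi.single j 1) := by
  ext a b
  simp only [velocity, Matrix.of_apply, Matrix.sum_apply, Matrix.smul_apply]
  conv_lhs => rw [pi_eq_sum_univ' v]
  simp [map_sum, map_smul]

theorem hasDerivAt_velocity {d : ℕ} {σ : (Fin d → ℝ) → UGroup n 𝔽}
    (hσ : ∀ i j, ContDiff ℝ ∞ fun x => (σ x : Mat n 𝔽) i j) (x v : Fin d → ℝ) :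
    HasDerivAt (fun t : ℝ => (σ (x + t • v) : Mat n 𝔽)) (velocity σ x v) 0 :=
  hasDerivAt_mat_of_entries fun i j =>
    (((hσ i j).differentiable (by simp)) x).hasFDerivAt.hasLineDerivAt v

/-- Left translation of the metric form, expressed on the Lie algebra. -/
theorem form_eq {K H : Subgroup (UGroup n 𝔽)} {g : QuotientMetric K H} (hg : g.IsInvariant)
    {A : UGroup n 𝔽} (hA : A ∈ K) {V W : Mat n 𝔽} (hV : V ∈ lieAlg K) (hW : W ∈ lieAlg K) :
    g.form A ((A : Mat n 𝔽) * V) ((A : Mat n 𝔽) * W) = g.form 1 V W := by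
  have := hg A hA 1 K.one_mem V ⟨V, hV, by simp⟩ W ⟨W, hW, by simp⟩
  rwa [mul_one] at this

/-- Two commuting vectors `X`, `Y` that are independent modulo the isotropy algebra and satisfy
`⟨[X, W], X⟩ = ⟨[Y, W], Y⟩ = ⟨[X, W], Y⟩ + ⟨X, [Y, W]⟩ = 0` for all `W` generate a totally geodesic
flat surface. This excludes positive curvature. -/
theorem false_of_flat_pair {K H : Subgroup (UGroup n 𝔽)} (hK : IsClosed (K : Set (UGroup n 𝔽)))
    (hH : IsClosed (H : Set (UGroup n 𝔽))) {g : QuotientMetric K H}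
    (hg : g.IsInvariant) (hpos : g.PositivelyCurved) {X Y : Mat n 𝔽} (hX : X ∈ lieAlg K)
    (hY : Y ∈ lieAlg K) (hXY : X * Y = Y * X)
    (hind : ∀ a b : ℝ, a • X + b • Y ∈ lieAlg H → a = 0 ∧ b = 0)
    (hflat : ∀ W ∈ lieAlg K, ∀ P ∈ ({X, Y} : Set (Mat n 𝔽)), ∀ Q ∈ ({X, Y} : Set (Mat n 𝔽)),
      g.form 1 (P * W - W * P) Q + g.form 1 P (Q * W - W * Q) = 0) : False := by
  classical
  obtain ⟨d, i₀, i₁, B, π, hne, hBk, hπB, hπ, rfl, rfl⟩ :=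
    exists_adapted_basis (k := lieSub hK) (h := lieSub hH) hX hY hind
  set s : Set (Fin d) := {i₀, i₁} with hs
  have hcomm : ∀ i ∈ s, ∀ j ∈ s, B i * B j = B j * B i := by
    rintro i (rfl | rfl) j (rfl | rfl) <;> simp [hXY]
  have h1k : ∀ x : Fin d → ℝ, x i₀ • B i₀ + x i₁ • B i₁ ∈ lieSub hK := fun x =>
    add_mem (Submodule.smul_mem _ _ hX) (Submodule.smul_mem _ _ hY)
  have h2k : ∀ x : Fin d → ℝ,
      ∑ m, (if m = i₀ ∨ m = i₁ then 0 else x m) • B m ∈ lieSub hK := fun x =>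
    Submodule.sum_mem _ fun m _ => Submodule.smul_mem _ _ (hBk m)
  have hex : ∀ x, ∃ A ∈ K, (A : Mat n 𝔽) = paramMat B i₀ i₁ x := by
    intro x
    obtain ⟨A, hA, hA'⟩ := exists_coe_eq_exp (h1k x)
    obtain ⟨C, hC, hC'⟩ := exists_coe_eq_exp (h2k x)
    exact ⟨A * C, K.mul_mem hA hC, by rw [coe_mul, hA', hC', paramMat]⟩
  choose σ hσK hσ using hex
  have hsm : ∀ i j, ContDiff ℝ ∞ fun x => (σ x : Mat n 𝔽) i j := by
    intro i j; simp only [hσ]; exact contDiff_paramMat B i₀ i₁ i j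
  have hσ0 : (σ 0 : Mat n 𝔽) = 1 := by rw [hσ, paramMat]; simp [exp_zero]
  -- translation by the coordinates in `s` is left multiplication
  have htrans : ∀ i ∈ s, ∀ x, ∀ t : ℝ,
      (σ (x + t • Pi.single i 1) : Mat n 𝔽) = exp (t • B i) * (σ x : Mat n 𝔽) := by
    intro i hi x t
    rw [hσ, hσ, paramMat, paramMat, ← mul_assoc]
    congr 1
    · rw [← mat_exp_add]
      · congr 1
        rcases hi with rfl | rfl
        · simp [hne, add_smul]; abel
        · simp [hne.symm, add_smul]; abel
      · simp only [mul_add, add_mul, smul_mul_assoc, mul_smul_comm]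
        rw [hcomm i hi i₀ (by simp [hs]), hcomm i hi i₁ (by simp [hs])]
        simp only [smul_smul, smul_add, mul_comm]
    · congr 1
      refine Finset.sum_congr rfl fun m _ => ?_
      split_ifs with hm
      · rfl
      · have : m ≠ i := by rintro rfl; exact hm hi
        simp [this]
  have hvtrans : ∀ i ∈ s, ∀ x v, ∀ t : ℝ,
      velocity σ (x + t • Pi.single i 1) v = exp (t • B i) * velocity σ x v := by
    intro i hi x v t
    have h1 := hasDerivAt_velocity hsm (x + t • Pi.single i 1) v
    have h2 := hasDerivAt_mat_mul_left (hasDerivAt_velocity hsm x v) (exp (t • B i))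
    refine mat_hasDerivAt_unique h1 ?_
    convert h2 using 2 with r
    rw [← htrans i hi, add_right_comm]
  have hvdir : ∀ i ∈ s, ∀ x, velocity σ x (Pi.single i 1) = B i * (σ x : Mat n 𝔽) := by
    intro i hi x
    have h1 := hasDerivAt_velocity hsm x (Pi.single i 1)
    have h2 := hasDerivAt_mat_mul_right (hasDerivAt_mat_exp_smul (B i)) (σ x : Mat n 𝔽)
    refine mat_hasDerivAt_unique h1 ?_
    simp only [htrans i hi]
    exact h2
  -- velocities are tangent to `K`
  have hvk : ∀ x v, ((σ x)⁻¹ : UGroup n 𝔽) * velocity σ x v ∈ lieAlg K := by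
    intro x v
    refine mem_lieAlg_of_hasDerivAt hK
      (hasDerivAt_mat_mul_left (hasDerivAt_velocity hsm x v) _) ?_ fun t => ?_
    · simp [coe_inv_mul]
    · exact coe_mem_matSubmonoid.2 (K.mul_mem (K.inv_mem (hσK x)) (hσK _))
  have hvt : ∀ x v, velocity σ x v ∈ tangentAt K (σ x) := fun x v =>
    ⟨_, hvk x v, by rw [← mul_assoc, mul_coe_inv, one_mul]⟩
  -- the differential modulo the isotropy algebra, as a square matrix
  set M : (Fin d → ℝ) → Matrix (Fin d) (Fin d) ℝ := fun x => Matrix.of fun i j =>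
    π (((σ x)⁻¹ : UGroup n 𝔽) * velocity σ x (Pi.single j 1)) i with hM
  have hMv : ∀ x v, (M x).mulVec v = π (((σ x)⁻¹ : UGroup n 𝔽) * velocity σ x v) := by
    intro x v
    rw [velocity_eq_sum σ x v, Finset.mul_sum, map_sum]
    funext i
    simp only [hM, Matrix.mulVec, dotProduct, Matrix.of_apply, mul_smul_comm, map_smul,
      Finset.sum_apply, Pi.smul_apply, smul_eq_mul]
    exact Finset.sum_congr rfl fun j _ => mul_comm _ _
  have hM0 : M 0 = 1 := by
    ext i j
    have h0 : velocity σ 0 (Pi.single j 1) = B j := by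
      by_cases hj : j ∈ s
      · rw [hvdir j hj, hσ0, mul_one]
      · refine mat_hasDerivAt_unique (hasDerivAt_velocity hsm 0 (Pi.single j 1)) ?_
        have hj' : ¬ (j = i₀ ∨ j = i₁) := hj
        push Not at hj'
        convert hasDerivAt_mat_exp_smul (B j) using 2 with t
        rw [hσ, paramMat, Finset.sum_eq_single j]
        · simp [hj'.1, hj'.2, hj'.1.symm, hj'.2.symm, exp_zero]
        · intro m _ hm; simp [hm]
        · simp
    have hi0 : (((σ 0)⁻¹ : UGroup n 𝔽) : Mat n 𝔽) = 1 := by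
      have := coe_inv_mul (σ 0); rwa [hσ0, mul_one] at this
    simp only [hM, Matrix.of_apply, h0, hi0, one_mul, hπB, Matrix.one_apply, Pi.single_apply]
  have hMc : Continuous fun x => (M x).det := by
    have hinv : Continuous fun x => (((σ x)⁻¹ : UGroup n 𝔽) : Mat n 𝔽) := by
      refine continuous_matrix fun a b => ?_
      simp only [coe_inv_apply]
      exact continuous_star.comp (hsm b a).continuous
    refine Continuous.matrix_det (continuous_matrix fun i j => ?_)
    have hv : Continuous fun x => velocity σ x (Pi.single j 1) := by
      refine continuous_matrix fun a b => ?_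
      simp only [velocity, Matrix.of_apply]
      exact ((hsm a b).continuous_fderiv (by simp)).clm_apply continuous_const
    have hπc : Continuous π := by
      let _ : NormedRing (Mat n 𝔽) := Matrix.linftyOpNormedRing
      let _ : NormedAlgebra ℝ (Mat n 𝔽) := Matrix.linftyOpNormedAlgebra
      exact LinearMap.continuous_of_finiteDimensional π
    exact (continuous_apply i).comp (hπc.comp (hinv.mul hv))
  set U : Set (Fin d → ℝ) := {x | (M x).det ≠ 0} with hU
  have hloc : IsLocalParam K H σ U := by
    refine ⟨isOpen_ne_fun hMc continuous_const, fun i j => (hsm i j).contDiffOn,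
      fun x _ => hσK x, ?_⟩
    rintro x hx V ⟨Z, hZ, rfl⟩
    have hu : IsUnit (M x) := (Matrix.isUnit_iff_isUnit_det _).2 (isUnit_iff_ne_zero.2 hx)
    have hbij : Function.Bijective (M x).mulVec :=
      ⟨Matrix.mulVec_injective_iff_isUnit.2 hu, Matrix.mulVec_surjective_iff_isUnit.2 hu⟩
    have hiff : ∀ v, (σ x : Mat n 𝔽) * Z - velocity σ x v ∈ tangentAt H (σ x) ↔
        (M x).mulVec v = π Z := by
      intro v
      have hmem : Z - ((σ x)⁻¹ : UGroup n 𝔽) * velocity σ x v ∈ lieSub hK :=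
        (lieSub hK).sub_mem hZ (hvk x v)
      have hfac : (σ x : Mat n 𝔽) * Z - velocity σ x v =
          (σ x : Mat n 𝔽) * (Z - ((σ x)⁻¹ : UGroup n 𝔽) * velocity σ x v) := by
        rw [mul_sub, ← mul_assoc, mul_coe_inv, one_mul]
      have h3 := hπ _ hmem
      rw [map_sub, sub_eq_zero] at h3
      rw [hMv, eq_comm, h3]
      constructor
      · rintro ⟨W, hW, h⟩
        rw [hfac] at h
        have h' := congrArg (fun T => (((σ x)⁻¹ : UGroup n 𝔽) : Mat n 𝔽) * T) h
        simp only [← mul_assoc, coe_inv_mul, one_mul] at h'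
        rw [h']; exact hW
      · intro h
        exact ⟨_, h, hfac⟩
    obtain ⟨v, hv⟩ := hbij.2 (π Z)
    exact ⟨v, (hiff v).2 hv, fun w hw => hbij.1 (((hiff w).1 hw).trans hv.symm)⟩
  -- the coefficients of the metric
  have hG1 : ∀ i ∈ s, ∀ x, ∀ t : ℝ, g.coeff σ (x + t • Pi.single i 1) = g.coeff σ x := by
    intro i hi x t
    obtain ⟨A, hA, hA'⟩ := exists_coe_eq_exp ((lieSub hK).smul_mem t (hBk i))
    have hAσ : σ (x + t • Pi.single i 1) = A * σ x := by
      apply Subtype.ext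
      rw [htrans i hi, coe_mul, hA']
    ext a b
    simp only [QuotientMetric.coeff, Matrix.of_apply]
    rw [hvtrans i hi, hvtrans i hi, hAσ, ← hA']
    exact hg A hA (σ x) (hσK x) _ (hvt _ _) _ (hvt _ _)
  have hG2 : ∀ x, (∀ m ∉ s, x m = 0) → ∀ i ∈ s, ∀ j ∈ s, ∀ m ∉ s,
      HasDerivAt (fun t : ℝ => g.coeff σ (x + t • Pi.single m 1) i j) 0 0 := by
    intro x hx i hi j hj m hm
    have hm' : ¬ (m = i₀ ∨ m = i₁) := hm
    have hσt : ∀ t : ℝ, (σ (x + t • Pi.single m 1) : Mat n 𝔽) =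
        (σ x : Mat n 𝔽) * exp (t • B m) := by
      intro t
      have hm2 := not_or.1 hm'
      rw [hσ, hσ, paramMat, paramMat, Finset.sum_eq_single m, Finset.sum_eq_zero]
      · have hxm := hx m hm
        simp [hm2.1, hm2.2, Ne.symm hm2.1, Ne.symm hm2.2, exp_zero, hxm]
      · intro l _
        split_ifs with hl
        · simp
        · rw [hx l hl, zero_smul]
      · intro l _ hlm
        split_ifs with hl
        · simp
        · simp [hx l hl, hlm]
      · simp
    have hσx : ∀ i ∈ s, B i * (σ x : Mat n 𝔽) = (σ x : Mat n 𝔽) * B i := by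
      intro i hi
      have : (σ x : Mat n 𝔽) = exp (x i₀ • B i₀ + x i₁ • B i₁) := by
        rw [hσ, paramMat, Finset.sum_eq_zero]
        · simp [exp_zero]
        · intro l _
          split_ifs with hl
          · simp
          · rw [hx l hl, zero_smul]
      rw [this]
      refine (mat_exp_mul_eq_mul_exp ?_).symm
      simp only [mul_add, add_mul, smul_mul_assoc, mul_smul_comm]
      rw [hcomm i hi i₀ (by simp [hs]), hcomm i hi i₁ (by simp [hs])]
    have hcoeff : ∀ t : ℝ, g.coeff σ (x + t • Pi.single m 1) i j =
        g.form 1 (exp (-(t • B m)) * B i * exp (t • B m))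
          (exp (-(t • B m)) * B j * exp (t • B m)) := by
      intro t
      have hv : ∀ i ∈ s, velocity σ (x + t • Pi.single m 1) (Pi.single i 1) =
          (σ (x + t • Pi.single m 1) : Mat n 𝔽) * (exp (-(t • B m)) * B i * exp (t • B m)) := by
        intro i hi
        rw [hvdir i hi, hσt, ← mul_assoc, hσx i hi, ← mul_assoc, ← mul_assoc,
          mul_assoc (σ x : Mat n 𝔽) (exp (t • B m)), mat_exp_mul_exp_neg, mul_one]
      have hmem : ∀ i, exp (-(t • B m)) * B i * exp (t • B m) ∈ lieAlg K := by
        intro i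
        obtain ⟨A, hA, hA'⟩ := exists_coe_eq_exp ((lieSub hK).smul_mem (-t) (hBk m))
        have h := lieAlg_conj hA (hBk i)
        have hinv : ((A⁻¹ : UGroup n 𝔽) : Mat n 𝔽) = exp (t • B m) := by
          rw [← mul_one ((A⁻¹ : UGroup n 𝔽) : Mat n 𝔽), ← mat_exp_neg_mul_exp (t • B m),
            ← mul_assoc, ← neg_smul, ← hA', coe_inv_mul, one_mul]
        rwa [hinv, hA', neg_smul] at h
      simp only [QuotientMetric.coeff, Matrix.of_apply]
      rw [hv i hi, hv j hj, form_eq hg (hσK _) (hmem i) (hmem j)]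
    simp only [hcoeff]
    have := hasDerivAt_bilin (g.form 1) (hasDerivAt_mat_exp_conj (B m) (B i))
      (hasDerivAt_mat_exp_conj (B m) (B j))
    refine this.congr_deriv ?_
    simp only [zero_smul, neg_zero, exp_zero, one_mul, mul_one]
    refine hflat (B m) (hBk m) (B i) ?_ (B j) ?_
    · rcases hi with rfl | rfl <;> simp
    · rcases hj with rfl | rfl <;> simp
  have hx0 : ∀ m ∉ s, (0 : Fin d → ℝ) m = 0 := fun _ _ => rfl
  have hcurv := sectionalCurvature_eq_zero (g.coeff σ) (x := 0) (i := i₀) (j := i₁)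
    (riemannTensor_eq_zero (g.coeff σ) s hG1 hG2 hx0 (by simp [hs]) (by simp [hs]) (by simp [hs]))
  have hlin : LinearIndependent ℝ ![(Pi.single i₀ 1 : Fin d → ℝ), Pi.single i₁ 1] := by
    rw [LinearIndependent.pair_iff]
    intro a b hab
    have h0 := congrFun hab i₀
    have h1 := congrFun hab i₁
    simp [hne, hne.symm] at h0 h1
    exact ⟨h0, h1⟩
  have := hpos d σ U hloc 0 (by simp [hU, hM0]) _ _ hlin
  exact absurd hcurv this.ne'

end Param

/-! ### Forms on matrices over `ℝ`, `ℂ`, `ℍ` -/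

/-- The properties of the real part and the conjugation that `ℝ`, `ℂ` and `ℍ` have in common. -/
class HasRealPart (𝔽 : Type) [NormedDivisionRing 𝔽] [NormedAlgebra ℝ 𝔽] [StarRing 𝔽] where
  re : 𝔽 →ₗ[ℝ] ℝ
  re_mul_comm : ∀ a b, re (a * b) = re (b * a)
  re_star : ∀ a, re (star a) = re a
  re_algebraMap : ∀ r : ℝ, re (algebraMap ℝ 𝔽 r) = r
  star_mul_self : ∀ a : 𝔽, star a * a = algebraMap ℝ 𝔽 (‖a‖ ^ 2)
  star_algebraMap : ∀ r : ℝ, star (algebraMap ℝ 𝔽 r) = algebraMap ℝ 𝔽 r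

open HasRealPart

section Forms

/-- A symmetric positive semidefinite form vanishes on its isotropic vectors. -/
theorem eq_zero_of_isotropic {E : Type*} [AddCommGroup E] [Module ℝ E]
    (q : LinearMap.BilinForm ℝ E) {k : Submodule ℝ E} (hsymm : ∀ x ∈ k, ∀ y ∈ k, q x y = q y x)
    (hnn : ∀ x ∈ k, 0 ≤ q x x) {x y : E} (hx : x ∈ k) (hy : y ∈ k) (h0 : q x x = 0) :
    q x y = 0 := by
  by_contra hne
  have h := hnn _ (k.add_mem (k.smul_mem (-(q y y + 1) / (2 * q x y)) hx) hy)
  simp only [map_add, map_smul, LinearMap.add_apply, LinearMap.smul_apply, smul_eq_mul, h0,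
    hsymm y hy x hx] at h
  have h2 : -(q y y + 1) / (2 * q x y) * q x y = -(q y y + 1) / 2 := by field_simp
  nlinarith

/-- A symmetric form has an eigenvector with respect to a positive definite form: a maximizer of the
Rayleigh quotient. -/
theorem exists_eigenvector_aux {E : Type*} [NormedAddCommGroup E] [NormedSpace ℝ E]
    [FiniteDimensional ℝ E] (s e : LinearMap.BilinForm ℝ E) {W : Submodule ℝ E}
    (hs : ∀ x ∈ W, ∀ y ∈ W, s x y = s y x) (he : ∀ x ∈ W, ∀ y ∈ W, e x y = e y x)
    (hpos : ∀ x ∈ W, x ≠ 0 → 0 < e x x) {w : E} (hw : w ∈ W) (hw0 : w ≠ 0) :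
    ∃ x ∈ W, x ≠ 0 ∧ ∃ c : ℝ, ∀ y ∈ W, s x y = c * e x y := by
  have hc : ∀ b : LinearMap.BilinForm ℝ E, Continuous fun x => b x x := by
    intro b
    set b' : E →L[ℝ] E →L[ℝ] ℝ := LinearMap.toContinuousBilinearMap b
    exact b'.continuous.clm_apply continuous_id
  have : ProperSpace E := FiniteDimensional.proper ℝ E
  have hcomp : IsCompact (Metric.sphere (0 : E) 1 ∩ W) :=
    (isCompact_sphere 0 1).inter_right (Submodule.closed_of_finiteDimensional W)
  have hnz : ∀ x ∈ Metric.sphere (0 : E) 1 ∩ W, x ≠ 0 := by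
    rintro x ⟨hx, -⟩ rfl
    simp at hx
  obtain ⟨x, hx, hmax⟩ := hcomp.exists_isMaxOn (f := fun x => s x x / e x x)
    ⟨‖w‖⁻¹ • w, by simp [norm_smul, inv_mul_cancel₀ (norm_ne_zero_iff.2 hw0)], W.smul_mem _ hw⟩
    ((hc s).continuousOn.div (hc e).continuousOn fun x hx => (hpos x hx.2 (hnz x hx)).ne')
  refine ⟨x, hx.2, hnz x hx, s x x / e x x, fun y hy => ?_⟩
  set c := s x x / e x x with hc'
  have hle : ∀ y ∈ W, s y y ≤ c * e y y := by
    intro y hy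
    by_cases hy0 : y = 0
    · simp [hy0]
    have hny : ‖y‖ ≠ 0 := norm_ne_zero_iff.2 hy0
    have h1 := hmax (a := ‖y‖⁻¹ • y) ⟨by simp [norm_smul, inv_mul_cancel₀ hny], W.smul_mem _ hy⟩
    have h2 := hpos y hy hy0
    have h3 : s (‖y‖⁻¹ • y) (‖y‖⁻¹ • y) / e (‖y‖⁻¹ • y) (‖y‖⁻¹ • y) = s y y / e y y := by
      simp only [map_smul, LinearMap.smul_apply, smul_eq_mul]
      field_simp
    simp only [Set.mem_ofPred_eq, h3] at h1
    rwa [div_le_iff₀ h2] at h1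
  have key := eq_zero_of_isotropic (c • e - s) (k := W) (x := x) (y := y)
    (fun x hx y hy => by simp [hs x hx y hy, he x hx y hy])
    (fun x hx => by simpa using hle x hx) hx.2 hy
    (by
      have := (hpos x hx.2 (hnz x hx)).ne'
      simp [hc', div_mul_cancel₀ _ this])
  simp only [LinearMap.sub_apply, LinearMap.smul_apply, smul_eq_mul] at key
  linarith

variable {n : ℕ} {𝔽 : Type} [NormedDivisionRing 𝔽] [NormedAlgebra ℝ 𝔽] [StarRing 𝔽]
  [FiniteDimensional ℝ 𝔽] [ContinuousStar 𝔽] [HasRealPart 𝔽]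

theorem star_smul_real (r : ℝ) (a : 𝔽) : star (r • a) = r • star a := by
  rw [Algebra.smul_def, star_mul, star_algebraMap, ← Algebra.commutes, ← Algebra.smul_def]

instance : StarModule ℝ 𝔽 := ⟨fun r a => by rw [star_smul_real]; rfl⟩

theorem exists_eigenvector (s e : LinearMap.BilinForm ℝ (Mat n 𝔽)) {W : Submodule ℝ (Mat n 𝔽)}
    (hs : ∀ x ∈ W, ∀ y ∈ W, s x y = s y x) (he : ∀ x ∈ W, ∀ y ∈ W, e x y = e y x)
    (hpos : ∀ x ∈ W, x ≠ 0 → 0 < e x x) {w : Mat n 𝔽} (hw : w ∈ W) (hw0 : w ≠ 0) :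
    ∃ x ∈ W, x ≠ 0 ∧ ∃ c : ℝ, ∀ y ∈ W, s x y = c * e x y := by
  let _ : NormedRing (Mat n 𝔽) := Matrix.linftyOpNormedRing
  let _ : NormedAlgebra ℝ (Mat n 𝔽) := Matrix.linftyOpNormedAlgebra
  exact exists_eigenvector_aux s e hs he hpos hw hw0

/-- The real part of the trace. -/
noncomputable def reTr : Mat n 𝔽 →ₗ[ℝ] ℝ := re ∘ₗ Matrix.traceLinearMap (Fin n) ℝ 𝔽

theorem reTr_apply (A : Mat n 𝔽) : reTr A = ∑ i, re (A i i) := by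
  simp [reTr, Matrix.trace]

theorem reTr_mul_comm (A B : Mat n 𝔽) : reTr (A * B) = reTr (B * A) := by
  simp only [reTr_apply, Matrix.mul_apply, map_sum]
  rw [Finset.sum_comm]
  exact Finset.sum_congr rfl fun i _ => Finset.sum_congr rfl fun j _ => re_mul_comm _ _

theorem reTr_star (A : Mat n 𝔽) : reTr (star A) = reTr A := by
  simp [reTr_apply, Matrix.star_apply, re_star]

theorem star_mul_self_apply (A : Mat n 𝔽) (i : Fin n) :
    (star A * A) i i = algebraMap ℝ 𝔽 (∑ a, ‖A a i‖ ^ 2) := by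
  simp [Matrix.mul_apply, Matrix.star_apply, star_mul_self]

theorem reTr_star_mul_self_pos {A : Mat n 𝔽} (hA : A ≠ 0) : 0 < reTr (star A * A) := by
  rw [reTr_apply]
  simp only [star_mul_self_apply, re_algebraMap]
  have h0 : ∀ i ∈ Finset.univ, 0 ≤ ∑ a, ‖A a i‖ ^ 2 := fun i _ => by positivity
  refine lt_of_le_of_ne (Finset.sum_nonneg h0) fun h => hA ?_
  ext a i
  have h1 := (Finset.sum_eq_zero_iff_of_nonneg h0).1 h.symm i (Finset.mem_univ i)
  have h2 := (Finset.sum_eq_zero_iff_of_nonneg fun a _ => by positivity).1 h1 a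
    (Finset.mem_univ a)
  simpa using h2

/-- The form `Re tr (A* B)`. -/
noncomputable def traceForm : LinearMap.BilinForm ℝ (Mat n 𝔽) :=
  LinearMap.mk₂ ℝ (fun A B => reTr (star A * B)) (by intros; simp [add_mul])
    (by intros; simp) (by intros; simp [mul_add]) (by intros; simp)

theorem traceForm_apply (A B : Mat n 𝔽) : traceForm A B = reTr (star A * B) := rfl

theorem traceForm_symm (A B : Mat n 𝔽) : traceForm A B = traceForm B A := by
  rw [traceForm_apply, traceForm_apply, ← reTr_star, star_mul, star_star]

/-! ### Forms on the isotropy representation -/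

/-- Elements of the Lie algebra of a group of unitary matrices are skew-hermitian. -/
theorem star_eq_neg_of_mem_lieAlg {L : Subgroup (UGroup n 𝔽)} {X : Mat n 𝔽} (hX : X ∈ lieAlg L) :
    star X = -X := by
  have h : ∀ t : ℝ, exp (t • star X) = exp (t • (-X)) := by
    intro t
    obtain ⟨A, -, hA⟩ := hX t
    have h1 : star (A : Mat n 𝔽) = exp (t • star X) := by
      rw [hA, NormedSpace.star_exp, star_smul]; rfl
    have h2 : star (A : Mat n 𝔽) * A = 1 := Unitary.star_mul_self_of_mem A.2
    rw [← h1, smul_neg, ← mul_one (star (A : Mat n 𝔽)), ← mat_exp_mul_exp_neg (t • X),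
      ← mul_assoc, ← hA, h2, one_mul]
  have h1 := hasDerivAt_mat_exp_smul (star X)
  simp only [h] at h1
  exact mat_hasDerivAt_unique h1 (hasDerivAt_mat_exp_smul (-X))

/-- The form on the Lie algebra of `K` that is induced by a homogeneous metric on `K/H` of positive
curvature: its kernel is the Lie algebra of `H`, it is invariant under the adjoint action of `H`, and
there is no pair of vectors spanning a flat totally geodesic surface. -/
structure IsotropyForm (K H : Subgroup (UGroup n 𝔽)) (q : LinearMap.BilinForm ℝ (Mat n 𝔽)) :
    Prop where
  symm : ∀ V ∈ lieAlg K, ∀ W ∈ lieAlg K, q V W = q W V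
  nonneg : ∀ V ∈ lieAlg K, 0 ≤ q V V
  eq_zero_iff : ∀ V ∈ lieAlg K, (q V V = 0 ↔ V ∈ lieAlg H)
  skew : ∀ B ∈ lieAlg H, ∀ V ∈ lieAlg K, ∀ W ∈ lieAlg K,
    q (V * B - B * V) W + q V (W * B - B * W) = 0
  no_flat : ∀ X ∈ lieAlg K, ∀ Y ∈ lieAlg K, X * Y = Y * X →
    (∀ W ∈ lieAlg K, ∀ P ∈ ({X, Y} : Set (Mat n 𝔽)), ∀ Q ∈ ({X, Y} : Set (Mat n 𝔽)),
      q (P * W - W * P) Q + q P (Q * W - W * Q) = 0) →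
    ∃ a b : ℝ, a • X + b • Y ∈ lieAlg H ∧ ¬ (a = 0 ∧ b = 0)

/-- The value of an invariant metric at the base point. Its invariance under `H` is differentiated along
one-parameter groups. -/
theorem exists_isotropyForm {K H : Subgroup (UGroup n 𝔽)} (hK : IsClosed (K : Set (UGroup n 𝔽)))
    (hH : IsClosed (H : Set (UGroup n 𝔽))) (hle : H ≤ K) (h : AdmitsPositiveCurvature K H) :
    ∃ q, IsotropyForm K H q := by
  obtain ⟨g, hg, hpos⟩ := h
  have ht : ∀ L : Subgroup (UGroup n 𝔽), tangentAt L 1 = lieAlg L := by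
    intro L; ext V
    constructor
    · rintro ⟨X, hX, rfl⟩; simpa using hX
    · exact fun hV => ⟨V, hV, by simp⟩
  refine ⟨g.form 1, ⟨?_, ?_, ?_, ?_, ?_⟩⟩
  · intro V hV W hW
    exact g.symm 1 K.one_mem V (by rwa [ht]) W (by rwa [ht])
  · intro V hV
    exact g.nonneg 1 K.one_mem V (by rwa [ht])
  · intro V hV
    rw [← ht H]
    exact g.eq_zero_iff 1 K.one_mem V (by rwa [ht])
  · intro B hB V hV W hW
    have hinv : ∀ A ∈ H, ∀ V ∈ lieAlg K, ∀ W ∈ lieAlg K,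
        g.form 1 ((A⁻¹ : UGroup n 𝔽) * V * A) ((A⁻¹ : UGroup n 𝔽) * W * A) = g.form 1 V W := by
      intro A hA V hV W hW
      have hAd : ∀ V ∈ lieAlg K, ((A⁻¹ : UGroup n 𝔽) : Mat n 𝔽) * V * A ∈ lieAlg K := by
        intro V hV
        have := lieAlg_conj (K.inv_mem (hle hA)) hV
        rwa [inv_inv] at this
      have h1 := g.right_inv 1 K.one_mem A hA V (by rwa [ht]) W (by rwa [ht])
      have h2 := form_eq hg (hle hA) (hAd V hV) (hAd W hW)
      rw [← h1, ← h2, one_mul]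
      simp only [← mul_assoc, mul_coe_inv, one_mul]
    have hconst : ∀ t : ℝ, g.form 1 (exp (-(t • B)) * V * exp (t • B))
        (exp (-(t • B)) * W * exp (t • B)) = g.form 1 V W := by
      intro t
      obtain ⟨A, hA, hA'⟩ := hB t
      have hinv' : ((A⁻¹ : UGroup n 𝔽) : Mat n 𝔽) = exp (-(t • B)) := by
        rw [← mul_one ((A⁻¹ : UGroup n 𝔽) : Mat n 𝔽), ← mat_exp_mul_exp_neg (t • B),
          ← mul_assoc, ← hA', coe_inv_mul, one_mul]
      rw [← hinv', ← hA']
      exact hinv A hA V hV W hW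
    have hd := hasDerivAt_bilin (g.form 1) (hasDerivAt_mat_exp_conj B V)
      (hasDerivAt_mat_exp_conj B W)
    simp only [hconst] at hd
    have := hd.unique (hasDerivAt_const 0 _)
    simpa [exp_zero] using this
  · intro X hX Y hY hXY hflat
    by_contra hcon
    push Not at hcon
    exact false_of_flat_pair hK hH hg hpos hX hY hXY hcon hflat

theorem mem_conjugate {g A : UGroup n 𝔽} {L : Subgroup (UGroup n 𝔽)} :
    A ∈ conjugate g L ↔ g⁻¹ * A * g ∈ L := by
  unfold conjugate
  constructor
  · rintro ⟨B, hB, rfl⟩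
    have : g⁻¹ * (g * B * g⁻¹) * g = B := by group
    simpa [this] using hB
  · intro h
    exact ⟨_, h, by simp [mul_assoc]⟩

theorem mem_lieAlg_conjugate {g : UGroup n 𝔽} {L : Subgroup (UGroup n 𝔽)} {X : Mat n 𝔽} :
    X ∈ lieAlg (conjugate g L) ↔ ((g⁻¹ : UGroup n 𝔽) : Mat n 𝔽) * X * g ∈ lieAlg L := by
  have key : ∀ t : ℝ, exp (t • (((g⁻¹ : UGroup n 𝔽) : Mat n 𝔽) * X * g))
      = ((g⁻¹ : UGroup n 𝔽) : Mat n 𝔽) * exp (t • X) * (g : Mat n 𝔽) := by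
    intro t
    have h := mat_exp_mul_eq_mul_exp (A := t • (((g⁻¹ : UGroup n 𝔽) : Mat n 𝔽) * X * (g : Mat n 𝔽)))
      (B := t • X) (X := ((g⁻¹ : UGroup n 𝔽) : Mat n 𝔽)) (by
        rw [smul_mul_assoc, mul_assoc _ (g : Mat n 𝔽), mul_coe_inv, mul_one, mul_smul_comm])
    rw [← h, mul_assoc (exp _), coe_inv_mul, mul_one]
  constructor
  · intro h t
    obtain ⟨A, hA, hA'⟩ := h t
    exact ⟨g⁻¹ * A * g, mem_conjugate.1 hA, by rw [key, ← hA']; rfl⟩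
  · intro h t
    obtain ⟨A, hA, hA'⟩ := h t
    refine ⟨g * A * g⁻¹, mem_conjugate.2 (by simpa [mul_assoc] using hA), ?_⟩
    rw [coe_mul, coe_mul, hA', key]
    simp only [← mul_assoc, mul_coe_inv, one_mul]
    rw [mul_assoc, mul_coe_inv, mul_one]

/-- The map `X ↦ g X g⁻¹`. -/
noncomputable def adjointMap (g : UGroup n 𝔽) : Mat n 𝔽 →ₗ[ℝ] Mat n 𝔽 :=
  LinearMap.mulRight ℝ ((g⁻¹ : UGroup n 𝔽) : Mat n 𝔽) ∘ₗ LinearMap.mulLeft ℝ (g : Mat n 𝔽)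

theorem adjointMap_apply (g : UGroup n 𝔽) (X : Mat n 𝔽) :
    adjointMap g X = (g : Mat n 𝔽) * X * (g⁻¹ : UGroup n 𝔽) := rfl

theorem adjointMap_mul (g : UGroup n 𝔽) (X Y : Mat n 𝔽) :
    adjointMap g (X * Y) = adjointMap g X * adjointMap g Y := by
  simp only [adjointMap_apply, mul_assoc]
  rw [← mul_assoc ((g⁻¹ : UGroup n 𝔽) : Mat n 𝔽) (g : Mat n 𝔽), coe_inv_mul, one_mul]

theorem mem_lieAlg_conjugate_inv {g : UGroup n 𝔽} {L : Subgroup (UGroup n 𝔽)} {X : Mat n 𝔽} :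
    X ∈ lieAlg (conjugate g⁻¹ L) ↔ adjointMap g X ∈ lieAlg L := by
  rw [mem_lieAlg_conjugate, inv_inv, adjointMap_apply]

theorem IsotropyForm.conjugate {K H : Subgroup (UGroup n 𝔽)}
    {q : LinearMap.BilinForm ℝ (Mat n 𝔽)} (hq : IsotropyForm K H q) {g : UGroup n 𝔽} (hg : g ∈ K) :
    IsotropyForm K (conjugate g⁻¹ H) (q.compl₁₂ (adjointMap g) (adjointMap g)) := by
  have hK : ∀ X ∈ lieAlg K, adjointMap g X ∈ lieAlg K := fun X hX => lieAlg_conj hg hX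
  have hsurj : ∀ W ∈ lieAlg K, ∃ W' ∈ lieAlg K, adjointMap g W' = W := by
    intro W hW
    refine ⟨_, lieAlg_conj (K.inv_mem hg) hW, ?_⟩
    rw [adjointMap_apply, inv_inv]
    simp only [← mul_assoc, mul_coe_inv, one_mul]
    rw [mul_assoc, mul_coe_inv, mul_one]
  constructor
  · exact fun V hV W hW => hq.symm _ (hK V hV) _ (hK W hW)
  · exact fun V hV => hq.nonneg _ (hK V hV)
  · intro V hV
    rw [mem_lieAlg_conjugate_inv]
    exact hq.eq_zero_iff _ (hK V hV)
  · intro B hB V hV W hW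
    rw [mem_lieAlg_conjugate_inv] at hB
    simpa [adjointMap_mul] using hq.skew _ hB _ (hK V hV) _ (hK W hW)
  · intro X hX Y hY hXY hflat
    obtain ⟨a, b, hab, hne⟩ := hq.no_flat _ (hK X hX) _ (hK Y hY)
      (by rw [← adjointMap_mul, hXY, adjointMap_mul]) (by
        intro W hW P hP Q hQ
        obtain ⟨W, hW', rfl⟩ := hsurj W hW
        have lift : ∀ P ∈ ({adjointMap g X, adjointMap g Y} : Set (Mat n 𝔽)),
            ∃ P' ∈ ({X, Y} : Set (Mat n 𝔽)), adjointMap g P' = P := by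
          rintro P (rfl | rfl)
          · exact ⟨X, by simp, rfl⟩
          · exact ⟨Y, by simp, rfl⟩
        obtain ⟨P, hP', rfl⟩ := lift P hP
        obtain ⟨Q, hQ', rfl⟩ := lift Q hQ
        simpa [adjointMap_mul] using hflat W hW' P hP' Q hQ')
    refine ⟨a, b, ?_, hne⟩
    rw [mem_lieAlg_conjugate_inv]
    simpa using hab

end Forms

/-! ### The off-diagonal part and the lower block algebra -/

section Block

variable {n : ℕ} {𝔽 : Type} [NormedDivisionRing 𝔽] [NormedAlgebra ℝ 𝔽] [StarRing 𝔽]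
  [FiniteDimensional ℝ 𝔽] [ContinuousStar 𝔽] [HasRealPart 𝔽] {k : ℕ}

/-- The projection `diag(0, I_k)` onto the last `k` coordinates. -/
def lowProj (n : ℕ) (𝔽 : Type) [NormedDivisionRing 𝔽] (k : ℕ) : Mat n 𝔽 :=
  Matrix.diagonal fun i => if i.val + k < n then 0 else 1

local notation "D" => lowProj n 𝔽 k

theorem lowProj_mul_apply (A : Mat n 𝔽) (i j : Fin n) :
    (D * A) i j = if i.val + k < n then 0 else A i j := by
  rw [lowProj, Matrix.diagonal_mul]; split_ifs <;> simp

theorem mul_lowProj_apply (A : Mat n 𝔽) (i j : Fin n) :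
    (A * D) i j = if j.val + k < n then 0 else A i j := by
  rw [lowProj, Matrix.mul_diagonal]; split_ifs <;> simp

theorem lowProj_mul_self : D * D = D := by
  ext i j
  rw [lowProj_mul_apply, lowProj]
  by_cases h : i = j
  · subst h; simp
  · simp [h]

theorem star_lowProj : star D = D := by
  ext i j
  rw [Matrix.star_apply, lowProj]
  by_cases h : i = j
  · subst h; simp only [Matrix.diagonal_apply_eq]; split_ifs <;> simp
  · simp [h, Ne.symm h]

theorem mem_block_iff {K : Subgroup (UGroup n 𝔽)} {A : UGroup n 𝔽} :
    A ∈ block K k ↔ A ∈ K ∧ (1 - D) * (A : Mat n 𝔽) = 1 - D ∧ (A : Mat n 𝔽) * (1 - D) = 1 - D := by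
  have h1 : ∀ B : Mat n 𝔽, (1 - D) * B = 1 - D ↔
      ∀ i j : Fin n, i.val + k < n → B i j = (1 : Mat n 𝔽) i j := by
    intro B
    rw [← Matrix.ext_iff]
    refine forall₂_congr fun i j => ?_
    rw [sub_mul, one_mul, Matrix.sub_apply, Matrix.sub_apply, lowProj_mul_apply,
      ← mul_one D, lowProj_mul_apply]
    split_ifs with h <;> simp [h]
  have h2 : ∀ B : Mat n 𝔽, B * (1 - D) = 1 - D ↔
      ∀ i j : Fin n, j.val + k < n → B i j = (1 : Mat n 𝔽) i j := by
    intro B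
    rw [← Matrix.ext_iff]
    refine forall₂_congr fun i j => ?_
    rw [mul_sub, mul_one, Matrix.sub_apply, Matrix.sub_apply, mul_lowProj_apply,
      ← one_mul D, mul_lowProj_apply]
    split_ifs with h <;> simp [h]
  rw [h1, h2]
  constructor
  · rintro ⟨hK, h⟩
    exact ⟨hK, fun i j hi => h i j (Or.inl hi), fun i j hj => h i j (Or.inr hj)⟩
  · rintro ⟨hK, ha, hb⟩
    exact ⟨hK, fun i j h => h.elim (ha i j) (hb i j)⟩

/-- The elements of the Lie algebra of `K` that are supported in the lower `k × k` block. -/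
def blockAlg (K : Subgroup (UGroup n 𝔽)) (k : ℕ) : Set (Mat n 𝔽) :=
  {X | X ∈ lieAlg K ∧ lowProj n 𝔽 k * X = X ∧ X * lowProj n 𝔽 k = X}

theorem blockAlg_subset {K : Subgroup (UGroup n 𝔽)} : blockAlg K k ⊆ lieAlg (block K k) := by
  rintro X ⟨hX, h1, h2⟩ t
  obtain ⟨A, hA, hA'⟩ := hX t
  refine ⟨A, mem_block_iff.2 ⟨hA, ?_, ?_⟩, hA'⟩
  · rw [hA']
    exact mat_mul_exp_of_mul_eq_zero (by rw [mul_smul_comm, sub_mul, one_mul, h1, sub_self, smul_zero])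
  · rw [hA']
    exact mat_exp_mul_of_mul_eq_zero (by rw [smul_mul_assoc, mul_sub, mul_one, h2, sub_self, smul_zero])

/-- What the argument uses of the group `K` and its lower `k × k` block: `K` is closed, its Lie algebra
contains the skew-hermitian matrices with zero diagonal, the lower block of an element of the Lie
algebra differs from an element of the lower block algebra by a matrix commuting with the latter, and the
lower block algebra generates the ring of all matrices supported in the lower block. -/
structure IsBlockGroup (K : Subgroup (UGroup n 𝔽)) (k : ℕ) : Prop where
  isClosed : IsClosed (K : Set (UGroup n 𝔽))
  two_le : 2 ≤ k
  zero_diag : ∀ X : Mat n 𝔽, star X = -X → (∀ i, X i i = 0) → X ∈ lieAlg K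
  split : ∀ Z ∈ lieAlg K, ∃ L ∈ blockAlg K k, ∀ B ∈ blockAlg K k,
    B * (lowProj n 𝔽 k * Z * lowProj n 𝔽 k - L) = (lowProj n 𝔽 k * Z * lowProj n 𝔽 k - L) * B
  generate : ∀ P : Submodule ℝ (Mat n 𝔽), (∀ B ∈ blockAlg K k, B ∈ P) →
    (∀ T ∈ P, ∀ B ∈ blockAlg K k, T * B ∈ P) →
    ∀ i j : Fin n, n ≤ i.val + k → n ≤ j.val + k → ∀ z : 𝔽, Matrix.single i j z ∈ P

theorem IsBlockGroup.mem_of_generate {K : Subgroup (UGroup n 𝔽)} (hK : IsBlockGroup K k)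
    {P : Submodule ℝ (Mat n 𝔽)} (h1 : ∀ B ∈ blockAlg K k, B ∈ P)
    (h2 : ∀ T ∈ P, ∀ B ∈ blockAlg K k, T * B ∈ P) {T : Mat n 𝔽} (hT1 : D * T = T)
    (hT2 : T * D = T) : T ∈ P := by
  rw [Matrix.matrix_eq_sum_single T]
  refine Submodule.sum_mem _ fun i _ => Submodule.sum_mem _ fun j _ => ?_
  by_cases hi : i.val + k < n
  · have : T i j = 0 := by rw [← hT1, lowProj_mul_apply, if_pos hi]
    rw [this, Matrix.single_zero]; exact P.zero_mem
  by_cases hj : j.val + k < n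
  · have : T i j = 0 := by rw [← hT2, mul_lowProj_apply, if_pos hj]
    rw [this, Matrix.single_zero]; exact P.zero_mem
  exact hK.generate P h1 h2 i j (by omega) (by omega) _

/-- The matrices supported in the upper right corner. -/
def IsOff (k : ℕ) (V : Mat n 𝔽) : Prop := lowProj n 𝔽 k * V = 0 ∧ V * lowProj n 𝔽 k = V

/-- The skew-hermitian matrix `V - V*`. -/
def skewPart (V : Mat n 𝔽) : Mat n 𝔽 := V - star V

theorem skewPart_add (V W : Mat n 𝔽) : skewPart (V + W) = skewPart V + skewPart W := by
  simp only [skewPart, star_add]; abel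

theorem skewPart_smul (c : ℝ) (V : Mat n 𝔽) : skewPart (c • V) = c • skewPart V := by
  simp only [skewPart, star_smul, smul_sub]; rfl

theorem skewPart_zero : skewPart (0 : Mat n 𝔽) = 0 := by simp [skewPart]

theorem star_skewPart (V : Mat n 𝔽) : star (skewPart V) = -skewPart V := by
  simp [skewPart]

theorem IsOff.star_mul {V : Mat n 𝔽} (hV : IsOff k V) : star V * D = 0 := by
  rw [← star_lowProj (k := k), ← StarMul.star_mul, hV.1, star_zero]

theorem IsOff.mul_star {V : Mat n 𝔽} (hV : IsOff k V) : D * star V = star V := by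
  rw [← star_lowProj (k := k), ← StarMul.star_mul, hV.2]

theorem IsOff.mul {V T : Mat n 𝔽} (hV : IsOff k V) (hT : T * D = T) : IsOff k (V * T) :=
  ⟨by rw [← mul_assoc, hV.1, zero_mul], by rw [mul_assoc, hT]⟩

theorem IsOff.mul_off {V W : Mat n 𝔽} (hV : IsOff k V) (hW : IsOff k W) : V * W = 0 := by
  rw [← hV.2, mul_assoc, hW.1, mul_zero]

theorem IsOff.star_mul_star {V W : Mat n 𝔽} (hV : IsOff k V) (hW : IsOff k W) :
    star V * star W = 0 := by
  rw [← StarMul.star_mul, hW.mul_off hV, star_zero]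

theorem isOff_off (Z : Mat n 𝔽) : IsOff k ((1 - D) * Z * D) := by
  constructor
  · rw [← mul_assoc, ← mul_assoc, mul_sub, mul_one, lowProj_mul_self, sub_self, zero_mul, zero_mul]
  · rw [mul_assoc, lowProj_mul_self]

theorem off_skewPart {V : Mat n 𝔽} (hV : IsOff k V) : (1 - D) * skewPart V * D = V := by
  rw [skewPart, mul_sub, sub_mul, sub_mul 1 D, sub_mul 1 D, hV.1, hV.mul_star]
  simp [hV.2]

theorem IsOff.diag {V : Mat n 𝔽} (hV : IsOff k V) (i : Fin n) : V i i = 0 := by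
  by_cases hi : i.val + k < n
  · rw [← hV.2, mul_lowProj_apply, if_pos hi]
  · have := congrFun (congrFun hV.1 i) i
    rwa [lowProj_mul_apply, if_neg hi] at this

theorem IsBlockGroup.skewPart_mem {K : Subgroup (UGroup n 𝔽)} (hK : IsBlockGroup K k)
    {V : Mat n 𝔽} (hV : IsOff k V) : skewPart V ∈ lieAlg K :=
  hK.zero_diag _ (star_skewPart V) fun i => by
    simp [skewPart, Matrix.star_apply, hV.diag]

theorem skewPart_bracket {K : Subgroup (UGroup n 𝔽)} {V B : Mat n 𝔽} (hV : IsOff k V)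
    (hB : B ∈ blockAlg K k) : skewPart V * B - B * skewPart V = skewPart (V * B) := by
  have hs := star_eq_neg_of_mem_lieAlg hB.1
  have h1 : B * V = 0 := by rw [← hB.2.2, mul_assoc, hV.1, mul_zero]
  have h2 : star V * B = 0 := by rw [← hB.2.1, ← mul_assoc, hV.star_mul, zero_mul]
  rw [skewPart, skewPart, sub_mul, mul_sub, h1, h2, star_mul, hs]
  simp

/-- An element of the Lie algebra of `K` is the sum of its off-diagonal part, a matrix commuting with
the lower block algebra, and an element of that algebra. -/
theorem IsBlockGroup.decomp {K : Subgroup (UGroup n 𝔽)} (hK : IsBlockGroup K k) {Z : Mat n 𝔽}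
    (hZ : Z ∈ lieAlg K) : ∃ C ∈ lieAlg K, ∃ L ∈ blockAlg K k,
      Z = skewPart ((1 - D) * Z * D) + C + L ∧ ∀ B ∈ blockAlg K k, B * C = C * B := by
  obtain ⟨L, hL, hcomm⟩ := hK.split Z hZ
  have hs := star_eq_neg_of_mem_lieAlg hZ
  have hstar : star ((1 - D) * Z * D) = -(D * Z * (1 - D)) := by
    rw [star_mul, star_mul, star_sub, star_one, star_lowProj, hs]
    simp [mul_assoc]
  have hCeq : Z = skewPart ((1 - D) * Z * D) + ((1 - D) * Z * (1 - D) + (D * Z * D - L)) + L := by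
    rw [skewPart, hstar]
    noncomm_ring
  refine ⟨(1 - D) * Z * (1 - D) + (D * Z * D - L), ?_, L, hL, hCeq, ?_⟩
  · rw [eq_sub_of_add_eq' (eq_sub_of_add_eq hCeq.symm)]
    exact (lieSub hK.isClosed).sub_mem ((lieSub hK.isClosed).sub_mem hZ hL.1)
      (hK.skewPart_mem (isOff_off (k := k) Z))
  · intro B hB
    have h1 : B * (1 - D) = 0 := by rw [mul_sub, mul_one, hB.2.2, sub_self]
    have h2 : (1 - D) * B = 0 := by rw [sub_mul, one_mul, hB.2.1, sub_self]
    rw [mul_add, add_mul, hcomm B hB, ← mul_assoc, ← mul_assoc, h1, zero_mul, zero_mul,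
      mul_assoc _ (1 - D) B, h2, mul_zero]

variable {K H : Subgroup (UGroup n 𝔽)}

/-- If the Lie algebra of `H` contains the lower block algebra, it is closed under multiplying the
off-diagonal part of an element by any matrix of the lower block. -/
theorem IsBlockGroup.off_mul_mem (hK : IsBlockGroup K k) (hH : IsClosed (H : Set (UGroup n 𝔽)))
    (hHK : H ≤ K) (hbl : block K k ≤ H) {Z : Mat n 𝔽} (hZ : Z ∈ lieAlg H) {T : Mat n 𝔽}
    (hT1 : D * T = T) (hT2 : T * D = T) :
    skewPart ((1 - D) * Z * D * T) ∈ lieAlg H := by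
  set V := (1 - D) * Z * D with hV
  have hVoff : IsOff k V := isOff_off Z
  have hsub : blockAlg K k ⊆ lieAlg H := blockAlg_subset.trans (lieAlg_mono hbl)
  let P : Submodule ℝ (Mat n 𝔽) :=
    { carrier := {T | T * D = T ∧ skewPart (V * T) ∈ lieAlg H}
      add_mem' := fun {S T} hS hT => ⟨by rw [add_mul, hS.1, hT.1], by
        rw [mul_add, skewPart_add]; exact (lieSub hH).add_mem hS.2 hT.2⟩
      zero_mem' := ⟨zero_mul _, by
        rw [mul_zero, skewPart_zero]; exact (lieSub hH).zero_mem⟩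
      smul_mem' := fun c T hT => ⟨by rw [smul_mul_assoc, hT.1], by
        rw [mul_smul_comm, skewPart_smul]; exact (lieSub hH).smul_mem c hT.2⟩ }
  suffices T ∈ P from this.2
  refine hK.mem_of_generate ?_ ?_ hT1 hT2
  · intro B hB
    refine ⟨hB.2.2, ?_⟩
    obtain ⟨C, -, L, hL, hZeq, hcomm⟩ := hK.decomp (lieAlg_mono hHK hZ)
    have h1 : skewPart (V * B) = (Z * B - B * Z) - (L * B - B * L) := by
      rw [← skewPart_bracket hVoff hB, hZeq, ← hV]
      simp only [add_mul, mul_add, hcomm B hB]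
      abel
    rw [h1]
    exact (lieSub hH).sub_mem (lieAlg_bracket hH hZ (hsub hB))
      (lieAlg_bracket hH (hsub hL) (hsub hB))
  · intro T hT B hB
    refine ⟨by rw [mul_assoc, hB.2.2], ?_⟩
    rw [← mul_assoc, ← skewPart_bracket (hVoff.mul hT.1) hB]
    exact lieAlg_bracket hH hT.2 (hsub hB)

variable {q : LinearMap.BilinForm ℝ (Mat n 𝔽)}

theorem IsotropyForm.kernel (hq : IsotropyForm K H q) (hKc : IsClosed (K : Set (UGroup n 𝔽)))
    (hHK : H ≤ K) {V L : Mat n 𝔽} (hV : V ∈ lieAlg K) (hL : L ∈ lieAlg H) : q V L = 0 := by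
  have hL' := lieAlg_mono hHK hL
  rw [hq.symm V hV L hL']
  exact eq_zero_of_isotropic q (k := lieSub hKc) hq.symm hq.nonneg hL' hV
    ((hq.eq_zero_iff L hL').2 hL)

/-- Multiplications by `T` and `T*` are adjoint to each other for the form on the off-diagonal part. -/
theorem IsotropyForm.off_adjoint (hq : IsotropyForm K H q) (hK : IsBlockGroup K k)
    (hbl : block K k ≤ H) {V W T : Mat n 𝔽} (hV : IsOff k V) (hW : IsOff k W)
    (hT1 : D * T = T) (hT2 : T * D = T) :
    q (skewPart (V * T)) (skewPart W) = q (skewPart V) (skewPart (W * star T)) := by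
  have hsub : blockAlg K k ⊆ lieAlg H := blockAlg_subset.trans (lieAlg_mono hbl)
  let P : Submodule ℝ (Mat n 𝔽) :=
    { carrier := {T | D * T = T ∧ T * D = T ∧ ∀ V W, IsOff k V → IsOff k W →
        q (skewPart (V * T)) (skewPart W) = q (skewPart V) (skewPart (W * star T))}
      add_mem' := fun {S T} hS hT => ⟨by rw [mul_add, hS.1, hT.1], by rw [add_mul, hS.2.1, hT.2.1],
        fun V W hV hW => by
          rw [mul_add, skewPart_add, star_add, mul_add, skewPart_add, map_add, map_add,
            LinearMap.add_apply, hS.2.2 V W hV hW, hT.2.2 V W hV hW]⟩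
      zero_mem' := ⟨mul_zero _, zero_mul _, fun V W _ _ => by simp [skewPart_zero]⟩
      smul_mem' := fun c T hT => ⟨by rw [mul_smul_comm, hT.1], by rw [smul_mul_assoc, hT.2.1],
        fun V W hV hW => by
          rw [mul_smul_comm, skewPart_smul, star_smul, star_trivial, mul_smul_comm, skewPart_smul,
            map_smul, map_smul, LinearMap.smul_apply, hT.2.2 V W hV hW]⟩ }
  have hbase : ∀ B ∈ blockAlg K k, ∀ V W, IsOff k V → IsOff k W →
      q (skewPart (V * B)) (skewPart W) = q (skewPart V) (skewPart (W * star B)) := by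
    intro B hB V W hV hW
    have h := hq.skew B (hsub hB) _ (hK.skewPart_mem hV) _ (hK.skewPart_mem hW)
    rw [skewPart_bracket hV hB, skewPart_bracket hW hB] at h
    rw [star_eq_neg_of_mem_lieAlg hB.1, mul_neg, ← neg_one_smul ℝ (W * B), skewPart_smul, map_smul,
      smul_eq_mul]
    linarith
  suffices T ∈ P from this.2.2 V W hV hW
  refine hK.mem_of_generate ?_ ?_ hT1 hT2
  · exact fun B hB => ⟨hB.2.1, hB.2.2, hbase B hB⟩
  · rintro T ⟨hT1, hT2, hT⟩ B hB
    refine ⟨by rw [← mul_assoc, hT1], by rw [mul_assoc, hB.2.2], fun V W hV hW => ?_⟩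
    have hsB : star B * D = star B := by
      rw [← star_lowProj (k := k), ← star_mul, hB.2.1]
    rw [← mul_assoc, hbase B hB _ _ (hV.mul hT2) hW, hT _ _ hV (hW.mul hsB), star_mul, mul_assoc]

/-- The off-diagonal part is orthogonal to everything that commutes with the lower block algebra. -/
theorem IsotropyForm.off_orthogonal (hq : IsotropyForm K H q) (hK : IsBlockGroup K k)
    (hbl : block K k ≤ H) {V T C : Mat n 𝔽} (hV : IsOff k V) (hC : C ∈ lieAlg K)
    (hcomm : ∀ B ∈ blockAlg K k, B * C = C * B) (hT1 : D * T = T) (hT2 : T * D = T) :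
    q (skewPart (V * T)) C = 0 := by
  have hsub : blockAlg K k ⊆ lieAlg H := blockAlg_subset.trans (lieAlg_mono hbl)
  let P : Submodule ℝ (Mat n 𝔽) :=
    { carrier := {T | T * D = T ∧ q (skewPart (V * T)) C = 0}
      add_mem' := fun {S T} hS hT => ⟨by rw [add_mul, hS.1, hT.1], by
        rw [mul_add, skewPart_add, map_add, LinearMap.add_apply, hS.2, hT.2, add_zero]⟩
      zero_mem' := ⟨zero_mul _, by simp [skewPart_zero]⟩
      smul_mem' := fun c T hT => ⟨by rw [smul_mul_assoc, hT.1], by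
        rw [mul_smul_comm, skewPart_smul, map_smul, LinearMap.smul_apply, hT.2, smul_zero]⟩ }
  have hbase : ∀ B ∈ blockAlg K k, ∀ V, IsOff k V → q (skewPart (V * B)) C = 0 := by
    intro B hB V hV
    have h := hq.skew B (hsub hB) _ (hK.skewPart_mem hV) _ hC
    rwa [skewPart_bracket hV hB, hcomm B hB, sub_self, map_zero, add_zero] at h
  suffices T ∈ P from this.2
  refine hK.mem_of_generate ?_ ?_ hT1 hT2
  · exact fun B hB => ⟨hB.2.2, hbase B hB V hV⟩
  · rintro T ⟨hT1, -⟩ B hB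
    refine ⟨by rw [mul_assoc, hB.2.2], ?_⟩
    rw [← mul_assoc]
    exact hbase B hB _ (hV.mul hT1)

/-- The form pairs an off-diagonal vector with an arbitrary one through the off-diagonal part. -/
theorem IsotropyForm.off_apply (hq : IsotropyForm K H q) (hK : IsBlockGroup K k) (hHK : H ≤ K)
    (hbl : block K k ≤ H) {V T Z : Mat n 𝔽} (hV : IsOff k V) (hZ : Z ∈ lieAlg K)
    (hT1 : D * T = T) (hT2 : T * D = T) (hVT : V * T = V) :
    q (skewPart V) Z = q (skewPart V) (skewPart ((1 - D) * Z * D * star T)) := by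
  obtain ⟨C, hC, L, hL, hZeq, hcomm⟩ := hK.decomp hZ
  have hL' : L ∈ lieAlg H := blockAlg_subset.trans (lieAlg_mono hbl) hL
  have h1 := hq.off_orthogonal hK hbl hV hC hcomm hT1 hT2
  rw [hVT] at h1
  have h2 := hq.kernel hK.isClosed hHK (hK.skewPart_mem hV) hL'
  have h3 := hq.off_adjoint hK hbl hV (isOff_off (k := k) Z) hT1 hT2
  rw [hVT] at h3
  rw [← h3]
  conv_lhs => rw [hZeq]
  rw [map_add, map_add, h1, h2, add_zero, add_zero]

end Block

/-! ### Flat planes in small blocks -/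

section Flat

variable {n : ℕ} {𝔽 : Type} [NormedDivisionRing 𝔽] [NormedAlgebra ℝ 𝔽] [StarRing 𝔽]
  [FiniteDimensional ℝ 𝔽] [ContinuousStar 𝔽] [HasRealPart 𝔽] {k : ℕ}

local notation "D" => lowProj n 𝔽 k

theorem lowProj_mul_single {i j : Fin n} (hi : n ≤ i.val + k) (z : 𝔽) :
    D * Matrix.single i j z = Matrix.single i j z := by
  ext a b
  rw [lowProj_mul_apply, Matrix.single_apply]
  split_ifs with h h' <;> first | rfl | (obtain ⟨rfl, -⟩ := h'; omega)

theorem single_mul_lowProj {i j : Fin n} (hj : n ≤ j.val + k) (z : 𝔽) :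
    Matrix.single i j z * D = Matrix.single i j z := by
  ext a b
  rw [mul_lowProj_apply, Matrix.single_apply]
  split_ifs with h h' <;> first | rfl | (obtain ⟨-, rfl⟩ := h'; omega)

theorem star_single (i j : Fin n) (z : 𝔽) :
    star (Matrix.single i j z) = Matrix.single j i (star z) := by
  rw [Matrix.star_eq_conjTranspose, Matrix.conjTranspose_single]

theorem single_one_mul_mul_single_one (i j : Fin n) (A : Mat n 𝔽) :
    Matrix.single i i 1 * A * Matrix.single j j 1 = Matrix.single i j (A i j) := by
  rw [Matrix.single_mul_mul_single, one_mul, mul_one]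

/-- The off-diagonal matrices whose only nonzero column is the `i`-th one. -/
def offColumn (k : ℕ) (i : Fin n) : Submodule ℝ (Mat n 𝔽) where
  carrier := {V | lowProj n 𝔽 k * V = 0 ∧ V * Matrix.single i i 1 = V}
  add_mem' hV hW := ⟨by rw [mul_add, hV.1, hW.1, add_zero], by rw [add_mul, hV.2, hW.2]⟩
  zero_mem' := ⟨mul_zero _, zero_mul _⟩
  smul_mem' c V hV := ⟨by rw [mul_smul_comm, hV.1, smul_zero], by rw [smul_mul_assoc, hV.2]⟩

theorem isOff_of_mem_offColumn {i : Fin n} (hi : n ≤ i.val + k) {V : Mat n 𝔽}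
    (hV : V ∈ offColumn k i) : IsOff k V :=
  ⟨hV.1, by rw [← hV.2, mul_assoc, single_mul_lowProj hi]⟩

theorem single_mul_star_of_mem_offColumn {i : Fin n} {V : Mat n 𝔽} (hV : V ∈ offColumn k i) :
    Matrix.single i i 1 * star V = star V := by
  conv_rhs => rw [← hV.2, star_mul, star_single, star_one]

theorem mul_single_mem_offColumn {V : Mat n 𝔽} (hV : D * V = 0) (i j : Fin n) (z : 𝔽) :
    V * Matrix.single i j z ∈ offColumn k j :=
  ⟨by rw [← mul_assoc, hV, zero_mul], by rw [mul_assoc, Matrix.single_mul_single_same, mul_one]⟩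

/-- Up to the factor `-2`, pairing with `V - V*` is pairing with `V*` on skew-hermitian matrices. -/
theorem reTr_skewPart_mul {V Z : Mat n 𝔽} (hZ : star Z = -Z) :
    reTr (skewPart V * Z) = -2 * reTr (star V * Z) := by
  have h : reTr (V * Z) = -reTr (star V * Z) := by
    rw [← reTr_star, star_mul, hZ, neg_mul, map_neg, reTr_mul_comm]
  rw [skewPart, sub_mul, map_sub, h]; ring

theorem traceForm_off {V Z : Mat n 𝔽} (hV : IsOff k V) :
    traceForm V ((1 - D) * Z * D) = reTr (star V * Z) := by
  have h1 : star V * (1 - D) = star V := by rw [mul_sub, mul_one, hV.star_mul, sub_zero]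
  rw [traceForm_apply, ← mul_assoc, ← mul_assoc, h1, reTr_mul_comm, ← mul_assoc, hV.mul_star]

variable {K H : Subgroup (UGroup n 𝔽)} {q : LinearMap.BilinForm ℝ (Mat n 𝔽)}

/-- The pull-back of a form under `V ↦ V - V*`. -/
noncomputable def skewForm (q : LinearMap.BilinForm ℝ (Mat n 𝔽)) :
    LinearMap.BilinForm ℝ (Mat n 𝔽) :=
  LinearMap.mk₂ ℝ (fun V W => q (skewPart V) (skewPart W))
    (by intros; simp [skewPart_add]) (by intros; simp [skewPart_smul])
    (by intros; simp [skewPart_add]) (by intros; simp [skewPart_smul])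

theorem skewForm_apply (V W : Mat n 𝔽) : skewForm q V W = q (skewPart V) (skewPart W) := rfl

/-- If `V` in the `i`-th column is an eigenvector of the form within that column, then `V - V*` is an
eigenvector of the form on the whole Lie algebra. -/
theorem IsotropyForm.eigenvector (hq : IsotropyForm K H q) (hK : IsBlockGroup K k) (hHK : H ≤ K)
    (hbl : block K k ≤ H) {i : Fin n} (hi : n ≤ i.val + k) {V : Mat n 𝔽} {c : ℝ}
    (hV : V ∈ offColumn k i) (hc : ∀ W ∈ offColumn k i, skewForm q V W = c * traceForm V W)
    {Z : Mat n 𝔽} (hZ : Z ∈ lieAlg K) :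
    q (skewPart V) Z = -c / 2 * reTr (skewPart V * Z) := by
  have hoff := isOff_of_mem_offColumn hi hV
  have h1 := hq.off_apply hK hHK hbl hoff hZ (lowProj_mul_single hi 1) (single_mul_lowProj hi 1) hV.2
  rw [star_single, star_one] at h1
  have h2 := hc _ (mul_single_mem_offColumn (isOff_off (k := k) Z).1 i i 1)
  rw [skewForm_apply] at h2
  rw [h1, h2, reTr_skewPart_mul (star_eq_neg_of_mem_lieAlg hZ), ← traceForm_off hoff,
    traceForm_apply, traceForm_apply, ← mul_assoc, reTr_mul_comm, ← mul_assoc,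
    single_mul_star_of_mem_offColumn hV]
  ring

/-- If the upper part has size at least two and `H` has no off-diagonal part, the form has
two commuting eigenvectors in different columns. So there is no form without flat surfaces. -/
theorem IsotropyForm.false_of_blockDiag (hq : IsotropyForm K H q) (hK : IsBlockGroup K k)
    (hHK : H ≤ K) (hbl : block K k ≤ H) (hk : k + 2 ≤ n)
    (hdiag : ∀ Z ∈ lieAlg H, (1 - D) * Z * D = 0) : False := by
  have hk2 := hK.two_le
  obtain ⟨a, ha⟩ : ∃ a : Fin n, a.val = 0 := ⟨⟨0, by omega⟩, rfl⟩
  obtain ⟨b, hb⟩ : ∃ b : Fin n, b.val = 1 := ⟨⟨1, by omega⟩, rfl⟩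
  obtain ⟨i, hi'⟩ : ∃ i : Fin n, i.val = n - 1 := ⟨⟨n - 1, by omega⟩, rfl⟩
  obtain ⟨j, hj'⟩ : ∃ j : Fin n, j.val = n - 2 := ⟨⟨n - 2, by omega⟩, rfl⟩
  have hi : n ≤ i.val + k := by omega
  have hj : n ≤ j.val + k := by omega
  have hij : i ≠ j := by intro h; rw [h] at hi'; omega
  have hab : a ≠ b := by intro h; rw [h] at ha; omega
  have hup : ∀ c : Fin n, c.val + k < n → ∀ (l : Fin n) (z : 𝔽),
      (Matrix.single c l z : Mat n 𝔽) ∈ offColumn k l := by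
    intro c hc l z
    refine ⟨?_, by rw [Matrix.single_mul_single_same, mul_one]⟩
    ext a b
    rw [lowProj_mul_apply, Matrix.single_apply, Matrix.zero_apply]
    split_ifs with h h' <;> first | rfl | (obtain ⟨rfl, -⟩ := h'; omega)
  have hsk : ∀ l : Fin n, n ≤ l.val + k → ∀ V ∈ (offColumn k l : Submodule ℝ (Mat n 𝔽)),
      skewPart V ∈ lieAlg K :=
    fun l hl V hV => hK.skewPart_mem (isOff_of_mem_offColumn hl hV)
  have hsymm : ∀ l : Fin n, n ≤ l.val + k → ∀ V ∈ (offColumn k l : Submodule ℝ (Mat n 𝔽)),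
      ∀ W ∈ (offColumn k l : Submodule ℝ (Mat n 𝔽)), skewForm q V W = skewForm q W V :=
    fun l hl V hV W hW => hq.symm _ (hsk l hl V hV) _ (hsk l hl W hW)
  obtain ⟨V₁, hV₁, hne₁, c₁, hc₁⟩ := exists_eigenvector (skewForm q) traceForm
    (W := offColumn k i) (hsymm i hi) (fun x _ y _ => traceForm_symm x y)
    (fun x _ hx => reTr_star_mul_self_pos hx) (hup a (by omega) i 1)
    (by intro h; simpa using congrFun (congrFun h a) i)
  -- the second eigenvector is taken in the orthogonal complement of the first one
  let W₂ : Submodule ℝ (Mat n 𝔽) := offColumn k j ⊓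
    { carrier := {V | star V₁ * V = 0}
      add_mem' := fun {V W} hV hW => by
        change star V₁ * (V + W) = 0
        rw [mul_add, show star V₁ * V = 0 from hV, show star V₁ * W = 0 from hW, add_zero]
      zero_mem' := mul_zero _
      smul_mem' := fun c V hV => by
        change star V₁ * (c • V) = 0
        rw [mul_smul_comm, show star V₁ * V = 0 from hV, smul_zero] }
  obtain ⟨U, hU, hU0⟩ : ∃ U ∈ W₂, U ≠ 0 := by
    obtain ⟨x, y, hxy, hne⟩ : ∃ x y : 𝔽, star (V₁ a i) * x + star (V₁ b i) * y = 0 ∧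
        (x ≠ 0 ∨ y ≠ 0) := by
      by_cases h0 : V₁ a i = 0
      · exact ⟨1, 0, by simp [h0], Or.inl one_ne_zero⟩
      · have h0' : star (V₁ a i) ≠ 0 := star_ne_zero.2 h0
        exact ⟨-((star (V₁ a i))⁻¹ * star (V₁ b i)), 1, by simp [h0'], Or.inr one_ne_zero⟩
    refine ⟨Matrix.single a j x + Matrix.single b j y, ⟨(offColumn k j).add_mem
      (hup a (by omega) j x) (hup b (by omega) j y), ?_⟩, ?_⟩
    · change star V₁ * _ = 0
      rw [← single_mul_star_of_mem_offColumn hV₁, mul_assoc, mul_add]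
      ext r l
      by_cases hr : r = i
      · by_cases hl : l = j
        · subst hr hl
          simp [Matrix.single_mul_apply_same, Matrix.add_apply, Matrix.star_apply, hxy]
        · simp [hr, hl, Matrix.single_mul_apply_same]
      · simp [hr]
    · intro h
      have h1 := congrFun (congrFun h a) j
      have h2 := congrFun (congrFun h b) j
      simp [hab, hab.symm] at h1 h2
      rcases hne with h | h
      · exact h h1
      · exact h h2
  obtain ⟨V₂, ⟨hV₂, horth⟩, hne₂, c₂, hc₂⟩ := exists_eigenvector (skewForm q) traceForm (W := W₂)
    (fun x hx y hy => hsymm j hj x hx.1 y hy.1) (fun x _ y _ => traceForm_symm x y)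
    (fun x _ hx => reTr_star_mul_self_pos hx) hU hU0
  replace horth : star V₁ * V₂ = 0 := horth
  have horth' : star V₂ * V₁ = 0 := by rw [← star_star (star V₂ * V₁)]; simp [horth]
  have hoff₁ := isOff_of_mem_offColumn hi hV₁
  have hoff₂ := isOff_of_mem_offColumn hj hV₂
  set r : ℝ := ∑ a, ‖V₁ a i‖ ^ 2 with hr
  have hnorm : star V₁ * V₁ = Matrix.single i i (algebraMap ℝ 𝔽 r) := by
    rw [← star_mul_self_apply, ← single_one_mul_mul_single_one, ← mul_assoc,
      single_mul_star_of_mem_offColumn hV₁, mul_assoc, hV₁.2]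
  have hr0 : r ≠ 0 := by
    intro h0
    have := reTr_star_mul_self_pos hne₁
    rw [hnorm, h0] at this
    simp at this
  have hc₂' : ∀ W ∈ (offColumn k j : Submodule ℝ (Mat n 𝔽)),
      skewForm q V₂ W = c₂ * traceForm V₂ W := by
    intro W hW
    set T : Mat n 𝔽 := Matrix.single i j (r⁻¹ • (star V₁ * W) i j) with hT
    have hV₁W : star V₁ * W = Matrix.single i j ((star V₁ * W) i j) := by
      rw [← single_one_mul_mul_single_one, ← mul_assoc, single_mul_star_of_mem_offColumn hV₁,
        mul_assoc, hW.2]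
    have hmem : W - V₁ * T ∈ W₂ := by
      refine ⟨(show W - V₁ * T ∈ offColumn k j from
        Submodule.sub_mem (offColumn k j : Submodule ℝ (Mat n 𝔽)) hW
          (mul_single_mem_offColumn hV₁.1 i j _)), ?_⟩
      change star V₁ * (W - V₁ * T) = 0
      rw [mul_sub, ← mul_assoc, hnorm, hT, Matrix.single_mul_single_same, ← Algebra.smul_def,
        smul_smul, mul_inv_cancel₀ hr0, one_smul, ← hV₁W, sub_self]
    have h1 := hc₂ _ hmem
    have h2 : skewForm q V₂ (V₁ * T) = 0 := by
      have hstar : star T = Matrix.single j i (star (r⁻¹ • (star V₁ * W) i j)) := star_single _ _ _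
      have hm : V₂ * star T ∈ offColumn k i := by
        rw [hstar]; exact mul_single_mem_offColumn hV₂.1 j i _
      have hT1 : D * T = T := lowProj_mul_single hi _
      have hT2 : T * D = T := single_mul_lowProj hj _
      rw [skewForm_apply, hq.symm _ (hsk j hj _ hV₂) _ (hK.skewPart_mem (hoff₁.mul hT2)),
        hq.off_adjoint hK hbl hoff₁ hoff₂ hT1 hT2, ← skewForm_apply, hc₁ _ hm, traceForm_apply,
        ← mul_assoc, horth, zero_mul, map_zero, mul_zero]
    have h3 : traceForm V₂ (V₁ * T) = 0 := by
      rw [traceForm_apply, ← mul_assoc, horth', zero_mul, map_zero]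
    rwa [map_sub, map_sub, h2, h3, sub_zero, sub_zero] at h1
  have he₁ := fun Z hZ => hq.eigenvector hK hHK hbl hi hV₁ hc₁ (Z := Z) hZ
  have he₂ := fun Z hZ => hq.eigenvector hK hHK hbl hj hV₂ hc₂' (Z := Z) hZ
  have h12 : V₁ * star V₂ = 0 := by
    rw [← hV₁.2, ← single_mul_star_of_mem_offColumn hV₂, mul_assoc, ← mul_assoc (Matrix.single i i 1),
      Matrix.single_mul_single_of_ne _ _ _ _ hij, zero_mul, mul_zero]
  have h21 : V₂ * star V₁ = 0 := by rw [← star_star (V₂ * star V₁)]; simp [h12]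
  have hX : skewPart V₁ * skewPart V₂ = 0 := by
    simp only [skewPart, sub_mul, mul_sub, hoff₁.mul_off hoff₂, h12, horth,
      hoff₁.star_mul_star hoff₂, sub_self]
  have hY : skewPart V₂ * skewPart V₁ = 0 := by
    simp only [skewPart, sub_mul, mul_sub, hoff₂.mul_off hoff₁, h21, horth',
      hoff₂.star_mul_star hoff₁, sub_self]
  have heig : ∀ P ∈ ({skewPart V₁, skewPart V₂} : Set (Mat n 𝔽)), P ∈ lieAlg K ∧
      ∃ c : ℝ, ∀ Z ∈ lieAlg K, q P Z = c * reTr (P * Z) := by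
    rintro P (rfl | rfl)
    · exact ⟨hsk i hi _ hV₁, _, he₁⟩
    · exact ⟨hsk j hj _ hV₂, _, he₂⟩
  have hcomm : ∀ P ∈ ({skewPart V₁, skewPart V₂} : Set (Mat n 𝔽)),
      ∀ Q ∈ ({skewPart V₁, skewPart V₂} : Set (Mat n 𝔽)), P * Q = Q * P := by
    rintro P (rfl | rfl) Q (rfl | rfl)
    · rfl
    · rw [hX, hY]
    · rw [hX, hY]
    · rfl
  obtain ⟨s, t, hst, hne⟩ := hq.no_flat _ (hsk i hi _ hV₁) _ (hsk j hj _ hV₂) (by rw [hX, hY]) (by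
    have hzero : ∀ P ∈ ({skewPart V₁, skewPart V₂} : Set (Mat n 𝔽)),
        ∀ Q ∈ ({skewPart V₁, skewPart V₂} : Set (Mat n 𝔽)), ∀ W ∈ lieAlg K,
        q P (Q * W - W * Q) = 0 := by
      intro P hP Q hQ W hW
      obtain ⟨hPk, c, hc⟩ := heig P hP
      rw [hc _ (lieAlg_bracket hK.isClosed (heig Q hQ).1 hW), mul_sub, map_sub, ← mul_assoc,
        reTr_mul_comm P (W * Q), mul_assoc W, reTr_mul_comm W, hcomm P hP Q hQ, sub_self, mul_zero]
    intro W hW P hP Q hQ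
    rw [hq.symm _ (lieAlg_bracket hK.isClosed (heig P hP).1 hW) _ (heig Q hQ).1,
      hzero Q hQ P hP W hW, hzero P hP Q hQ W hW, add_zero])
  have h0 := hdiag _ hst
  rw [← skewPart_smul, ← skewPart_smul, ← skewPart_add, off_skewPart
    ⟨by rw [mul_add, mul_smul_comm, mul_smul_comm, hoff₁.1, hoff₂.1, smul_zero, smul_zero, add_zero],
      by rw [add_mul, smul_mul_assoc, smul_mul_assoc, hoff₁.2, hoff₂.2]⟩] at h0
  have hV₁j : V₁ * Matrix.single j j 1 = 0 := by
    rw [← hV₁.2, mul_assoc, Matrix.single_mul_single_of_ne _ _ _ _ hij, mul_zero]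
  have hV₂i : V₂ * Matrix.single i i 1 = 0 := by
    rw [← hV₂.2, mul_assoc, Matrix.single_mul_single_of_ne _ _ _ _ hij.symm, mul_zero]
  apply hne
  constructor
  · have := congrArg (fun A => A * Matrix.single i i (1 : 𝔽)) h0
    simp only [add_mul, smul_mul_assoc, hV₁.2, hV₂i, smul_zero, add_zero, zero_mul] at this
    exact (smul_eq_zero.1 this).resolve_right hne₁
  · have := congrArg (fun A => A * Matrix.single j j (1 : 𝔽)) h0
    simp only [add_mul, smul_mul_assoc, hV₂.2, hV₁j, smul_zero, zero_add, zero_mul] at this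
    exact (smul_eq_zero.1 this).resolve_right hne₂

end Flat

/-! ### Rotations and the enlargement of the block -/

section Enlarge

variable {n : ℕ} {𝔽 : Type} [NormedDivisionRing 𝔽] [NormedAlgebra ℝ 𝔽] [StarRing 𝔽]
  [FiniteDimensional ℝ 𝔽] [ContinuousStar 𝔽] [HasRealPart 𝔽] {k : ℕ}

theorem mulVec_exp_rotation {G : Mat n 𝔽} {a b : Fin n → 𝔽} (ha : G *ᵥ a = -b) (hb : G *ᵥ b = a)
    (t : ℝ) : exp (t • G) *ᵥ (Real.cos t • a + Real.sin t • b) = a := by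
  rcases isEmpty_or_nonempty (Fin n) with h | ⟨⟨p⟩⟩
  · exact Subsingleton.elim _ _
  have h := mat_exp_smul_mul_rotation (G := G) (A := vecMulVec a (Pi.single p 1))
    (B := vecMulVec b (Pi.single p 1))
    (by rw [mul_vecMulVec, ha, neg_vecMulVec]) (by rw [mul_vecMulVec, hb]) t
  rw [← smul_vecMulVec, ← smul_vecMulVec, ← add_vecMulVec, mul_vecMulVec] at h
  funext c
  have := congrFun (congrFun h c) p
  simpa [vecMulVec_apply] using this

theorem star_mul_self_of_norm_eq_one {z : 𝔽} (hz : ‖z‖ = 1) : star z * z = 1 := by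
  rw [star_mul_self, hz]; simp

theorem mul_star_self_of_norm_eq_one {z : 𝔽} (hz : ‖z‖ = 1) : z * star z = 1 := by
  have hz0 : z ≠ 0 := by rintro rfl; simp at hz
  rw [eq_inv_of_mul_eq_one_left (star_mul_self_of_norm_eq_one hz), mul_inv_cancel₀ hz0]

/-- The infinitesimal rotation `e_p y* - y e_p*` in the plane of `e_p` and `y`. -/
def turn (p : Fin n) (y : Fin n → 𝔽) : Mat n 𝔽 :=
  skewPart (vecMulVec (Pi.single p 1) (star y))

theorem turn_apply (p : Fin n) (y : Fin n → 𝔽) (i j : Fin n) :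
    turn p y i j = (if i = p then star (y j) else 0) - (if j = p then y i else 0) := by
  simp [turn, skewPart, vecMulVec_apply, Matrix.star_apply, Pi.single_apply, apply_ite star]

theorem turn_mulVec {p : Fin n} {y : Fin n → 𝔽} (u : Fin n → 𝔽) :
    turn p y *ᵥ u = Pi.single p (∑ c, star (y c) * u c) - fun c => y c * u p := by
  funext i
  simp only [Matrix.mulVec, dotProduct, turn_apply, sub_mul, Finset.sum_sub_distrib, Pi.sub_apply,
    ite_mul, zero_mul, Finset.sum_ite_eq', Finset.mem_univ, if_true, Pi.single_apply]
  congr 1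
  split_ifs <;> simp

theorem turn_mem {K : Subgroup (UGroup n 𝔽)} (hK : IsBlockGroup K k) {p : Fin n} {y : Fin n → 𝔽}
    (hy : y p = 0) : turn p y ∈ lieAlg K := by
  refine hK.zero_diag _ (star_skewPart _) fun i => ?_
  rw [turn_apply]
  split_ifs with h
  · subst h; simp [hy]
  · simp

/-- A unit vector supported on `S` can be rotated into a multiple of `e_p`, in a plane spanned by `e_p` and a
vector supported on `S`. -/
theorem exists_turn {S : Set (Fin n)} {p : Fin n} {u : Fin n → 𝔽}
    (hu : ∑ c, ‖u c‖ ^ 2 = 1) (hS : ∀ c ∉ S, u c = 0) :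
    ∃ (y : Fin n → 𝔽) (t : ℝ) (z : 𝔽), y p = 0 ∧ (∀ c ∉ S, y c = 0) ∧ ‖z‖ = 1 ∧
      exp (t • turn p y) *ᵥ u = Pi.single p z := by
  classical
  set u' : Fin n → 𝔽 := fun c => if c = p then 0 else u c with hu'
  have hsum : ‖u p‖ ^ 2 + ∑ c, ‖u' c‖ ^ 2 = 1 := by
    rw [← hu, ← Finset.add_sum_erase _ _ (Finset.mem_univ p),
      ← Finset.add_sum_erase _ (fun c => ‖u c‖ ^ 2) (Finset.mem_univ p)]
    congr 1
    simp only [hu', if_true, norm_zero]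
    rw [zero_pow two_ne_zero, zero_add]
    refine Finset.sum_congr rfl fun c hc => ?_
    rw [if_neg (Finset.ne_of_mem_erase hc)]
  have huu : ∀ c, u c = (Pi.single p (u p) : Fin n → 𝔽) c + u' c := by
    intro c
    by_cases hc : c = p
    · subst hc; simp [hu']
    · simp [hu', hc]
  set s : ℝ := Real.sqrt (∑ c, ‖u' c‖ ^ 2) with hs
  have hs2 : s ^ 2 = ∑ c, ‖u' c‖ ^ 2 := Real.sq_sqrt (Finset.sum_nonneg fun _ _ => by positivity)
  by_cases hs0 : s = 0
  · refine ⟨0, 0, u p, rfl, fun _ _ => rfl, ?_, ?_⟩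
    · rw [← hs2, hs0] at hsum
      nlinarith [norm_nonneg (u p)]
    · rw [zero_smul, exp_zero, one_mulVec]
      funext c
      have h1 : ∑ c, ‖u' c‖ ^ 2 = 0 := by rw [← hs2, hs0]; simp
      have h2 := (Finset.sum_eq_zero_iff_of_nonneg fun _ _ => by positivity).1 h1 c
        (Finset.mem_univ c)
      have h3 : u' c = 0 := by simpa using h2
      rw [huu c, h3, add_zero]
  · -- the phase of the `p`-th coordinate
    obtain ⟨z, hz, hzu⟩ : ∃ z : 𝔽, ‖z‖ = 1 ∧ ‖u p‖ • z = u p := by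
      by_cases h0 : u p = 0
      · exact ⟨1, norm_one, by simp [h0]⟩
      · have hn : ‖u p‖ ≠ 0 := norm_ne_zero_iff.2 h0
        exact ⟨‖u p‖⁻¹ • u p, by simp [norm_smul, inv_mul_cancel₀ hn],
          by rw [smul_smul, mul_inv_cancel₀ hn, one_smul]⟩
    set b : Fin n → 𝔽 := s⁻¹ • u' with hb
    have hbp : b p = 0 := by simp [hb, hu']
    have hbb : ∑ c, star (b c) * b c = 1 := by
      simp only [hb, Pi.smul_apply, star_mul_self, norm_smul, mul_pow]
      rw [← map_sum, ← Finset.mul_sum, ← hs2, norm_inv, Real.norm_eq_abs, inv_pow, sq_abs,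
        inv_mul_cancel₀ (pow_ne_zero 2 hs0), map_one]
    refine ⟨fun c => b c * star z, Real.arccos ‖u p‖, z, by simp [hbp], fun c hc => ?_, hz, ?_⟩
    · have : u' c = 0 := by simp only [hu']; split_ifs <;> simp [hS c hc]
      simp [hb, this]
    · have h1 : ‖u p‖ ≤ 1 := by
        rw [← hs2] at hsum
        nlinarith [norm_nonneg (u p), sq_nonneg s]
      have hcos : Real.cos (Real.arccos ‖u p‖) = ‖u p‖ :=
        Real.cos_arccos (by linarith [norm_nonneg (u p)]) h1
      have hsin : Real.sin (Real.arccos ‖u p‖) = s := by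
        rw [Real.sin_arccos, hs]; congr 1; linarith
      have hrot := mulVec_exp_rotation (G := turn p fun c => b c * star z)
        (a := Pi.single p z) (b := b) (by
          rw [turn_mulVec]
          simp [Pi.single_apply, hbp, mul_assoc, star_mul_self_of_norm_eq_one hz]) (by
          rw [turn_mulVec]
          simp only [hbp, mul_zero, star_mul, star_star, mul_assoc, ← Finset.mul_sum, hbb, mul_one]
          funext c; simp) (Real.arccos ‖u p‖)
      rw [hcos, hsin] at hrot
      convert hrot using 2
      funext c
      rw [huu c, Pi.add_apply, hb, smul_smul, mul_inv_cancel₀ hs0, one_smul]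
      congr 1
      by_cases hc : c = p
      · subst hc; simp [hzu]
      · simp [hc]

/-- A quarter turn. -/
theorem exp_turn_mulVec {p : Fin n} {y : Fin n → 𝔽} (hyp : y p = 0)
    (hy : ∑ c, star (y c) * y c = 1) (z : 𝔽) :
    exp ((Real.pi / 2) • turn p y) *ᵥ (fun c => y c * z) = Pi.single p z := by
  have h := mulVec_exp_rotation (G := turn p y) (a := Pi.single p z) (b := fun c => y c * z) (by
      rw [turn_mulVec]
      simp [Pi.single_apply, hyp]) (by
      rw [turn_mulVec]
      simp only [hyp, zero_mul, mul_zero, ← mul_assoc, ← Finset.sum_mul, hy, one_mul]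
      funext c; simp) (Real.pi / 2)
  simpa using h

theorem turn_mem_blockAlg {K : Subgroup (UGroup n 𝔽)} (hK : IsBlockGroup K k) {m : ℕ} {p : Fin n}
    {y : Fin n → 𝔽} (hy : y p = 0) (hp : n ≤ p.val + m) (hm : ∀ c : Fin n, c.val + m < n → y c = 0) :
    turn p y ∈ blockAlg K m := by
  refine ⟨turn_mem hK hy, ?_, ?_⟩
  · ext i j
    rw [lowProj_mul_apply, turn_apply]
    split_ifs with h1 h2 h3 h3
    · subst h2; omega
    · subst h2; omega
    · simp [hm i h1]
    · simp
    all_goals rfl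
  · ext i j
    rw [mul_lowProj_apply, turn_apply]
    split_ifs with h1 h2 h3 h3
    · subst h3; omega
    · simp [hm j h1]
    · subst h3; omega
    · simp
    all_goals rfl

/-- A closed subgroup containing the lower `k × k` block and the rotations in the planes of `e_p` and
the last `k` coordinate vectors, where `p` is the preceding index, contains the lower
`(k + 1) × (k + 1)` block: an element of that block is moved by such rotations to one fixing `e_p`. -/
theorem block_succ_le {K H : Subgroup (UGroup n 𝔽)} (hK : IsBlockGroup K k)
    (hbl : block K k ≤ H) {p : Fin n} (hp : p.val + k + 1 = n)
    (hturn : ∀ y : Fin n → 𝔽, (∀ c : Fin n, c.val + k < n → y c = 0) → turn p y ∈ lieAlg H) :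
    block K (k + 1) ≤ H := by
  have hk2 := hK.two_le
  intro A hA
  have hrot : ∀ (y : Fin n → 𝔽) (t : ℝ), (∀ c : Fin n, c.val + k < n → y c = 0) →
      ∃ h ∈ H ⊓ block K (k + 1), (h : Mat n 𝔽) = exp (t • turn p y) := by
    intro y t hy
    obtain ⟨h, hh, hh'⟩ := hturn y hy t
    have hyp : y p = 0 := hy p (by omega)
    obtain ⟨h2, hh2, hh2'⟩ := blockAlg_subset (turn_mem_blockAlg hK (m := k + 1) hyp (by omega)
      fun c hc => hy c (by omega)) t
    have : h = h2 := Subtype.ext (hh'.trans hh2'.symm)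
    exact ⟨h, ⟨hh, this ▸ hh2⟩, hh'⟩
  set u : Fin n → 𝔽 := fun c => (A : Mat n 𝔽) c p with hu
  have hAu : (A : Mat n 𝔽) *ᵥ Pi.single p 1 = u := by
    funext c; simp [hu]
  have hunit : ∑ c, ‖u c‖ ^ 2 = 1 := by
    have h1 : (star (A : Mat n 𝔽) * A) p p = 1 := by
      rw [Unitary.star_mul_self_of_mem A.2, Matrix.one_apply_eq]
    rw [star_mul_self_apply] at h1
    have h2 := congrArg re h1
    rwa [re_algebraMap, ← map_one (algebraMap ℝ 𝔽), re_algebraMap] at h2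
  have hsupp : ∀ c ∉ {c : Fin n | n ≤ c.val + (k + 1)}, u c = 0 := by
    intro c hc
    have hc' : c.val + (k + 1) < n := not_le.1 hc
    have hcp : c ≠ p := by rintro rfl; omega
    rw [hu]
    simp only
    rw [hA.2 c p (Or.inl hc'), Matrix.one_apply_ne hcp]
  obtain ⟨y, t, z, hyp, hy, hz, hyt⟩ := exists_turn (p := p) hunit hsupp
  have hylow : ∀ c : Fin n, c.val + k < n → y c = 0 := by
    intro c hc
    by_cases hcp : c = p
    · rw [hcp, hyp]
    · refine hy c ?_
      have : c.val ≠ p.val := fun h => hcp (Fin.ext h)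
      change ¬ (n ≤ c.val + (k + 1))
      omega
  obtain ⟨h₁, hh₁, he₁⟩ := hrot y t hylow
  obtain ⟨i, hi⟩ : ∃ i : Fin n, n ≤ i.val + k := ⟨⟨n - 1, by omega⟩, by simp only; omega⟩
  have hip : i ≠ p := by rintro rfl; omega
  have hylow₀ : ∀ c : Fin n, c.val + k < n → (Pi.single i 1 : Fin n → 𝔽) c = 0 := by
    intro c hc
    have : c ≠ i := by rintro rfl; omega
    simp [this]
  have hylow₁ : ∀ c : Fin n, c.val + k < n → (Pi.single i z : Fin n → 𝔽) c = 0 := by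
    intro c hc
    have : c ≠ i := by rintro rfl; omega
    simp [this]
  obtain ⟨h₂, hh₂, he₂⟩ := hrot (Pi.single i 1) (Real.pi / 2) hylow₀
  obtain ⟨h₃, hh₃, he₃⟩ := hrot (Pi.single i z) (Real.pi / 2) hylow₁
  have hsingle : ∀ z : 𝔽, ‖z‖ = 1 →
      ∑ c, star ((Pi.single i z : Fin n → 𝔽) c) * (Pi.single i z : Fin n → 𝔽) c = 1 := by
    intro z hz
    rw [Finset.sum_eq_single i]
    · simp [star_mul_self_of_norm_eq_one hz]
    · intro c _ hc; simp [hc]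
    · simp
  have hm₂ : (h₂ : Mat n 𝔽) *ᵥ Pi.single i z = Pi.single p z := by
    have := exp_turn_mulVec (p := p) (y := Pi.single i 1) (by simp [hip.symm])
      (hsingle 1 norm_one) z
    rw [← he₂] at this
    rw [← this]
    congr 1
    funext c
    by_cases hc : c = i
    · subst hc; simp
    · simp [hc]
  have hm₃ : (h₃ : Mat n 𝔽) *ᵥ Pi.single i z = Pi.single p 1 := by
    have := exp_turn_mulVec (p := p) (y := Pi.single i z) (by simp [hip.symm])
      (hsingle z hz) 1
    rw [← he₃] at this
    rw [← this]
    simp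
  set h := h₃ * h₂⁻¹ * h₁ with hdef
  have hh : h ∈ H ⊓ block K (k + 1) := mul_mem (mul_mem hh₃ (inv_mem hh₂)) hh₁
  have hm₂' : ((h₂⁻¹ : UGroup n 𝔽) : Mat n 𝔽) *ᵥ Pi.single p z = Pi.single i z := by
    rw [← hm₂, mulVec_mulVec, coe_inv_mul, one_mulVec]
  have hfix : ((h * A : UGroup n 𝔽) : Mat n 𝔽) *ᵥ Pi.single p 1 = Pi.single p 1 := by
    rw [hdef]
    simp only [coe_mul, ← mulVec_mulVec]
    rw [hAu, he₁, hyt, hm₂', hm₃]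
  have hfix' : (((h * A)⁻¹ : UGroup n 𝔽) : Mat n 𝔽) *ᵥ Pi.single p 1 = Pi.single p 1 := by
    conv_lhs => rw [← hfix]
    rw [mulVec_mulVec, coe_inv_mul, one_mulVec]
  have hmem : h * A ∈ block K k := by
    have hmem' := mul_mem hh.2 hA
    refine ⟨hmem'.1, fun i j hij => ?_⟩
    by_cases hjp : j = p
    · subst hjp
      have := congrFun hfix i
      simp only [mulVec_single_one, Matrix.col_apply] at this
      rw [this, Matrix.one_apply, Pi.single_apply]
    · by_cases hip : i = p
      · subst hip
        have := congrFun hfix' j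
        simp only [mulVec_single_one, Matrix.col_apply, coe_inv_apply] at this
        rw [← star_star (((h * A : UGroup n 𝔽) : Mat n 𝔽) i j), this, Matrix.one_apply,
          Pi.single_apply]
        simp only [eq_comm (a := i)]
        split_ifs; simp
      · have h1 : i.val ≠ p.val := fun h => hip (Fin.ext h)
        have h2 : j.val ≠ p.val := fun h => hjp (Fin.ext h)
        exact hmem'.2 i j (by omega)
  have := H.mul_mem (H.inv_mem hh.1) (hbl hmem)
  simpa using this

theorem turn_mul_lowProj {p : Fin n} {y : Fin n → 𝔽} (hp : p.val + k < n)
    (hy : ∀ c : Fin n, n ≤ c.val + k → y c = 0) : turn p y * lowProj n 𝔽 k = 0 := by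
  ext a b
  rw [mul_lowProj_apply, turn_apply, Matrix.zero_apply]
  split_ifs with h1 h2 h3 h3
  · rfl
  · subst h3; omega
  · rw [hy b (by omega), star_zero, sub_zero]
  · subst h3; omega
  · simp

theorem lowProj_mul_turn {p : Fin n} {y : Fin n → 𝔽} (hp : p.val + k < n)
    (hy : ∀ c : Fin n, n ≤ c.val + k → y c = 0) : lowProj n 𝔽 k * turn p y = 0 := by
  ext a b
  rw [lowProj_mul_apply, turn_apply, Matrix.zero_apply]
  split_ifs with h1 h2 h3 h3
  · rfl
  · subst h2; omega
  · subst h2; omega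
  · rw [hy a (by omega), sub_zero]
  · simp

theorem adjointMap_skewPart (g : UGroup n 𝔽) (V : Mat n 𝔽) :
    adjointMap g (skewPart V) = skewPart (adjointMap g V) := by
  have h : ((g⁻¹ : UGroup n 𝔽) : Mat n 𝔽) = star (g : Mat n 𝔽) := rfl
  simp only [adjointMap_apply, skewPart, h, star_mul, star_star, mul_sub, sub_mul, mul_assoc]

theorem commute_of_mem_block {K : Subgroup (UGroup n 𝔽)} {A : UGroup n 𝔽} (hA : A ∈ block K k)
    {g : Mat n 𝔽} (h1 : g * lowProj n 𝔽 k = lowProj n 𝔽 k)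
    (h2 : lowProj n 𝔽 k * g = lowProj n 𝔽 k) : g * A = A * g := by
  obtain ⟨-, hA1, hA2⟩ := mem_block_iff.1 hA
  have h3 : g * (A : Mat n 𝔽) = g + A - 1 := by
    have h : (A : Mat n 𝔽) = (1 - lowProj n 𝔽 k) + lowProj n 𝔽 k * A := by
      conv_rhs => rw [← hA1]
      rw [← add_mul, sub_add_cancel, one_mul]
    have h' : lowProj n 𝔽 k * (A : Mat n 𝔽) = A - (1 - lowProj n 𝔽 k) := by
      rw [← hA1, sub_mul, one_mul, sub_sub_cancel]
    conv_lhs => rw [h]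
    rw [mul_add, ← mul_assoc, h1, h', mul_sub, mul_one, h1]; abel
  have h4 : (A : Mat n 𝔽) * g = g + A - 1 := by
    have h : (A : Mat n 𝔽) = (1 - lowProj n 𝔽 k) + A * lowProj n 𝔽 k := by
      conv_rhs => rw [← hA2]
      rw [← mul_add, sub_add_cancel, mul_one]
    have h' : (A : Mat n 𝔽) * lowProj n 𝔽 k = A - (1 - lowProj n 𝔽 k) := by
      rw [← hA2, mul_sub, mul_one, sub_sub_cancel]
    conv_lhs => rw [h]
    rw [add_mul, mul_assoc, h2, h', sub_mul, one_mul, h2]; abel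
  rw [h3, h4]

/-- A nonzero off-diagonal part of the Lie algebra of `H` enlarges the block contained in `H`. -/
theorem IsBlockGroup.exists_conjugate_block_succ {K H : Subgroup (UGroup n 𝔽)}
    (hK : IsBlockGroup K k) (hH : IsClosed (H : Set (UGroup n 𝔽))) (hHK : H ≤ K)
    (hbl : block K k ≤ H) (hk : k + 1 ≤ n) {Z : Mat n 𝔽} (hZ : Z ∈ lieAlg H)
    (hne : (1 - lowProj n 𝔽 k) * Z * lowProj n 𝔽 k ≠ 0) :
    ∃ g ∈ K, conjugate g (block K (k + 1)) ≤ H := by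
  set V := (1 - lowProj n 𝔽 k) * Z * lowProj n 𝔽 k with hV
  have hoff : IsOff k V := isOff_off Z
  obtain ⟨c₀, i, hci⟩ : ∃ c i, V c i ≠ 0 := by
    by_contra hcon
    push Not at hcon
    exact hne (Matrix.ext hcon)
  have hi : n ≤ i.val + k := by
    by_contra hlt
    apply hci
    rw [← hoff.2, mul_lowProj_apply, if_pos (by omega)]
  have hup : ∀ c : Fin n, n ≤ c.val + k → V c i = 0 := by
    intro c hc
    have := congrFun (congrFun hoff.1 c) i
    rwa [lowProj_mul_apply, if_neg (by omega)] at this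
  set r : ℝ := Real.sqrt (∑ c, ‖V c i‖ ^ 2) with hr
  have hr2 : r ^ 2 = ∑ c, ‖V c i‖ ^ 2 := Real.sq_sqrt (Finset.sum_nonneg fun _ _ => by positivity)
  have hr0 : r ≠ 0 := by
    intro h0
    rw [h0, zero_pow two_ne_zero] at hr2
    have h := (Finset.sum_eq_zero_iff_of_nonneg fun _ _ => by positivity).1 hr2.symm c₀
      (Finset.mem_univ _)
    exact hci (by simpa using h)
  set u : Fin n → 𝔽 := fun c => r⁻¹ • V c i with hu
  have hunit : ∑ c, ‖u c‖ ^ 2 = 1 := by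
    simp only [hu, norm_smul, mul_pow]
    rw [← Finset.mul_sum, ← hr2, norm_inv, Real.norm_eq_abs, inv_pow, sq_abs,
      inv_mul_cancel₀ (pow_ne_zero 2 hr0)]
  -- all the vectors `u y* - y u*` with lower `y` lie in the Lie algebra of `H`
  have hmem : ∀ y : Fin n → 𝔽, (∀ c : Fin n, c.val + k < n → y c = 0) →
      skewPart (vecMulVec u (star y)) ∈ lieAlg H := by
    intro y hy
    have h := hK.off_mul_mem hH hHK hbl hZ
      (T := vecMulVec (r⁻¹ • (Pi.single i 1 : Fin n → 𝔽)) (star y)) (by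
        ext a b
        rw [lowProj_mul_apply]
        split_ifs with ha
        · have : a ≠ i := by rintro rfl; omega
          simp [vecMulVec_apply, this]
        · rfl) (by
        ext a b
        rw [mul_lowProj_apply]
        split_ifs with hb
        · simp [vecMulVec_apply, hy b hb]
        · rfl)
    rw [← hV, mul_vecMulVec] at h
    convert h using 3
    funext c
    simp [hu, mulVec_smul]
  obtain ⟨p, hp⟩ : ∃ p : Fin n, p.val + k + 1 = n := ⟨⟨n - k - 1, by omega⟩, by simp only; omega⟩
  obtain ⟨y₀, t, z, hy₀p, hy₀, hz, hyt⟩ := exists_turn (S := {c : Fin n | c.val + k < n}) (p := p)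
    hunit (fun c hc => by
      have hc' : n ≤ c.val + k := not_lt.1 hc
      simp [hu, hup c hc'])
  obtain ⟨g, hg, hgt⟩ := turn_mem hK hy₀p t
  have hgD : (g : Mat n 𝔽) * lowProj n 𝔽 k = lowProj n 𝔽 k := by
    rw [hgt]
    refine mat_exp_mul_of_mul_eq_zero ?_
    rw [smul_mul_assoc]
    rw [turn_mul_lowProj (by omega) fun c hc => hy₀ c (not_lt.2 hc), smul_zero]
  have hDg : lowProj n 𝔽 k * (g : Mat n 𝔽) = lowProj n 𝔽 k := by
    rw [hgt]
    refine mat_mul_exp_of_mul_eq_zero ?_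
    rw [mul_smul_comm]
    rw [lowProj_mul_turn (by omega) fun c hc => hy₀ c (not_lt.2 hc), smul_zero]
  have hDg' : lowProj n 𝔽 k * ((g⁻¹ : UGroup n 𝔽) : Mat n 𝔽) = lowProj n 𝔽 k := by
    conv_lhs => rw [← hDg, mul_assoc, mul_coe_inv, mul_one]
  have hle : block K (k + 1) ≤ conjugate g H := by
    refine block_succ_le hK ?_ hp ?_
    · intro A hA
      rw [mem_conjugate]
      have hcomm : g * A = A * g := Subtype.ext (commute_of_mem_block hA hgD hDg)
      rw [mul_assoc, ← hcomm, ← mul_assoc, inv_mul_cancel, one_mul]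
      exact hbl hA
    · intro y hy
      have h1 := hmem (fun c => y c * z) fun c hc => by rw [hy c hc, zero_mul]
      have h2 : adjointMap g (skewPart (vecMulVec u (star fun c => y c * z))) = turn p y := by
        rw [adjointMap_skewPart, turn, adjointMap_apply, mul_vecMulVec, hgt, hyt]
        congr 1
        have h3 : vecMulVec (Pi.single p z) (star fun c => y c * z)
            = vecMulVec (Pi.single p 1) (star y) := by
          ext a b
          by_cases ha : a = p
          · subst ha
            simp [vecMulVec_apply, ← mul_assoc, mul_star_self_of_norm_eq_one hz]
          · simp [vecMulVec_apply, ha]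
        have h4 : vecMulVec (Pi.single p 1) (star y) * lowProj n 𝔽 k
            = vecMulVec (Pi.single p 1) (star y) := by
          ext a b
          rw [mul_lowProj_apply]
          split_ifs with hb
          · simp [vecMulVec_apply, hy b hb]
          · rfl
        rw [h3, ← h4, mul_assoc, hDg']
      rw [mem_lieAlg_conjugate, ← h2, adjointMap_apply]
      simp only [← mul_assoc, coe_inv_mul, one_mul]
      rwa [mul_assoc, coe_inv_mul, mul_one]
  refine ⟨g⁻¹, K.inv_mem hg, fun A hA => ?_⟩
  rw [mem_conjugate, inv_inv] at hA
  have := hle hA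
  rw [mem_conjugate] at this
  convert this using 1
  group

end Enlarge

/-! ### Enlarging the block up to codimension one -/

section Induction

variable {n : ℕ} {𝔽 : Type} [NormedDivisionRing 𝔽] [NormedAlgebra ℝ 𝔽] [StarRing 𝔽]
  [FiniteDimensional ℝ 𝔽] [ContinuousStar 𝔽] [HasRealPart 𝔽] {K H L : Subgroup (UGroup n 𝔽)}

theorem conjugate_conjugate (a b : UGroup n 𝔽) (L : Subgroup (UGroup n 𝔽)) :
    conjugate a (conjugate b L) = conjugate (a * b) L := by
  ext A
  simp only [mem_conjugate, _root_.mul_inv_rev, mul_assoc]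

theorem conjugate_one (L : Subgroup (UGroup n 𝔽)) : conjugate 1 L = L := by
  ext A; simp [mem_conjugate]

theorem conjugate_mono (g : UGroup n 𝔽) (h : H ≤ L) : conjugate g H ≤ conjugate g L :=
  Subgroup.map_mono h

theorem conjugate_le_iff {g : UGroup n 𝔽} : conjugate g L ≤ H ↔ L ≤ conjugate g⁻¹ H := by
  constructor
  · intro h
    have := conjugate_mono g⁻¹ h
    rwa [conjugate_conjugate, inv_mul_cancel, conjugate_one] at this
  · intro h
    have := conjugate_mono g h
    rwa [conjugate_conjugate, mul_inv_cancel, conjugate_one] at this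

theorem conjugate_eq_self {g : UGroup n 𝔽} (hg : g ∈ K) : conjugate g K = K := by
  ext A
  rw [mem_conjugate]
  constructor
  · intro h
    have := K.mul_mem (K.mul_mem hg h) (K.inv_mem hg)
    convert this using 1
    group
  · exact fun h => K.mul_mem (K.mul_mem (K.inv_mem hg) h) hg

theorem conjugate_le (hHK : H ≤ K) {g : UGroup n 𝔽} (hg : g ∈ K) : conjugate g H ≤ K :=
  (conjugate_mono g hHK).trans (conjugate_eq_self hg).le

theorem isClosed_conjugate (hH : IsClosed (H : Set (UGroup n 𝔽))) (g : UGroup n 𝔽) :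
    IsClosed (conjugate g H : Set (UGroup n 𝔽)) := by
  have : (conjugate g H : Set (UGroup n 𝔽)) = (fun A => g⁻¹ * A * g) ⁻¹' H := by
    ext A; exact mem_conjugate
  rw [this]
  exact hH.preimage (by fun_prop)

theorem isConnected_conjugate (hH : IsConnected (H : Set (UGroup n 𝔽))) (g : UGroup n 𝔽) :
    IsConnected (conjugate g H : Set (UGroup n 𝔽)) := by
  have : (conjugate g H : Set (UGroup n 𝔽)) = (fun A => g * A * g⁻¹) '' H := by
    rw [conjugate, Subgroup.coe_map]
    rfl
  rw [this]
  exact hH.image _ (by fun_prop)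

theorem block_self (K : Subgroup (UGroup n 𝔽)) : block K n = K := by
  ext A
  constructor
  · exact fun h => h.1
  · exact fun h => ⟨h, fun i j hij => by omega⟩

/-- If `K/H` has positive curvature, then after conjugation `H` contains the block of codimension one:
as long as two more rows are missing, a Lie algebra without off-diagonal part is excluded by a flat
surface, and a nonzero off-diagonal part enlarges the block. In codimension one the off-diagonal part
vanishes, since otherwise `H` would be all of `K`. -/
theorem exists_conjugate_block_pred {k : ℕ} (hK : ∀ m, k ≤ m → m ≤ n → IsBlockGroup K m)
    (hH : IsClosed (H : Set (UGroup n 𝔽))) (hlt : H < K) (hkn : k ≤ n) (hbl : block K k ≤ H)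
    (hpos : AdmitsPositiveCurvature K H) :
    ∃ g ∈ K, block K (n - 1) ≤ conjugate g⁻¹ H ∧ ∀ Z ∈ lieAlg (conjugate g⁻¹ H),
      (1 - lowProj n 𝔽 (n - 1)) * Z * lowProj n 𝔽 (n - 1) = 0 := by
  have hne : ∀ g ∈ K, ¬ conjugate g (block K n) ≤ H := by
    intro g hg h
    rw [block_self, conjugate_eq_self hg] at h
    exact hlt.not_ge h
  have hKc := (hK k le_rfl hkn).isClosed
  have hk2 := (hK k le_rfl hkn).two_le
  obtain ⟨q, hq⟩ := exists_isotropyForm hKc hH hlt.le hpos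
  have hlt' : k < n := lt_of_le_of_ne hkn fun h =>
    hne 1 K.one_mem (by rw [conjugate_one]; exact h ▸ hbl)
  have hsucc : ∀ m, k ≤ m → m + 1 ≤ n → ∀ g ∈ K, block K m ≤ conjugate g⁻¹ H →
      (∃ Z ∈ lieAlg (conjugate g⁻¹ H), (1 - lowProj n 𝔽 m) * Z * lowProj n 𝔽 m ≠ 0) →
      ∃ g ∈ K, conjugate g (block K (m + 1)) ≤ H := by
    rintro m hkm hmn g hg hb ⟨Z, hZ, hZ0⟩
    obtain ⟨g', hg', hle⟩ := (hK m hkm (by omega)).exists_conjugate_block_succ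
      (isClosed_conjugate hH _) (conjugate_le hlt.le (K.inv_mem hg)) hb hmn hZ hZ0
    refine ⟨g * g', K.mul_mem hg hg', ?_⟩
    rwa [← conjugate_conjugate, conjugate_le_iff]
  have hind : ∀ m, k ≤ m → m + 1 ≤ n → ∃ g ∈ K, conjugate g (block K m) ≤ H := by
    intro m hkm
    induction m, hkm using Nat.le_induction with
    | base => exact fun _ => ⟨1, K.one_mem, by rwa [conjugate_one]⟩
    | succ m hkm ih =>
      intro hm
      obtain ⟨g, hg, hb⟩ := ih (by omega)
      rw [conjugate_le_iff] at hb
      refine hsucc m hkm (by omega) g hg hb ?_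
      by_contra hcon
      push Not at hcon
      exact (hq.conjugate hg).false_of_blockDiag (hK m hkm (by omega))
        (conjugate_le hlt.le (K.inv_mem hg)) hb (by omega) hcon
  obtain ⟨g, hg, hb⟩ := hind (n - 1) (by omega) (by omega)
  rw [conjugate_le_iff] at hb
  refine ⟨g, hg, hb, ?_⟩
  by_contra hcon
  push Not at hcon
  obtain ⟨g', hg', h⟩ := hsucc (n - 1) (by omega) (by omega) g hg hb hcon
  rw [Nat.sub_add_cancel (by omega)] at h
  exact hne g' hg' h

/-! ### Subgroups containing a block of codimension one -/

variable {e : Fin n}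

theorem val_add_lt_iff (he : e.val = 0) (i : Fin n) : i.val + (n - 1) < n ↔ i = e := by
  have := e.2
  rw [Fin.ext_iff, he]; omega

theorem mem_block_of_mem_splitBlock (he : e.val = 0) {A : UGroup n 𝔽} (hA : A ∈ splitBlock K)
    (h1 : (A : Mat n 𝔽) e e = 1) : A ∈ block K (n - 1) := by
  have hoff : ∀ i : Fin n, i ≠ e → (A : Mat n 𝔽) e i = 0 ∧ (A : Mat n 𝔽) i e = 0 :=
    fun i hi => hA.2 e i he fun h => hi (Fin.ext (h.trans he.symm))
  refine ⟨hA.1, fun i j hij => ?_⟩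
  rw [val_add_lt_iff he, val_add_lt_iff he] at hij
  by_cases hi : i = e
  · by_cases hj : j = e
    · rw [hi, hj, h1, Matrix.one_apply_eq]
    · rw [hi, (hoff j hj).1, Matrix.one_apply_ne (Ne.symm hj)]
  · have hj : j = e := hij.resolve_left hi
    rw [hj, (hoff i hi).2, Matrix.one_apply_ne hi]

theorem row_eq_zero (he : e.val = 0) {Z : Mat n 𝔽}
    (hZ : (1 - lowProj n 𝔽 (n - 1)) * Z * lowProj n 𝔽 (n - 1) = 0) (hs : star Z = -Z)
    {i : Fin n} (hi : i ≠ e) : Z e i = 0 ∧ Z i e = 0 := by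
  have h1 : Z e i = 0 := by
    have := congrFun (congrFun hZ e) i
    rw [mul_lowProj_apply, if_neg (by rwa [val_add_lt_iff he]), sub_mul, one_mul, Matrix.sub_apply,
      lowProj_mul_apply, if_pos ((val_add_lt_iff he e).2 rfl), sub_zero] at this
    exact this
  refine ⟨h1, ?_⟩
  have h2 := congrFun (congrFun hs i) e
  rw [Matrix.star_apply, h1, star_zero, Matrix.neg_apply] at h2
  exact neg_eq_zero.1 h2.symm

theorem mul_single_of_col_eq_zero {Z : Mat n 𝔽} (hcol : ∀ i ≠ e, Z i e = 0) :
    Z * Matrix.single e e 1 = Matrix.single e e (Z e e) := by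
  ext i j
  by_cases hj : j = e
  · subst hj
    by_cases hi : i = j
    · subst hi; simp
    · simp [hcol i hi, Ne.symm hi]
  · simp [hj, Ne.symm hj]

theorem exp_apply_of_col_eq_zero {Z : Mat n 𝔽} (hcol : ∀ i ≠ e, Z i e = 0) :
    (exp Z) e e = exp (Z e e) := by
  let _ : NormedAlgebra ℚ 𝔽 := NormedAlgebra.restrictScalars ℚ ℝ 𝔽
  have : CompleteSpace 𝔽 := FiniteDimensional.complete ℝ 𝔽
  have h := mat_exp_mul_eq_mul_exp (A := Z) (B := Matrix.diagonal fun _ => Z e e)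
    (X := Matrix.single e e (1 : 𝔽)) (by
      rw [mul_single_of_col_eq_zero hcol]
      ext i j
      by_cases hi : i = e
      · subst hi
        by_cases hj : j = i
        · subst hj; simp
        · simp [Ne.symm hj]
      · simp [Ne.symm hi])
  rw [Matrix.exp_diagonal] at h
  have h2 := congrFun (congrFun h e) e
  simpa [Pi.coe_exp] using h2

/-- A closed connected subgroup whose Lie algebra has no off-diagonal part commutes with the matrix unit
at the first index. -/
theorem le_splitBlock (he : e.val = 0) (hH : IsClosed (H : Set (UGroup n 𝔽)))
    (hc : IsConnected (H : Set (UGroup n 𝔽))) (hHK : H ≤ K)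
    (hdiag : ∀ Z ∈ lieAlg H, (1 - lowProj n 𝔽 (n - 1)) * Z * lowProj n 𝔽 (n - 1) = 0) :
    H ≤ splitBlock K := by
  refine le_of_exp_lieAlg hH hc fun Z hZ => ?_
  obtain ⟨A, hA, hAZ⟩ := exists_coe_eq_exp hZ
  refine mem_matSubmonoid.2 ⟨A, ⟨hHK hA, fun i j hi hj => ?_⟩, hAZ⟩
  have hie : i = e := Fin.ext (hi.trans he.symm)
  have hje : j ≠ e := fun h => hj (h ▸ he)
  subst hie
  have hrow := fun l hl => row_eq_zero (i := l) he (hdiag Z hZ) (star_eq_neg_of_mem_lieAlg hZ) hl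
  have h1 := mul_single_of_col_eq_zero (Z := Z) fun l hl => (hrow l hl).2
  have h2 : Matrix.single i i 1 * Z = Matrix.single i i (Z i i) := by
    ext a b
    by_cases ha : a = i
    · subst ha
      by_cases hb : b = a
      · subst hb; simp
      · simp [(hrow b hb).1, Ne.symm hb]
    · simp [ha, Ne.symm ha]
  have h3 := mat_exp_mul_eq_mul_exp (h1.trans h2.symm)
  rw [hAZ]
  constructor
  · have := congrFun (congrFun h3 i) j
    simpa [hje, hje.symm] using this.symm
  · have := congrFun (congrFun h3 j) i
    simpa [hje, hje.symm] using this

theorem eq_block_of_apply_eq_zero (he : e.val = 0) (hH : IsClosed (H : Set (UGroup n 𝔽)))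
    (hc : IsConnected (H : Set (UGroup n 𝔽))) (hHK : H ≤ K) (hbl : block K (n - 1) ≤ H)
    (hdiag : ∀ Z ∈ lieAlg H, (1 - lowProj n 𝔽 (n - 1)) * Z * lowProj n 𝔽 (n - 1) = 0)
    (h0 : ∀ Z ∈ lieAlg H, Z e e = 0) : H = block K (n - 1) := by
  refine le_antisymm (le_of_exp_lieAlg hH hc fun Z hZ => ?_) hbl
  obtain ⟨A, hA, hAZ⟩ := exists_coe_eq_exp hZ
  refine mem_matSubmonoid.2 ⟨A, mem_block_of_mem_splitBlock he
    (le_splitBlock he hH hc hHK hdiag hA) ?_, hAZ⟩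
  rw [hAZ, exp_apply_of_col_eq_zero fun i hi =>
    (row_eq_zero he (hdiag Z hZ) (star_eq_neg_of_mem_lieAlg hZ) hi).2, h0 Z hZ, exp_zero]

/-- An element of the split block lies in `H` as soon as its first diagonal entry is the exponential of
the first diagonal entry of an element of the Lie algebra of `H`. -/
theorem mem_of_exp_apply_eq (he : e.val = 0) (hHs : H ≤ splitBlock K) (hbl : block K (n - 1) ≤ H)
    (hdiag : ∀ Z ∈ lieAlg H, (1 - lowProj n 𝔽 (n - 1)) * Z * lowProj n 𝔽 (n - 1) = 0)
    {A : UGroup n 𝔽} (hA : A ∈ splitBlock K) {Z : Mat n 𝔽} (hZ : Z ∈ lieAlg H)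
    (hAZ : exp (Z e e) = (A : Mat n 𝔽) e e) : A ∈ H := by
  obtain ⟨C, hC, hCZ⟩ := exists_coe_eq_exp hZ
  have hCe : (C : Mat n 𝔽) e e = (A : Mat n 𝔽) e e := by
    rw [hCZ, exp_apply_of_col_eq_zero fun i hi =>
      (row_eq_zero he (hdiag Z hZ) (star_eq_neg_of_mem_lieAlg hZ) hi).2, hAZ]
  have hcol : ∀ B ∈ splitBlock K, ∀ i ≠ e, (B : Mat n 𝔽) i e = 0 := fun B hB i hi =>
    (hB.2 e i he fun h => hi (Fin.ext (h.trans he.symm))).2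
  have hmem : C⁻¹ * A ∈ block K (n - 1) := by
    refine mem_block_of_mem_splitBlock he ((splitBlock K).mul_mem ((splitBlock K).inv_mem (hHs hC)) hA)
      ?_
    have h1 := congrFun (congrFun (coe_inv_mul C) e) e
    rw [Matrix.mul_apply, Finset.sum_eq_single e] at h1
    · rw [coe_mul, Matrix.mul_apply, Finset.sum_eq_single e, ← hCe, h1, Matrix.one_apply_eq]
      · intro i _ hi; rw [hcol A hA i hi, mul_zero]
      · simp
    · intro i _ hi; rw [hcol C (hHs hC) i hi, mul_zero]
    · simp
  have := H.mul_mem hC (hbl hmem)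
  simpa using this

theorem norm_apply_of_mem_splitBlock (he : e.val = 0) {A : UGroup n 𝔽} (hA : A ∈ splitBlock K) :
    ‖(A : Mat n 𝔽) e e‖ = 1 := by
  have h0 : star (A : Mat n 𝔽) * (A : Mat n 𝔽) = 1 := Unitary.star_mul_self_of_mem A.2
  have h1 := congrFun (congrFun h0 e) e
  rw [star_mul_self_apply, Matrix.one_apply_eq, Finset.sum_eq_single e] at h1
  · have h2 := congrArg re h1
    rw [re_algebraMap, ← map_one (algebraMap ℝ 𝔽), re_algebraMap] at h2
    nlinarith [norm_nonneg ((A : Mat n 𝔽) e e)]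
  · intro i _ hi
    rw [(hA.2 e i he fun h => hi (Fin.ext (h.trans he.symm))).2]; simp
  · simp

/-- A conclusion about `g⁻¹ H g` yields one about `H`. -/
theorem isConjugateIn_of_conjugate {g : UGroup n 𝔽} (hg : g ∈ K)
    (h : IsConjugateIn K (conjugate g⁻¹ H) L) : IsConjugateIn K H L := by
  obtain ⟨g', hg', h⟩ := h
  refine ⟨g * g', K.mul_mem hg hg', ?_⟩
  rw [← conjugate_conjugate, ← h, conjugate_conjugate, mul_inv_cancel, conjugate_one]

theorem isConjugateIn_of_eq (h : H = L) : IsConjugateIn K H L :=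
  ⟨1, K.one_mem, by rw [conjugate_one, h]⟩

end Induction

/-! ### The real numbers, the complex numbers and the quaternions -/

noncomputable instance : HasRealPart ℝ where
  re := LinearMap.id
  re_mul_comm := mul_comm
  re_star := fun _ => rfl
  re_algebraMap := fun _ => rfl
  star_mul_self := fun a => by simp [sq]
  star_algebraMap := fun _ => rfl

noncomputable instance : HasRealPart ℂ where
  re := Complex.reLm
  re_mul_comm := fun a b => by rw [mul_comm]
  re_star := fun a => by simp
  re_algebraMap := fun r => by simp
  star_mul_self := fun a => by
    have := Complex.normSq_eq_conj_mul_self (z := a)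
    simpa [Complex.normSq_eq_norm_sq] using this.symm
  star_algebraMap := fun r => by simp

noncomputable instance : HasRealPart (Quaternion ℝ) where
  re :=
    { toFun := fun a => a.re
      map_add' := fun _ _ => rfl
      map_smul' := fun _ _ => rfl }
  re_mul_comm := fun a b => by
    change (a * b).re = (b * a).re
    rw [Quaternion.re_mul, Quaternion.re_mul]; ring
  re_star := fun a => Quaternion.re_star a
  re_algebraMap := fun r => rfl
  star_mul_self := fun a => by
    rw [Quaternion.star_mul_self, Quaternion.normSq_eq_norm_mul_self, sq]; rfl
  star_algebraMap := fun r => by simp [Quaternion.algebraMap_def]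

section Generate

variable {n : ℕ} {𝔽 : Type} [NormedDivisionRing 𝔽] [NormedAlgebra ℝ 𝔽] [StarRing 𝔽]
  [FiniteDimensional ℝ 𝔽] [ContinuousStar 𝔽] [HasRealPart 𝔽] {K : Subgroup (UGroup n 𝔽)} {k : ℕ}

/-- The skew-hermitian matrix with entries `z` at `(i, j)` and `-z*` at `(j, i)`. -/
def skewSingle (i j : Fin n) (z : 𝔽) : Mat n 𝔽 := Matrix.single i j z - Matrix.single j i (star z)

theorem skewSingle_mem_blockAlg
    (hz : ∀ X : Mat n 𝔽, star X = -X → (∀ i, X i i = 0) → X ∈ lieAlg K) {i j : Fin n}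
    (hij : i ≠ j) (hi : n ≤ i.val + k) (hj : n ≤ j.val + k) (z : 𝔽) :
    skewSingle i j z ∈ blockAlg K k := by
  refine ⟨hz _ ?_ ?_, ?_, ?_⟩
  · rw [skewSingle, star_sub, star_eq_conjTranspose, star_eq_conjTranspose,
      conjTranspose_single, conjTranspose_single, star_star, neg_sub]
  · intro a
    by_cases ha : a = i
    · subst ha; simp [skewSingle, hij.symm]
    · simp [skewSingle, Ne.symm ha]
  · rw [skewSingle, mul_sub, lowProj_mul_single hi, lowProj_mul_single hj]
  · rw [skewSingle, sub_mul, single_mul_lowProj hj, single_mul_lowProj hi]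

variable {P : Submodule ℝ (Mat n 𝔽)}

/-- The diagonal matrix units arise from the others: `single i l z * skewSingle l i 1 = single i i z`. -/
theorem generate_of_off_diag
    (hz : ∀ X : Mat n 𝔽, star X = -X → (∀ i, X i i = 0) → X ∈ lieAlg K) (hk : 2 ≤ k) (hkn : k ≤ n)
    (hP : ∀ T ∈ P, ∀ B ∈ blockAlg K k, T * B ∈ P)
    (hoff : ∀ i j : Fin n, i ≠ j → n ≤ i.val + k → n ≤ j.val + k →
      ∀ z : 𝔽, Matrix.single i j z ∈ P)
    (i j : Fin n) (hi : n ≤ i.val + k) (hj : n ≤ j.val + k) (z : 𝔽) :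
    Matrix.single i j z ∈ P := by
  by_cases hij : i = j
  · subst hij
    obtain ⟨l, hl, hli⟩ : ∃ l : Fin n, n ≤ l.val + k ∧ i ≠ l := by
      by_cases h : i.val = n - 1
      · exact ⟨⟨n - 2, by omega⟩, by simp only; omega, fun h' => by
          have := congrArg Fin.val h'; simp only at this; omega⟩
      · exact ⟨⟨n - 1, by omega⟩, by simp only; omega, fun h' => h (congrArg Fin.val h')⟩
    have := hP _ (hoff i l hli hi hl z) _ (skewSingle_mem_blockAlg hz hli.symm hl hi 1)
    rwa [skewSingle, mul_sub, single_mul_single_same, single_mul_single_of_ne _ _ _ _ hli.symm,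
      sub_zero, mul_one] at this
  · exact hoff i j hij hi hj z

/-- For `k ≥ 3` the products of two skew-hermitian matrices in the lower block with zero diagonal contain
all matrices with a single entry off the diagonal. -/
theorem generate_of_three_le
    (hz : ∀ X : Mat n 𝔽, star X = -X → (∀ i, X i i = 0) → X ∈ lieAlg K) (hk : 3 ≤ k) (hkn : k ≤ n)
    (hB : ∀ B ∈ blockAlg K k, B ∈ P) (hP : ∀ T ∈ P, ∀ B ∈ blockAlg K k, T * B ∈ P)
    (i j : Fin n) (hi : n ≤ i.val + k) (hj : n ≤ j.val + k) (z : 𝔽) :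
    Matrix.single i j z ∈ P := by
  refine generate_of_off_diag hz (by omega) hkn hP (fun i j hij hi hj z => ?_) i j hi hj z
  obtain ⟨l, hl, hli, hlj⟩ : ∃ l : Fin n, n ≤ l.val + k ∧ l ≠ i ∧ l ≠ j := by
    have hne : i.val ≠ j.val := fun h => hij (Fin.ext h)
    by_cases h1 : i.val ≠ n - 1 ∧ j.val ≠ n - 1
    · exact ⟨⟨n - 1, by omega⟩, by simp only; omega, fun h' => h1.1 (congrArg Fin.val h').symm,
        fun h' => h1.2 (congrArg Fin.val h').symm⟩
    by_cases h2 : i.val ≠ n - 2 ∧ j.val ≠ n - 2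
    · exact ⟨⟨n - 2, by omega⟩, by simp only; omega, fun h' => h2.1 (congrArg Fin.val h').symm,
        fun h' => h2.2 (congrArg Fin.val h').symm⟩
    · refine ⟨⟨n - 3, by omega⟩, by simp only; omega, fun h' => ?_, fun h' => ?_⟩ <;>
      · have := congrArg Fin.val h'
        simp only at this
        omega
  have := hP _ (hB _ (skewSingle_mem_blockAlg hz hli hl hi 1)) _
    (skewSingle_mem_blockAlg hz hlj hl hj z)
  have h2 : skewSingle l i 1 * skewSingle l j z = -Matrix.single i j z := by
    simp only [skewSingle, sub_mul, mul_sub]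
    rw [single_mul_single_of_ne _ _ _ _ hli.symm, single_mul_single_of_ne _ _ _ _ hij,
      single_mul_single_same, single_mul_single_of_ne _ _ _ _ hlj]
    simp
  rw [h2] at this
  simpa using P.neg_mem this

theorem exp_mem_unitary_of_skew {X : Mat n 𝔽}
    (hX : star X = -X) : exp X ∈ unitary (Mat n 𝔽) := by
  rw [Unitary.mem_iff, NormedSpace.star_exp, hX]
  exact ⟨mat_exp_neg_mul_exp X, mat_exp_mul_exp_neg X⟩

theorem mem_lieAlg_of_skew {X : Mat n 𝔽}
    (hX : star X = -X)
    (h : ∀ t : ℝ, ∀ A : UGroup n 𝔽, (A : Mat n 𝔽) = exp (t • X) → A ∈ K) : X ∈ lieAlg K := by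
  intro t
  have ht : star (t • X) = -(t • X) := by rw [star_smul, hX, smul_neg]; rfl
  exact ⟨⟨_, exp_mem_unitary_of_skew ht⟩, h t _ rfl, rfl⟩

theorem star_lower_of_skew {X : Mat n 𝔽}
    (hX : star X = -X) : star (lowProj n 𝔽 k * X * lowProj n 𝔽 k) =
      -(lowProj n 𝔽 k * X * lowProj n 𝔽 k) := by
  rw [star_mul, star_mul, star_lowProj, hX]
  noncomm_ring

end Generate

section SO

variable {n k : ℕ}

theorem mem_SO {A : UGroup n ℝ} : A ∈ SO n ↔ (A : Mat n ℝ).det = 1 := by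
  change (A : Mat n ℝ) ∈ Matrix.specialOrthogonalGroup (Fin n) ℝ ↔ _
  rw [Matrix.mem_specialOrthogonalGroup_iff]
  exact and_iff_right A.2

/-- The determinant of `exp X = exp (X / 2) ^ 2` is a square of `±1`. -/
theorem mem_lieAlg_SO {X : Mat n ℝ} (hX : star X = -X) : X ∈ lieAlg (SO n) := by
  refine mem_lieAlg_of_skew hX fun t A hA => mem_SO.2 ?_
  have ht : star ((t / 2) • X) = -((t / 2) • X) := by rw [star_smul, hX, smul_neg]; rfl
  have h1 : t • X = (t / 2) • X + (t / 2) • X := by rw [← add_smul, add_halves]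
  have h2 := (exp_mem_unitary_of_skew ht).1
  have h3 := congrArg Matrix.det h2
  rw [Matrix.det_mul, Matrix.det_one, star_eq_conjTranspose, Matrix.det_conjTranspose] at h3
  rw [hA, h1, mat_exp_add rfl, Matrix.det_mul]
  simpa using h3

theorem isBlockGroup_SO (hk : 3 ≤ k) (hkn : k ≤ n) : IsBlockGroup (SO n) k where
  isClosed := by
    have : (SO n : Set (UGroup n ℝ)) = {A : UGroup n ℝ | (A : Mat n ℝ).det = 1} :=
      Set.ext fun A => mem_SO
    rw [this]
    exact isClosed_eq (Continuous.matrix_det continuous_subtype_val) continuous_const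
  two_le := by omega
  zero_diag := fun X hX _ => mem_lieAlg_SO hX
  split := fun Z hZ => ⟨lowProj n ℝ k * Z * lowProj n ℝ k,
    ⟨mem_lieAlg_SO (star_lower_of_skew (star_eq_neg_of_mem_lieAlg hZ)),
      by rw [← mul_assoc, ← mul_assoc, lowProj_mul_self], by rw [mul_assoc, lowProj_mul_self]⟩,
    fun B _ => by simp⟩
  generate := fun P hB hP i j hi hj z =>
    generate_of_three_le (fun X hX _ => mem_lieAlg_SO hX) hk hkn hB hP i j hi hj z

end SO

section SU

variable {n k : ℕ}

theorem mem_SU {A : UGroup n ℂ} : A ∈ SU n ↔ (A : Mat n ℂ).det = 1 := by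
  change (A : Mat n ℂ) ∈ Matrix.specialUnitaryGroup (Fin n) ℂ ↔ _
  rw [Matrix.mem_specialUnitaryGroup_iff]
  exact and_iff_right A.2

/-- Jacobi's formula for skew-hermitian matrices, from the spectral theorem for `i X`. -/
theorem det_exp_of_skew {X : Mat n ℂ} (hX : star X = -X) :
    (exp X).det = Complex.exp X.trace := by
  have hA : (Complex.I • X).IsHermitian := by
    rw [Matrix.IsHermitian, conjTranspose_smul, ← star_eq_conjTranspose, hX]
    simp
  set U := hA.eigenvectorUnitary
  set v : Fin n → ℂ := fun i => -Complex.I * hA.eigenvalues i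
  have hU : IsUnit (U : Mat n ℂ) := ⟨Unitary.toUnits U, rfl⟩
  have hUi : (U : Mat n ℂ)⁻¹ = star (U : Mat n ℂ) :=
    Matrix.inv_eq_left_inv (Unitary.star_mul_self_of_mem U.2)
  have h1 : X = (U : Mat n ℂ) * Matrix.diagonal v * (U : Mat n ℂ)⁻¹ := by
    have h := hA.spectral_theorem
    rw [Unitary.conjStarAlgAut_apply] at h
    have h2 : X = -Complex.I • (Complex.I • X) := by
      rw [smul_smul]; simp
    have h3 : Matrix.diagonal v = -Complex.I • Matrix.diagonal
        (RCLike.ofReal ∘ hA.eigenvalues : Fin n → ℂ) := by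
      rw [← Matrix.diagonal_smul]; rfl
    rw [h2, h, hUi, h3, mul_smul_comm, smul_mul_assoc]
  have hdet : ∀ M : Mat n ℂ, ((U : Mat n ℂ) * M * (U : Mat n ℂ)⁻¹).det = M.det := fun M =>
    Matrix.det_conj hU M
  have htr : X.trace = ∑ i, v i := by
    conv_lhs => rw [h1, Matrix.trace_mul_comm, ← mul_assoc,
      Matrix.nonsing_inv_mul _ ((Matrix.isUnit_iff_isUnit_det _).1 hU), one_mul,
      Matrix.trace_diagonal]
  rw [htr, Complex.exp_sum]
  conv_lhs => rw [h1, Matrix.exp_conj _ _ hU, hdet, Matrix.exp_diagonal, Matrix.det_diagonal]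
  exact Finset.prod_congr rfl fun i _ => by rw [Pi.coe_exp, Complex.exp_eq_exp_ℂ]

theorem mem_lieAlg_SU {X : Mat n ℂ} (hX : star X = -X) (h0 : X.trace = 0) : X ∈ lieAlg (SU n) := by
  refine mem_lieAlg_of_skew hX fun t A hA => mem_SU.2 ?_
  have ht : star (t • X) = -(t • X) := by rw [star_smul, hX, smul_neg]; rfl
  rw [hA, det_exp_of_skew ht, Matrix.trace_smul, h0, smul_zero, Complex.exp_zero]

theorem trace_lowProj (hkn : k ≤ n) : (lowProj n ℂ k).trace = k := by
  have h : ∀ i : Fin n, i.val + k < n ↔ i.val < n - k := fun i => by omega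
  rw [lowProj, Matrix.trace_diagonal]
  simp only [h]
  rw [Fin.sum_univ_eq_sum_range (fun i => if i < n - k then (0 : ℂ) else 1) n]
  rw [Finset.sum_ite, Finset.sum_const_zero, zero_add, Finset.sum_const, nsmul_one]
  have : (Finset.range n).filter (fun i => ¬ i < n - k) = Finset.Ico (n - k) n := by
    ext i; simp [and_comm]
  rw [this, Nat.card_Ico]
  congr 1; omega

theorem isBlockGroup_SU (hk : 3 ≤ k) (hkn : k ≤ n) : IsBlockGroup (SU n) k where
  isClosed := by
    have : (SU n : Set (UGroup n ℂ)) = {A : UGroup n ℂ | (A : Mat n ℂ).det = 1} :=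
      Set.ext fun A => mem_SU
    rw [this]
    exact isClosed_eq (Continuous.matrix_det continuous_subtype_val) continuous_const
  two_le := by omega
  zero_diag := fun X hX h0 => mem_lieAlg_SU hX (by simp [Matrix.trace, h0])
  split := by
    intro Z hZ
    set D := lowProj n ℂ k
    have hs := star_lower_of_skew (k := k) (star_eq_neg_of_mem_lieAlg hZ)
    set Y := D * Z * D with hY
    have hD : D * D = D := lowProj_mul_self
    have hD' : star D = D := star_lowProj
    have h1 : D * Y = Y := by rw [hY, ← mul_assoc, ← mul_assoc, hD]
    have h2 : Y * D = Y := by rw [hY, mul_assoc, hD]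
    set c : ℂ := Y.trace / k
    have hk0 : (k : ℂ) ≠ 0 := Nat.cast_ne_zero.2 (by omega)
    have hc : star c = -c := by
      have : star Y.trace = -Y.trace := by
        rw [← Matrix.trace_conjTranspose, ← star_eq_conjTranspose, hs, Matrix.trace_neg]
      simp only [c, star_div₀, this, star_natCast, neg_div]
    -- the lower block is made trace free by a multiple of `D`, which commutes with the block algebra
    refine ⟨Y - c • D, ⟨mem_lieAlg_SU ?_ ?_, ?_, ?_⟩, ?_⟩
    · rw [star_sub, star_smul, hs, hD', hc]; module
    · rw [Matrix.trace_sub, Matrix.trace_smul, trace_lowProj hkn, smul_eq_mul,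
        div_mul_cancel₀ _ hk0, sub_self]
    · rw [mul_sub, mul_smul_comm, h1, hD]
    · rw [sub_mul, smul_mul_assoc, h2, hD]
    · rintro B ⟨-, hB1, hB2⟩
      rw [sub_sub_cancel, mul_smul_comm, smul_mul_assoc, hB1, hB2]
  generate := fun P hB hP i j hi hj z =>
    generate_of_three_le (fun X hX h0 => mem_lieAlg_SU hX (by simp [Matrix.trace, h0])) hk hkn hB hP
      i j hi hj z

end SU

section Sp

/-- The imaginary unit of `ℂ ⊂ ℍ`. -/
def quatI : Quaternion ℝ := ⟨0, 1, 0, 0⟩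

theorem re_quatI : quatI.re = 0 := rfl
theorem imI_quatI : quatI.imI = 1 := rfl
theorem imJ_quatI : quatI.imJ = 0 := rfl
theorem imK_quatI : quatI.imK = 0 := rfl

theorem quatI_mul_self : quatI * quatI = -1 := by
  refine Quaternion.ext _ _ ?_ ?_ ?_ ?_ <;>
    simp [re_quatI, imI_quatI, imJ_quatI, imK_quatI, Quaternion.re_one, Quaternion.imI_one,
      Quaternion.imJ_one, Quaternion.imK_one]

variable {n k : ℕ}

theorem mem_lieAlg_Sp {X : Mat n (Quaternion ℝ)} (hX : star X = -X) : X ∈ lieAlg (Sp n) :=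
  mem_lieAlg_of_skew hX fun _ _ _ => Subgroup.mem_top _

theorem isBlockGroup_Sp (hk : 2 ≤ k) (hkn : k ≤ n) : IsBlockGroup (Sp n) k where
  isClosed := by
    rw [Sp, Subgroup.coe_top]
    exact isClosed_univ
  two_le := hk
  zero_diag := fun X hX _ => mem_lieAlg_Sp hX
  split := fun Z hZ => ⟨lowProj n _ k * Z * lowProj n _ k,
    ⟨mem_lieAlg_Sp (star_lower_of_skew (star_eq_neg_of_mem_lieAlg hZ)),
      by rw [← mul_assoc, ← mul_assoc, lowProj_mul_self], by rw [mul_assoc, lowProj_mul_self]⟩,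
    fun B _ => by simp⟩
  generate := by
    intro P hB hP i j hi hj z
    have hz : ∀ X : Mat n (Quaternion ℝ), star X = -X → (∀ i, X i i = 0) → X ∈ lieAlg (Sp n) :=
      fun X hX _ => mem_lieAlg_Sp hX
    refine generate_of_off_diag hz hk hkn hP (fun i j hij hi hj z => ?_) i j hi hj z
    -- the square of `single i i quatI` is the negative of an idempotent; multiplied by a matrix
    -- supported on `(i, j)` and `(j, i)` that idempotent leaves a single entry
    have hu : Matrix.single i i quatI ∈ blockAlg (Sp n) k := by
      refine ⟨mem_lieAlg_Sp ?_, lowProj_mul_single hi _, single_mul_lowProj hi _⟩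
      rw [star_eq_conjTranspose, conjTranspose_single, Quaternion.star_eq_neg.2 re_quatI,
        ← Matrix.single_neg]
    have h1 := hP _ (hP _ (hB _ hu) _ hu) _ (skewSingle_mem_blockAlg hz hij hi hj z)
    rw [single_mul_single_same, quatI_mul_self, skewSingle, mul_sub, single_mul_single_same,
      single_mul_single_of_ne _ _ _ _ hij, sub_zero, neg_one_mul, ← Matrix.single_neg] at h1
    simpa using P.neg_mem h1

end Sp

/-! ### Imaginary quaternions -/

section Quat

theorem exp_smul_of_unit {w : Quaternion ℝ} (hw : w.re = 0) (hn : ‖w‖ = 1) (θ : ℝ) :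
    exp (θ • w) = (Real.cos θ : Quaternion ℝ) + Real.sin θ • w := by
  have hre : (θ • w).re = 0 := by rw [Quaternion.re_smul, hw, smul_zero]
  rw [Quaternion.exp_of_re_eq_zero _ hre, norm_smul, hn, mul_one, Real.norm_eq_abs, Real.cos_abs,
    smul_smul]
  congr 2
  rcases eq_or_ne θ 0 with rfl | h
  · simp
  · rcases abs_cases θ with ⟨h1, -⟩ | ⟨h1, -⟩ <;> rw [h1]
    · field_simp
    · rw [Real.sin_neg]; field_simp

theorem norm_sq_eq (q : Quaternion ℝ) :
    ‖q‖ ^ 2 = q.re ^ 2 + q.imI ^ 2 + q.imJ ^ 2 + q.imK ^ 2 := by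
  rw [sq, ← Quaternion.normSq_eq_norm_mul_self, Quaternion.normSq_def']

theorem norm_quatI : ‖quatI‖ = 1 := by
  have := norm_sq_eq quatI
  rw [re_quatI, imI_quatI, imJ_quatI, imK_quatI] at this
  nlinarith [norm_nonneg quatI]

theorem exists_cos_sin {a b : ℝ} (h : a ^ 2 + b ^ 2 = 1) :
    ∃ θ : ℝ, Real.cos θ = a ∧ Real.sin θ = b := by
  have hn : ‖(⟨a, b⟩ : ℂ)‖ = 1 := by
    rw [Complex.norm_def, Complex.normSq_mk, ← sq, ← sq, h, Real.sqrt_one]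
  obtain ⟨θ, hθ⟩ := (Complex.norm_eq_one_iff _).1 hn
  refine ⟨θ, ?_, ?_⟩
  · rw [← Complex.exp_ofReal_mul_I_re, hθ]
  · rw [← Complex.exp_ofReal_mul_I_im, hθ]

/-- Every unit quaternion is the exponential of an imaginary one. -/
theorem exists_exp_eq {q : Quaternion ℝ} (hq : ‖q‖ = 1) :
    ∃ v : Quaternion ℝ, v.re = 0 ∧ exp v = q := by
  obtain ⟨w, s, hw, hn, hs⟩ : ∃ (w : Quaternion ℝ) (s : ℝ), w.re = 0 ∧ ‖w‖ = 1 ∧ q.im = s • w := by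
    rcases eq_or_ne q.im 0 with h | h
    · exact ⟨quatI, 0, rfl, norm_quatI, by rw [h, zero_smul]⟩
    · have h' := norm_ne_zero_iff.2 h
      refine ⟨‖q.im‖⁻¹ • q.im, ‖q.im‖, ?_, ?_, ?_⟩
      · rw [Quaternion.re_smul, Quaternion.re_im, smul_zero]
      · rw [norm_smul, norm_inv, norm_norm, inv_mul_cancel₀ h']
      · rw [smul_smul, mul_inv_cancel₀ h', one_smul]
  have h1 : q.re ^ 2 + s ^ 2 = 1 := by
    have h2 := norm_sq_eq q
    have h3 := norm_sq_eq q.im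
    rw [hs, norm_smul, hn, mul_one, Real.norm_eq_abs, sq_abs, ← hs, Quaternion.re_im,
      Quaternion.imI_im, Quaternion.imJ_im, Quaternion.imK_im] at h3
    rw [hq] at h2
    linarith
  obtain ⟨θ, hc, hsn⟩ := exists_cos_sin h1
  refine ⟨θ • w, by rw [Quaternion.re_smul, hw, smul_zero], ?_⟩
  rw [exp_smul_of_unit hw hn, hc, hsn, ← hs, Quaternion.re_add_im]

/-- Every imaginary quaternion is conjugate to an imaginary complex number. -/
theorem exists_conj_quatI {z : Quaternion ℝ} (hz : z.re = 0) :
    ∃ u : Quaternion ℝ, ‖u‖ = 1 ∧ z * u = u * (‖z‖ • quatI) := by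
  suffices h : ∃ u : Quaternion ℝ, u ≠ 0 ∧ z * u = u * (‖z‖ • quatI) by
    obtain ⟨u, hu, h⟩ := h
    have hu' := norm_ne_zero_iff.2 hu
    refine ⟨‖u‖⁻¹ • u, by rw [norm_smul, norm_inv, norm_norm, inv_mul_cancel₀ hu'], ?_⟩
    rw [mul_smul_comm, smul_mul_assoc, h]
  have hzz : z * z = -((‖z‖ ^ 2) • 1) := by
    have h := star_mul_self z
    rw [Quaternion.star_eq_neg.2 hz, neg_mul, Algebra.algebraMap_eq_smul_one] at h
    rw [← h, neg_neg]
  by_cases h : z + ‖z‖ • quatI = 0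
  · -- here `z` is a negative multiple of `i`, and conjugation by `j` changes the sign
    obtain ⟨u, h1, h2, h3, h4⟩ : ∃ u : Quaternion ℝ, u.re = 0 ∧ u.imI = 0 ∧ u.imJ = 1 ∧ u.imK = 0 :=
      ⟨⟨0, 0, 1, 0⟩, rfl, rfl, rfl, rfl⟩
    have hu : -quatI * u = u * quatI := by
      refine Quaternion.ext _ _ ?_ ?_ ?_ ?_ <;>
        simp [re_quatI, imI_quatI, imJ_quatI, imK_quatI, h1, h2, h3, h4]
    refine ⟨u, fun h' => ?_, ?_⟩
    · rw [h', Quaternion.imJ_zero] at h3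
      exact zero_ne_one h3
    · have hz' := eq_neg_of_add_eq_zero_left h
      conv_lhs => rw [hz', ← smul_neg, smul_mul_assoc, hu]
      rw [mul_smul_comm]
  · refine ⟨z + ‖z‖ • quatI, h, ?_⟩
    rw [mul_add, add_mul, hzz, smul_mul_smul_comm, quatI_mul_self, smul_neg, ← sq, add_comm]

/-- An expression of an imaginary quaternion through two imaginary quaternions and their commutator. -/
theorem exists_norm_sq_commutator_smul_eq {z w v : Quaternion ℝ} (hz : z.re = 0) (hw : w.re = 0)
    (hv : v.re = 0) : ∃ a b c : ℝ,
      (‖z * w - w * z‖ ^ 2) • v = a • z + b • w + c • (z * w - w * z) := by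
  refine ⟨4 * ((v.imI * z.imI + v.imJ * z.imJ + v.imK * z.imK) *
      (w.imI ^ 2 + w.imJ ^ 2 + w.imK ^ 2) -
      (v.imI * w.imI + v.imJ * w.imJ + v.imK * w.imK) *
      (z.imI * w.imI + z.imJ * w.imJ + z.imK * w.imK)),
    4 * ((v.imI * w.imI + v.imJ * w.imJ + v.imK * w.imK) *
      (z.imI ^ 2 + z.imJ ^ 2 + z.imK ^ 2) -
      (v.imI * z.imI + v.imJ * z.imJ + v.imK * z.imK) *
      (z.imI * w.imI + z.imJ * w.imJ + z.imK * w.imK)),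
    2 * (v.imI * (z.imJ * w.imK - z.imK * w.imJ) + v.imJ * (z.imK * w.imI - z.imI * w.imK) +
      v.imK * (z.imI * w.imJ - z.imJ * w.imI)), ?_⟩
  rw [norm_sq_eq]
  refine Quaternion.ext _ _ ?_ ?_ ?_ ?_ <;>
    simp only [Quaternion.re_smul, Quaternion.imI_smul, Quaternion.imJ_smul, Quaternion.imK_smul,
      Quaternion.re_add, Quaternion.imI_add, Quaternion.imJ_add, Quaternion.imK_add,
      Quaternion.re_sub, Quaternion.imI_sub, Quaternion.imJ_sub, Quaternion.imK_sub,
      Quaternion.re_mul, Quaternion.imI_mul, Quaternion.imJ_mul, Quaternion.imK_mul, hz, hw, hv,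
      smul_eq_mul] <;> ring

theorem eq_smul_of_commute {z w : Quaternion ℝ} (hz : z.re = 0) (hz0 : z ≠ 0) (hw : w.re = 0)
    (h : z * w - w * z = 0) : ∃ c : ℝ, w = c • z := by
  have hn : ‖z‖ ^ 2 ≠ 0 := pow_ne_zero 2 (norm_ne_zero_iff.2 hz0)
  have h1 := congrArg (fun q : Quaternion ℝ => q.imI) h
  have h2 := congrArg (fun q : Quaternion ℝ => q.imJ) h
  have h3 := congrArg (fun q : Quaternion ℝ => q.imK) h
  simp only [Quaternion.imI_sub, Quaternion.imJ_sub, Quaternion.imK_sub, Quaternion.imI_mul,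
    Quaternion.imJ_mul, Quaternion.imK_mul, hz, hw, Quaternion.imI_zero, Quaternion.imJ_zero,
    Quaternion.imK_zero] at h1 h2 h3
  refine ⟨(z.imI * w.imI + z.imJ * w.imJ + z.imK * w.imK) / ‖z‖ ^ 2, ?_⟩
  rw [div_eq_inv_mul, mul_smul, eq_inv_smul_iff₀ hn, norm_sq_eq, hz]
  refine Quaternion.ext _ _ ?_ ?_ ?_ ?_ <;>
    simp only [Quaternion.re_smul, Quaternion.imI_smul, Quaternion.imJ_smul, Quaternion.imK_smul,
      hz, hw, smul_eq_mul]
  · ring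
  · linear_combination z.imJ / 2 * -h3 + z.imK / 2 * h2
  · linear_combination z.imI / 2 * h3 - z.imK / 2 * h1
  · linear_combination z.imJ / 2 * h1 - z.imI / 2 * h2

end Quat

/-! ### The subgroups of codimension one -/

section Classification

variable {n : ℕ}

theorem eq_block_SO {H : Subgroup (UGroup n ℝ)} {e : Fin n} (he : e.val = 0) (hHK : H ≤ SO n)
    (hH : IsClosed (H : Set (UGroup n ℝ))) (hc : IsConnected (H : Set (UGroup n ℝ)))
    (hbl : block (SO n) (n - 1) ≤ H)
    (hdiag : ∀ Z ∈ lieAlg H, (1 - lowProj n ℝ (n - 1)) * Z * lowProj n ℝ (n - 1) = 0) :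
    H = block (SO n) (n - 1) :=
  eq_block_of_apply_eq_zero he hH hc hHK hbl hdiag fun Z hZ => by
    have := congrFun (congrFun (star_eq_neg_of_mem_lieAlg hZ) e) e
    rw [Matrix.star_apply, star_trivial, Matrix.neg_apply] at this
    linarith

theorem eq_block_or_eq_splitBlock_SU {H : Subgroup (UGroup n ℂ)} {e : Fin n} (he : e.val = 0)
    (hHK : H ≤ SU n) (hH : IsClosed (H : Set (UGroup n ℂ)))
    (hc : IsConnected (H : Set (UGroup n ℂ))) (hbl : block (SU n) (n - 1) ≤ H)
    (hdiag : ∀ Z ∈ lieAlg H, (1 - lowProj n ℂ (n - 1)) * Z * lowProj n ℂ (n - 1) = 0) :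
    H = block (SU n) (n - 1) ∨ H = splitBlock (SU n) := by
  by_cases h0 : ∀ Z ∈ lieAlg H, Z e e = 0
  · exact Or.inl (eq_block_of_apply_eq_zero he hH hc hHK hbl hdiag h0)
  push Not at h0
  obtain ⟨Z, hZ, hZ0⟩ := h0
  have hle := le_splitBlock he hH hc hHK hdiag
  -- the exponentials of the multiples of the imaginary number `Z e e` fill the unit circle
  refine Or.inr (le_antisymm hle fun A hA => ?_)
  obtain ⟨θ, hθ⟩ := (Complex.norm_eq_one_iff _).1 (norm_apply_of_mem_splitBlock he hA)
  have hre : (Z e e).re = 0 := by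
    have := congrArg Complex.re (congrFun (congrFun (star_eq_neg_of_mem_lieAlg hZ) e) e)
    simp only [Matrix.star_apply, RCLike.star_def, Complex.conj_re, Matrix.neg_apply,
      Complex.neg_re] at this
    linarith
  have him : (Z e e).im ≠ 0 := fun h => hZ0 (Complex.ext hre h)
  refine mem_of_exp_apply_eq he hle hbl hdiag hA
    ((lieSub hH).smul_mem (θ / (Z e e).im) (show Z ∈ lieSub hH from hZ)) ?_
  rw [← hθ, ← Complex.exp_eq_exp_ℂ, Matrix.smul_apply]
  congr 1
  apply Complex.ext <;> simp [hre, him]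

theorem mul_apply_of_mem_splitBlock {K : Subgroup (UGroup n (Quaternion ℝ))} {e : Fin n}
    (he : e.val = 0) {A B : UGroup n (Quaternion ℝ)} (hA : A ∈ splitBlock K) :
    ((A * B : UGroup n (Quaternion ℝ)) : Mat n (Quaternion ℝ)) e e =
      (A : Mat n (Quaternion ℝ)) e e * (B : Mat n (Quaternion ℝ)) e e := by
  rw [coe_mul, Matrix.mul_apply]
  refine Finset.sum_eq_single e (fun m _ hm => ?_) (fun h => absurd (Finset.mem_univ e) h)
  rw [(hA.2 e m he fun h => hm (Fin.ext (h.trans he.symm))).1, zero_mul]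

theorem exists_mem_splitBlock_apply_eq (e : Fin n) {u : Quaternion ℝ} (hu : ‖u‖ = 1) :
    ∃ g ∈ splitBlock (Sp n), (g : Mat n (Quaternion ℝ)) e e = u := by
  have h1 : star u * u = 1 := by rw [star_mul_self, hu, one_pow, map_one]
  have h2 : u * star u = 1 := by
    have := star_mul_self (star u)
    rwa [star_star, Quaternion.norm_star, hu, one_pow, map_one] at this
  set M : Mat n (Quaternion ℝ) := Matrix.diagonal fun i => if i = e then u else 1
  have hM : M ∈ unitary (Mat n (Quaternion ℝ)) := by
    rw [Unitary.mem_iff, star_eq_conjTranspose, diagonal_conjTranspose, diagonal_mul_diagonal,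
      diagonal_mul_diagonal, ← diagonal_one]
    constructor <;> congr 1 <;> funext i <;> by_cases hi : i = e <;> simp [hi, h1, h2]
  refine ⟨⟨M, hM⟩, ⟨Subgroup.mem_top _, fun i j hi hj => ?_⟩, by simp [M]⟩
  have hij : i ≠ j := fun h => hj (h ▸ hi)
  exact ⟨diagonal_apply_ne _ hij, diagonal_apply_ne _ hij.symm⟩

/-- The first diagonal entries of the elements of the Lie algebra of `H` form a subalgebra of the
imaginary quaternions: zero, a line, or everything. A line can be rotated to `ℝ i`. -/
theorem eq_block_or_eq_splitBlock_or_isConjugateIn_spU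
    {H : Subgroup (UGroup n (Quaternion ℝ))} {e : Fin n} (he : e.val = 0)
    (hH : IsClosed (H : Set (UGroup n (Quaternion ℝ))))
    (hc : IsConnected (H : Set (UGroup n (Quaternion ℝ)))) (hbl : block (Sp n) (n - 1) ≤ H)
    (hdiag : ∀ Z ∈ lieAlg H,
      (1 - lowProj n (Quaternion ℝ) (n - 1)) * Z * lowProj n (Quaternion ℝ) (n - 1) = 0) :
    H = block (Sp n) (n - 1) ∨ H = splitBlock (Sp n) ∨ IsConjugateIn (Sp n) H (spU n) := by
  have hHK : H ≤ Sp n := le_top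
  by_cases h0 : ∀ Z ∈ lieAlg H, Z e e = 0
  · exact Or.inl (eq_block_of_apply_eq_zero he hH hc hHK hbl hdiag h0)
  push Not at h0
  obtain ⟨Z, hZ, hZ0⟩ := h0
  have hle := le_splitBlock he hH hc hHK hdiag
  have hre : ∀ Z ∈ lieAlg H, (Z e e).re = 0 := by
    intro Z hZ
    have := congrFun (congrFun (star_eq_neg_of_mem_lieAlg hZ) e) e
    exact Quaternion.star_eq_neg.1 this
  have hcol : ∀ Z ∈ lieAlg H, ∀ i ≠ e, Z e i = 0 ∧ Z i e = 0 := fun Z hZ i hi =>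
    row_eq_zero he (hdiag Z hZ) (star_eq_neg_of_mem_lieAlg hZ) hi
  have hmul : ∀ Z ∈ lieAlg H, ∀ W : Mat n (Quaternion ℝ), (Z * W) e e = Z e e * W e e := by
    intro Z hZ W
    rw [Matrix.mul_apply]
    exact Finset.sum_eq_single e (fun m _ hm => by rw [(hcol Z hZ m hm).1, zero_mul])
      (fun h => absurd (Finset.mem_univ e) h)
  -- all entries are multiples of `Z e e` iff they commute with it
  by_cases hcomm : ∀ W ∈ lieAlg H, Z e e * W e e - W e e * Z e e = 0
  · refine Or.inr (Or.inr ?_)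
    obtain ⟨u, hu, hzu⟩ := exists_conj_quatI (hre Z hZ)
    obtain ⟨g, hg, hgu⟩ := exists_mem_splitBlock_apply_eq e hu
    have hnz := norm_ne_zero_iff.2 hZ0
    have hconj : ∀ t : ℝ, exp (t • Z e e) * u = u * exp ((t * ‖Z e e‖) • quatI) := fun t =>
      exp_mul_eq_mul_exp (by rw [smul_mul_assoc, hzu, ← mul_smul_comm, smul_smul])
    have hginv : ((g⁻¹ : UGroup n (Quaternion ℝ)) : Mat n (Quaternion ℝ)) e e * u = 1 := by
      rw [← hgu, ← mul_apply_of_mem_splitBlock he ((splitBlock _).inv_mem hg), inv_mul_cancel]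
      exact Matrix.one_apply_eq e
    have hginv' : u * ((g⁻¹ : UGroup n (Quaternion ℝ)) : Mat n (Quaternion ℝ)) e e = 1 := by
      rw [← hgu, ← mul_apply_of_mem_splitBlock he hg, mul_inv_cancel]
      exact Matrix.one_apply_eq e
    refine ⟨g, Subgroup.mem_top _, le_antisymm ?_ ?_⟩
    · refine le_of_exp_lieAlg hH hc fun W hW => ?_
      obtain ⟨A, hA, hAW⟩ := exists_coe_eq_exp hW
      have hA' := hle hA
      have hAg := (splitBlock (Sp n)).mul_mem ((splitBlock (Sp n)).inv_mem hg) hA'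
      refine mem_matSubmonoid.2 ⟨A, mem_conjugate.2
        ⟨(splitBlock (Sp n)).mul_mem hAg hg, fun i hi => ?_⟩, hAW⟩
      obtain rfl : i = e := Fin.ext (hi.trans he.symm)
      obtain ⟨c, hcW⟩ := eq_smul_of_commute (hre Z hZ) hZ0 (hre W hW) (hcomm W hW)
      rw [mul_apply_of_mem_splitBlock he hAg,
        mul_apply_of_mem_splitBlock he ((splitBlock (Sp n)).inv_mem hg), hgu, hAW,
        exp_apply_of_col_eq_zero fun l hl => (hcol W hW l hl).2, hcW, mul_assoc, hconj, ← mul_assoc,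
        hginv, one_mul, exp_smul_of_unit re_quatI norm_quatI]
      constructor <;> simp [imJ_quatI, imK_quatI]
    · intro A hA
      rw [mem_conjugate] at hA
      obtain ⟨hB, hB'⟩ := hA
      set B := g⁻¹ * A * g with hBdef
      have hAB : A = g * B * g⁻¹ := by rw [hBdef]; group
      have hgB := (splitBlock (Sp n)).mul_mem hg hB
      have hA' : A ∈ splitBlock (Sp n) := by
        rw [hAB]
        exact (splitBlock (Sp n)).mul_mem hgB ((splitBlock (Sp n)).inv_mem hg)
      have hBn := norm_sq_eq ((B : Mat n (Quaternion ℝ)) e e)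
      rw [norm_apply_of_mem_splitBlock he hB, (hB' e he).1, (hB' e he).2] at hBn
      obtain ⟨θ, hcos, hsin⟩ := exists_cos_sin
        (a := ((B : Mat n (Quaternion ℝ)) e e).re) (b := ((B : Mat n (Quaternion ℝ)) e e).imI)
        (by linarith)
      have hBe : (B : Mat n (Quaternion ℝ)) e e = exp (θ • quatI) := by
        rw [exp_smul_of_unit re_quatI norm_quatI]
        refine Quaternion.ext _ _ ?_ ?_ ?_ ?_ <;>
          simp [re_quatI, imI_quatI, imJ_quatI, imK_quatI, hcos, hsin, hB' e he]
      refine mem_of_exp_apply_eq he hle hbl hdiag hA'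
        ((lieSub hH).smul_mem (θ / ‖Z e e‖) (show Z ∈ lieSub hH from hZ)) ?_
      rw [hAB, mul_apply_of_mem_splitBlock he hgB,
        mul_apply_of_mem_splitBlock he hg, hgu, hBe, Matrix.smul_apply]
      have h1 := hconj (θ / ‖Z e e‖)
      rw [div_mul_cancel₀ _ hnz] at h1
      rw [← h1, mul_assoc, hginv', mul_one]
  · push Not at hcomm
    -- otherwise `Z e e`, some `W e e` and their commutator span the imaginary quaternions
    obtain ⟨W, hW, hne⟩ := hcomm
    refine Or.inr (Or.inl (le_antisymm hle fun A hA => ?_))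
    obtain ⟨v, hv, hvA⟩ := exists_exp_eq (norm_apply_of_mem_splitBlock he hA)
    obtain ⟨a, b, c, habc⟩ := exists_norm_sq_commutator_smul_eq (hre Z hZ) (hre W hW) hv
    have hn : ‖Z e e * W e e - W e e * Z e e‖ ^ 2 ≠ 0 := pow_ne_zero 2 (norm_ne_zero_iff.2 hne)
    have hbr : Z * W - W * Z ∈ lieSub hH := lieAlg_bracket hH hZ hW
    refine mem_of_exp_apply_eq he hle hbl hdiag hA
      ((lieSub hH).smul_mem (‖Z e e * W e e - W e e * Z e e‖ ^ 2)⁻¹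
        ((lieSub hH).add_mem ((lieSub hH).add_mem
          ((lieSub hH).smul_mem a (show Z ∈ lieSub hH from hZ))
          ((lieSub hH).smul_mem b (show W ∈ lieSub hH from hW)))
          ((lieSub hH).smul_mem c hbr))) ?_
    rw [← hvA]
    congr 1
    rw [Matrix.smul_apply, inv_smul_eq_iff₀ hn, habc, Matrix.add_apply, Matrix.add_apply,
      Matrix.smul_apply, Matrix.smul_apply, Matrix.smul_apply, Matrix.sub_apply, hmul Z hZ,
      hmul W hW]

end Classification

/-! ### The classification -/

section Main

theorem classification_SO (n k : ℕ) (H : Subgroup (UGroup n ℝ)) (hk : 3 ≤ k) (hkn : k ≤ n)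
    (hlt : H < SO n) (hH : IsClosed (H : Set (UGroup n ℝ))) (hc : IsConnected (H : Set (UGroup n ℝ)))
    (hbl : block (SO n) k ≤ H) (hpos : AdmitsPositiveCurvature (SO n) H) :
    (∃ g ∈ SO n, conjugate g (block (SO n) (n - 1)) ≤ H) ∧
      IsConjugateIn (SO n) H (block (SO n) (n - 1)) := by
  obtain ⟨g, hg, hb, hdiag⟩ := exists_conjugate_block_pred
    (fun m hm hmn => isBlockGroup_SO (hk.trans hm) hmn) hH hlt hkn hbl hpos
  refine ⟨⟨g, hg, conjugate_le_iff.2 hb⟩, isConjugateIn_of_conjugate hg (isConjugateIn_of_eq ?_)⟩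
  exact eq_block_SO (e := ⟨0, by omega⟩) rfl (conjugate_le hlt.le ((SO n).inv_mem hg))
    (isClosed_conjugate hH _) (isConnected_conjugate hc _) hb hdiag

theorem classification_SU (n k : ℕ) (H : Subgroup (UGroup n ℂ)) (hk : 3 ≤ k) (hkn : k ≤ n)
    (hlt : H < SU n) (hH : IsClosed (H : Set (UGroup n ℂ))) (hc : IsConnected (H : Set (UGroup n ℂ)))
    (hbl : block (SU n) k ≤ H) (hpos : AdmitsPositiveCurvature (SU n) H) :
    (∃ g ∈ SU n, conjugate g (block (SU n) (n - 1)) ≤ H) ∧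
      (IsConjugateIn (SU n) H (block (SU n) (n - 1)) ∨
        IsConjugateIn (SU n) H (splitBlock (SU n))) := by
  obtain ⟨g, hg, hb, hdiag⟩ := exists_conjugate_block_pred
    (fun m hm hmn => isBlockGroup_SU (hk.trans hm) hmn) hH hlt hkn hbl hpos
  refine ⟨⟨g, hg, conjugate_le_iff.2 hb⟩, ?_⟩
  exact (eq_block_or_eq_splitBlock_SU (e := ⟨0, by omega⟩) rfl
    (conjugate_le hlt.le ((SU n).inv_mem hg)) (isClosed_conjugate hH _)
    (isConnected_conjugate hc _) hb hdiag).imp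
      (fun h => isConjugateIn_of_conjugate hg (isConjugateIn_of_eq h))
      (fun h => isConjugateIn_of_conjugate hg (isConjugateIn_of_eq h))

theorem classification_Sp (n k : ℕ) (H : Subgroup (UGroup n (Quaternion ℝ))) (hk : 2 ≤ k) (hkn : k ≤ n)
    (hlt : H < Sp n) (hH : IsClosed (H : Set (UGroup n (Quaternion ℝ))))
    (hc : IsConnected (H : Set (UGroup n (Quaternion ℝ))))
    (hbl : block (Sp n) k ≤ H) (hpos : AdmitsPositiveCurvature (Sp n) H) :
    (∃ g ∈ Sp n, conjugate g (block (Sp n) (n - 1)) ≤ H) ∧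
      (IsConjugateIn (Sp n) H (block (Sp n) (n - 1)) ∨
        IsConjugateIn (Sp n) H (splitBlock (Sp n)) ∨
        IsConjugateIn (Sp n) H (spU n)) := by
  obtain ⟨g, hg, hb, hdiag⟩ := exists_conjugate_block_pred
    (fun m hm hmn => isBlockGroup_Sp (hk.trans hm) hmn) hH hlt hkn hbl hpos
  refine ⟨⟨g, hg, conjugate_le_iff.2 hb⟩, ?_⟩
  exact (eq_block_or_eq_splitBlock_or_isConjugateIn_spU (e := ⟨0, by omega⟩) rfl
    (isClosed_conjugate hH _) (isConnected_conjugate hc _) hb hdiag).imp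
      (fun h => isConjugateIn_of_conjugate hg (isConjugateIn_of_eq h))
      (Or.imp (fun h => isConjugateIn_of_conjugate hg (isConjugateIn_of_eq h))
        (isConjugateIn_of_conjugate hg))

end Main

end BlockLemma

open BlockLemma in
theorem mainTheorem3 :
    (∀ (n k : ℕ) (H : Subgroup (UGroup n ℝ)), 3 ≤ k → k ≤ n → H < SO n →
      IsClosed (H : Set (UGroup n ℝ)) → IsConnected (H : Set (UGroup n ℝ)) →
      block (SO n) k ≤ H → AdmitsPositiveCurvature (SO n) H →
        (∃ g ∈ SO n, conjugate g (block (SO n) (n - 1)) ≤ H) ∧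
        IsConjugateIn (SO n) H (block (SO n) (n - 1))) ∧
    (∀ (n k : ℕ) (H : Subgroup (UGroup n ℂ)), 3 ≤ k → k ≤ n → H < SU n →
      IsClosed (H : Set (UGroup n ℂ)) → IsConnected (H : Set (UGroup n ℂ)) →
      block (SU n) k ≤ H → AdmitsPositiveCurvature (SU n) H →
        (∃ g ∈ SU n, conjugate g (block (SU n) (n - 1)) ≤ H) ∧
        (IsConjugateIn (SU n) H (block (SU n) (n - 1)) ∨
          IsConjugateIn (SU n) H (splitBlock (SU n)))) ∧
    (∀ (n k : ℕ) (H : Subgroup (UGroup n (Quaternion ℝ))), 2 ≤ k → k ≤ n → H < Sp n →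
      IsClosed (H : Set (UGroup n (Quaternion ℝ))) →
      IsConnected (H : Set (UGroup n (Quaternion ℝ))) →
      block (Sp n) k ≤ H → AdmitsPositiveCurvature (Sp n) H →
        (∃ g ∈ Sp n, conjugate g (block (Sp n) (n - 1)) ≤ H) ∧
        (IsConjugateIn (Sp n) H (block (Sp n) (n - 1)) ∨
          IsConjugateIn (Sp n) H (splitBlock (Sp n)) ∨
          IsConjugateIn (Sp n) H (spU n))) := by
  exact ⟨classification_SO, classification_SU, classification_Sp⟩
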